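/- **Proposition 3.5 (Kupka–Smale).** Let $M$ be a compact smooth manifold without boundary, $\dim M=d\ge 3$, let $X$ be a $C^1$ vector field on $M$ and $(\varphi_t)_{t\in\mathbb R}$ the $C^1$ flow generated by $X$. Let $D,\hat D\subset M$ be smooth (embedded, not necessarily compact) submanifolds of codimension one, with possibly empty boundaries $\partial D,\partial\hat D$ (in the sense of manifolds with boundary), both transversal to $X$, such that $D\cap\hat D=\emptyset$ and $X$ has no zero in the closure $\overline D$. *The space of impulses.* Let $\mathscr I_{D,\hat D}$ be the set of $C^1$ diffeomorphisms $I:D\to\hat D$, with the topology of the $C^1$ distance $$d_{C^1}(I,J)=\max\Big\{\sup_{x\in D}d(I(x),J(x)),\ \sup_{x\in D}\|DI(x)-DJ(x)\|\Big\}\in[0,\infty],$$ where $M$ is regarded as a submanifold of some $\mathbb R^m$ through a fixed (arbitrary) smooth embedding, which is used to measure distances and tangent vectors and to compare tangent vectors at different points. *The impulsive semiflow.* For $x\in M$ let $\tau_1(x)=\inf\{t>0:\varphi_t(x)\in D\}\in[0,+\infty]$ ($+\infty$ if there is no such $t$). For $I\in\mathscr I_{D,\hat D}$ the impulsive trajectory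 $\gamma_x$ is given by $\tau_0(x)=0$, $\gamma_x(0)=x$, $\tau_{k+1}(x)=\tau_k(x)+\tau_1(\gamma_x(\tau_k(x)))$, $$\gamma_x(t)=\varphi_{t-\tau_k(x)}\big(\gamma_x(\tau_k(x))\big)\ \text{ for }\tau_k(x)\le t<\tau_{k+1}(x),\qquad \gamma_x(\tau_{k+1}(x))=I\Big(\varphi_{\tau_{k+1}(x)-\tau_k(x)}\big(\gamma_x(\tau_k(x))\big)\Big)\ \text{ if }\tau_{k+1}(x)<\infty;$$ it is continued for as long as these formulas make sense, that is, as long as the infimum $\tau_1$ is attained whenever it is finite (which is automatic if $D$ is compact). Put $\psi_I(t,x)=\gamma_x(t)$. A $\psi_I$-periodic orbit is a set $\gamma=\{\gamma_x(t):t\ge 0\}$, where $x\in M$ is such that $\gamma_x(T)=x$ for some $T>0$. *Hyperbolicity.* Let $P_I(x)=I(\varphi_{\tau_1(x)}(x))$ for those $x\in\hat D$ for which $\tau_1(x)$ is finite and attained. A $\psi_I$-periodic orbit $\gamma$ is hyperbolic if $\gamma\cap\partial\hat D=\emptyset$ and there are $N\ge1$, points $x_1,\dots,x_N\in\gamma\cap\hat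 D$ and open neighbourhoods $V_i\subset\hat D$ of $x_i$ such that $P_I$ is defined and $C^1$ on each $V_i$, $x_{i+1}=P_I(x_i)$ for $1\le i\le N-1$, $x_1=P_I(x_N)$, and $x_1$ is a hyperbolic fixed point of $P_I^N$, i.e. $D(P_I^N)(x_1)$ has no complex eigenvalue of modulus $1$. *Claim.* There is a Baire residual set $\mathscr R_{per}\subset\mathscr I_{D,\hat D}$ (a set containing a countable intersection of open dense subsets) such that for every $I\in\mathscr R_{per}$, every $\psi_I$-periodic orbit $\gamma$ with $\overline\gamma\cap(D\setminus\partial D)\neq\emptyset$ is hyperbolic. -/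

import Mathlib

open Set
open scoped Manifold ContDiff ENNReal

noncomputable section

namespace Impulsive

/-! ### The flow and the cross-sections

`M` is a manifold of dimension `n + 1`; a cross-section is an abstract manifold with (possibly
empty) boundary `D` of dimension `n`, together with a smooth embedding `ι : D → M`. -/

section Flow

variable {n : ℕ} {M : Type*} [TopologicalSpace M]
  [ChartedSpace (EuclideanSpace ℝ (Fin (n + 1))) M]
  [IsManifold (𝓡 (n + 1)) ∞ M]

/-- `X` is a `C¹` vector field and `φ` is the `C¹` flow that it generates. -/
structure IsC1FlowOf (X : ∀ p : M, TangentSpace (𝓡 (n + 1)) p) (φ : Flow ℝ M) : Prop where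
  contMDiff_field : ContMDiff (𝓡 (n + 1)) (𝓡 (n + 1)).tangent 1
    (fun p => (⟨p, X p⟩ : TangentBundle (𝓡 (n + 1)) M))
  contMDiff_flow : ContMDiff (𝓘(ℝ, ℝ).prod (𝓡 (n + 1))) (𝓡 (n + 1)) 1
    (fun q : ℝ × M => φ q.1 q.2)
  isMIntegralCurve : ∀ p : M, IsMIntegralCurve (I := 𝓡 (n + 1)) (fun t : ℝ => φ t p) X

/-- `ι : D → M` presents a smooth submanifold (with boundary) of codimension one of `M` that is
transversal to the vector field `X`: at no point of `D` is `X` tangent to `D`. -/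
structure IsCrossSection [NeZero n] {D : Type*} [TopologicalSpace D]
    [ChartedSpace (EuclideanHalfSpace n) D]
    (X : ∀ p : M, TangentSpace (𝓡 (n + 1)) p) (ι : D → M) : Prop where
  isSmoothEmbedding : Manifold.IsSmoothEmbedding (𝓡∂ n) (𝓡 (n + 1)) ∞ ι
  transversal : ∀ y : D, X (ι y) ∉ range (mfderiv (𝓡∂ n) (𝓡 (n + 1)) ι y)

end Flow

/-! ### The impulsive semiflow -/

section Semiflow

variable {M D D' : Type*} [TopologicalSpace M]

/-- The first hitting time `τ₁(p) = inf {t > 0 | φ_t(p) ∈ S}`, with value `⊤` if there is no such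
`t`. -/
def hittingTime (φ : Flow ℝ M) (S : Set M) (p : M) : EReal :=
  sInf ((fun t : ℝ => (t : EReal)) '' {t : ℝ | 0 < t ∧ φ t p ∈ S})

/-- `ImpulseState φ ι ι' I p s z` says that `(s, z)` is one of the pairs `(τ_k(p), γ_p(τ_k(p)))`,
`k ≥ 0`, where `τ_0(p) = 0` and `γ_p(0) = p`: the next impulsive time is
`τ_k + τ₁(γ_p(τ_k))`, and there the point of `D` that has been reached is replaced by its image
under the impulse `I : D → D'`. -/
inductive ImpulseState (φ : Flow ℝ M) (ι : D → M) (ι' : D' → M) (I : D → D') (p : M) :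
    ℝ → M → Prop
  | start : ImpulseState φ ι ι' I p 0 p
  | impulse {s t : ℝ} {z : M} {y : D} (h : ImpulseState φ ι ι' I p s z)
      (ht : hittingTime φ (range ι) z = (t : EReal)) (hy : φ t z = ι y) :
      ImpulseState φ ι ι' I p (s + t) (ι' (I y))

/-- `Reaches φ ι ι' I p t q` says that the impulsive trajectory `γ_p` is defined at time `t` and
`γ_p(t) = q`, i.e. `q = ψ_I(t, p)`: for some `k` one has `τ_k ≤ t < τ_{k+1}` and
`q = φ_{t - τ_k}(γ_p(τ_k))`. -/
def Reaches (φ : Flow ℝ M) (ι : D → M) (ι' : D' → M) (I : D → D') (p : M) (t : ℝ) (q : M) :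
    Prop :=
  ∃ (s : ℝ) (z : M), ImpulseState φ ι ι' I p s z ∧ s ≤ t ∧
    ((t - s : ℝ) : EReal) < hittingTime φ (range ι) z ∧ q = φ (t - s) z

/-- `γ` is a periodic orbit of the impulsive semiflow: it is the orbit `{γ_p(t) | t ≥ 0}` of a
point `p` such that `γ_p(T) = p` for some `T > 0`. -/
def IsPeriodicOrbit (φ : Flow ℝ M) (ι : D → M) (ι' : D' → M) (I : D → D') (γ : Set M) : Prop :=
  ∃ (p : M) (T : ℝ), 0 < T ∧ Reaches φ ι ι' I p T p ∧
    γ = {q | ∃ t : ℝ, 0 ≤ t ∧ Reaches φ ι ι' I p t q}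

/-- The points of `D'` whose forward orbit reaches `D`. -/
def poincareDomain (φ : Flow ℝ M) (ι : D → M) (ι' : D' → M) : Set D' :=
  {x | ∃ y : D, ∃ t : ℝ, hittingTime φ (range ι) (ι' x) = (t : EReal) ∧ φ t (ι' x) = ι y}

open Classical in
/-- The Poincaré map `P_I(x) = I (φ_{τ₁(x)}(x))` on `poincareDomain`; outside of this set the value
is irrelevant. -/
def poincareMap (φ : Flow ℝ M) (ι : D → M) (ι' : D' → M) (I : D → D') (x : D') : D' :=
  if h : x ∈ poincareDomain φ ι ι' then I h.choose else x

end Semiflow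

/-! ### Hyperbolic periodic orbits -/

/-- A linear endomorphism is hyperbolic if none of its complex eigenvalues (the complex roots of
its characteristic polynomial) has modulus one. -/
def IsHyperbolicLinear {n : ℕ}
    (L : EuclideanSpace ℝ (Fin n) →L[ℝ] EuclideanSpace ℝ (Fin n)) : Prop :=
  ∀ z : ℂ, Polynomial.aeval z
    (LinearMap.charpoly (L : EuclideanSpace ℝ (Fin n) →ₗ[ℝ] EuclideanSpace ℝ (Fin n))) = 0 →
    ‖z‖ ≠ 1

/-- `x` is a hyperbolic fixed point of `f`. -/
def IsHyperbolicFixedPoint {n : ℕ} [NeZero n] {D' : Type*} [TopologicalSpace D']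
    [ChartedSpace (EuclideanHalfSpace n) D'] (f : D' → D') (x : D') : Prop :=
  f x = x ∧ MDifferentiableAt (𝓡∂ n) (𝓡∂ n) f x ∧
    IsHyperbolicLinear (n := n) (mfderiv (𝓡∂ n) (𝓡∂ n) f x)

/-- The periodic orbit `γ` is hyperbolic: it does not meet `∂D'`, and there are `N ≥ 1` points
`x 0, …, x (N - 1)` of `γ ∩ D'`, cyclically permuted by the Poincaré map `P`, and open
neighbourhoods `V i` of these points in `D'` on which `P` is defined and `C¹`, such that `x 0` is a
hyperbolic fixed point of the `N`-th iterate of `P`. -/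
def IsHyperbolicOrbit {n : ℕ} [NeZero n] {M D D' : Type*} [TopologicalSpace M]
    [TopologicalSpace D'] [ChartedSpace (EuclideanHalfSpace n) D']
    (φ : Flow ℝ M) (ι : D → M) (ι' : D' → M) (I : D → D') (γ : Set M) : Prop :=
  Disjoint γ (ι' '' (𝓡∂ n).boundary D') ∧
    ∃ (N : ℕ) (x : ℕ → D') (V : ℕ → Set D'), 0 < N ∧
      (∀ i < N, ι' (x i) ∈ γ ∧ IsOpen (V i) ∧ x i ∈ V i ∧ V i ⊆ poincareDomain φ ι ι' ∧
        ContMDiffOn (𝓡∂ n) (𝓡∂ n) 1 (poincareMap φ ι ι' I) (V i)) ∧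
      (∀ i < N, poincareMap φ ι ι' I (x i) = x (i + 1)) ∧ x N = x 0 ∧
      IsHyperbolicFixedPoint (n := n) ((poincareMap φ ι ι' I)^[N]) (x 0)

/-! ### The space of impulses -/

section Impulses

variable {n m : ℕ} [NeZero n] {M D D' : Type*}
  [TopologicalSpace D] [ChartedSpace (EuclideanHalfSpace n) D]
  [TopologicalSpace D'] [ChartedSpace (EuclideanHalfSpace n) D']

/-- The derivative at `y` of a map from `D` to a Euclidean space. -/
def derivAt (f : D → EuclideanSpace ℝ (Fin m)) (y : D) :
    EuclideanSpace ℝ (Fin n) →L[ℝ] EuclideanSpace ℝ (Fin m) :=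
  mfderiv (𝓡∂ n) (𝓡 m) f y

variable (n D D') in
/-- The space of impulses: the `C¹` diffeomorphisms from `D` onto `D'`. -/
abbrev Impulses := Diffeomorph (𝓡∂ n) (𝓡∂ n) D D' 1

/-- The `C¹` distance `max (sup_y d(I y, J y)) (sup_y ‖DI(y) - DJ(y)‖)` between two impulses. A
smooth embedding `e` of the ambient manifold `M` in a Euclidean space serves to measure distances
and tangent vectors and to compare tangent vectors at distinct points of `M`; the operator norm is
taken with respect to the length `‖D(e ∘ ι)(y) v‖` of tangent vectors `v` of `D`. -/
def c1EDist (ι : D → M) (ι' : D' → M) (e : M → EuclideanSpace ℝ (Fin m))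
    (I J : Impulses n D D') : ℝ≥0∞ :=
  max (⨆ y : D, edist (e (ι' (I y))) (e (ι' (J y))))
    (⨆ (y : D) (v : EuclideanSpace ℝ (Fin n)) (_ : ‖derivAt (e ∘ ι) y v‖ ≤ 1),
      edist (derivAt (e ∘ ι' ∘ I) y v) (derivAt (e ∘ ι' ∘ J) y v))

/-- The extended pseudometric on the space of impulses that is given by the `C¹` distance. -/
abbrev c1PseudoEMetric (ι : D → M) (ι' : D' → M) (e : M → EuclideanSpace ℝ (Fin m)) :
    PseudoEMetricSpace (Impulses n D D') where
  edist := c1EDist ι ι' e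
  edist_self I := by simp [c1EDist]
  edist_comm I J := by simp only [c1EDist, edist_comm]
  edist_triangle I J K := by
    unfold c1EDist
    refine max_le (iSup_le fun y => ?_) (iSup_le fun y => iSup_le fun v => iSup_le fun hv => ?_)
    · refine (edist_triangle _ (e (ι' (J y))) _).trans (add_le_add ?_ ?_)
      · exact le_max_of_le_left
          (le_iSup (fun y : D => edist (e (ι' (I y))) (e (ι' (J y)))) y)
      · exact le_max_of_le_left
          (le_iSup (fun y : D => edist (e (ι' (J y))) (e (ι' (K y)))) y)
    · refine (edist_triangle _ (derivAt (e ∘ ι' ∘ J) y v) _).trans (add_le_add ?_ ?_)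
      · exact le_max_of_le_right (le_iSup_of_le y (le_iSup_of_le v (le_iSup_of_le hv le_rfl)))
      · exact le_max_of_le_right (le_iSup_of_le y (le_iSup_of_le v (le_iSup_of_le hv le_rfl)))

/-- The `C¹` topology on the space of impulses. -/
abbrev c1Topology (ι : D → M) (ι' : D' → M) (e : M → EuclideanSpace ℝ (Fin m)) :
    TopologicalSpace (Impulses n D D') :=
  (c1PseudoEMetric ι ι' e).toUniformSpace.toTopologicalSpace

end Impulses

end Impulsive

end

open Set Filter Topology Manifold
open scoped Manifold ContDiff ENNReal NNReal

noncomputable section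

set_option linter.unusedSectionVars false

namespace Impulsive

/-! ### Adapted charts -/

section Charts

variable {E H : Type*} [NormedAddCommGroup E] [NormedSpace ℝ E] [TopologicalSpace H]
  {I : ModelWithCorners ℝ E H} {S : Type*} [TopologicalSpace S] [ChartedSpace H S]
  {E' H' : Type*} [NormedAddCommGroup E'] [NormedSpace ℝ E'] [TopologicalSpace H']
  {J : ModelWithCorners ℝ E' H'} {N : Type*} [TopologicalSpace N] [ChartedSpace H' N]

/-! A periodic orbit without impulses is a closed flow line that never hits `D`. It is compact, so
its closure misses `D` as well. The orbits in question therefore come from cycles of the Poincaré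
map (`IsPeriodicOrbit.exists_cycle`). Such a cycle can fail in two ways: its flow lines meet `∂D'`,
or the return map is not `C¹` near it or not hyperbolic at it. Each failure forces the impulse into
one of countably many closed sets with empty interior, `nullCycleImpulses` and `badCycleImpulses`,
and the residual set consists of the impulses outside all of them. Countability comes from countably
many charts and balls, compact exhaustions of `D` and `D'`, and a countable family of `C¹` branches
of the flow between the sections (`IsTransversal.exists_countable_branches`). Closedness is
compactness: each condition is closed, and the cycle data range over a compact set.

Empty interior is a matter of perturbation. A ball in a chart of `D'` isolates one point of a cycle
of minimal period from the others. Following the impulse by a diffeomorphism supported in that ball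
changes only the last step of the cycle (`eventually_exists_perturbation`). If `F` is the old return
map in the chart, the new one is `F + a • (F - q) + v` near the cycle, with small parameters `a` and
`v`.

Boundary. The points of `D'` whose flow lines meet `∂D'` are locally Lipschitz images of `∂D'`,
hence null for the `n`-dimensional Hausdorff measure (`hausdorffMeasure_boundaryTrace`). All points
of a chain are locally Lipschitz functions of each other, so the vectors `v` that close up a chain
through this null set form a null set in `ℝⁿ`. They cannot fill a neighbourhood of `0`
(`interior_nullCycleImpulses`).

Hyperbolicity. For fixed `z`, only finitely many `a ∈ [0, 1]` make `(1 + a) • DF(z)` non-hyperbolic.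
By Fubini, for almost every `a` the set of bad `z` is null, and so is its image under the `C¹` map
`ψ(z) = z - F z - a • (F z - q)`. Fixed points of the perturbed map are the solutions of `ψ z = v`,
so most `v` leave only hyperbolic ones. Away from the bad points `ψ` is a local diffeomorphism, so
`v` can also be chosen to keep the fixed points off a given closed set with empty interior
(`exists_generic_perturbation`).

This last freedom gives smoothness. Since `D` need not be closed, the first hitting time can jump
where nearby trajectories hit `D` earlier. The set of such early hits is open, so its frontier has
empty interior. A generic cycle avoids the frontier, and near it the first hitting time is a `C¹`
branch (`eventually_hittingTime_eq`). -/

lemma contMDiffWithinAt_extend_symm {κ : OpenPartialHomeomorph S H}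
    (hκ : κ ∈ IsManifold.maximalAtlas I ∞ S) {y : S} (hy : y ∈ κ.source) :
    ContMDiffWithinAt 𝓘(ℝ, E) I ∞ (κ.extend I).symm (range I) (κ.extend I y) := by
  refine (contMDiffOn_extend_symm hκ (κ.extend I y)
      ⟨κ y, κ.map_source hy, rfl⟩).mono_of_mem_nhdsWithin ?_
  exact I.image_mem_nhdsWithin (κ.open_target.mem_nhds (κ.map_source hy))

/-- The inverse chart is differentiated within `range I`, where derivatives are unique; this makes
the chain rule available at boundary points too. -/
lemma mfderiv_extend_surjective {κ : OpenPartialHomeomorph S H}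
    (hκ : κ ∈ IsManifold.maximalAtlas I ∞ S) {y : S} (hy : y ∈ κ.source) :
    Function.Surjective (mfderiv I 𝓘(ℝ, E) (κ.extend I) y) := by
  have h1 : MDifferentiableWithinAt 𝓘(ℝ, E) I (κ.extend I).symm (range I) (κ.extend I y) :=
    (contMDiffWithinAt_extend_symm hκ hy).mdifferentiableWithinAt (by simp)
  have h2 : MDifferentiableAt I 𝓘(ℝ, E) (κ.extend I) ((κ.extend I).symm (κ.extend I y)) := by
    rw [κ.extend_left_inv hy]
    exact (κ.contMDiffAt_extend hκ hy).mdifferentiableAt (by simp)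
  have hu : UniqueMDiffWithinAt 𝓘(ℝ, E) (range I) (κ.extend I y) :=
    (I.uniqueDiffOn _ ⟨κ y, rfl⟩).uniqueMDiffWithinAt
  have h3 := mfderiv_comp_mfderivWithin (κ.extend I y) h2 h1 hu
  have h4 : mfderivWithin 𝓘(ℝ, E) 𝓘(ℝ, E) (κ.extend I ∘ (κ.extend I).symm) (range I)
      (κ.extend I y) = ContinuousLinearMap.id ℝ E := by
    rw [Filter.EventuallyEq.mfderivWithin_eq (f := id), mfderivWithin_id hu]
    · rfl
    · have : (κ.extend I).target ∈ 𝓝[range I] (κ.extend I y) := κ.extend_target_mem_nhdsWithin hy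
      filter_upwards [this] with z hz using (κ.extend I).right_inv hz
    · simp [κ.left_inv hy]
  rw [κ.extend_left_inv hy] at h3
  intro w
  refine ⟨mfderivWithin 𝓘(ℝ, E) I (κ.extend I).symm (range I) (κ.extend I y) w, ?_⟩
  have := congrArg (fun L => L w) (h3.symm.trans h4)
  exact this

lemma mfderiv_extend_injective {κ : OpenPartialHomeomorph S H} [I.Boundaryless]
    (hκ : κ ∈ IsManifold.maximalAtlas I ∞ S) {y : S} (hy : y ∈ κ.source) :
    Function.Injective (mfderiv I 𝓘(ℝ, E) (κ.extend I) y) := by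
  have h1 : MDifferentiableAt 𝓘(ℝ, E) I (κ.extend I).symm (κ.extend I y) := by
    have := contMDiffWithinAt_extend_symm hκ hy
    rw [I.range_eq_univ] at this
    exact (this.contMDiffAt univ_mem).mdifferentiableAt (by simp)
  have h2 : MDifferentiableAt I 𝓘(ℝ, E) (κ.extend I) y :=
    (κ.contMDiffAt_extend hκ hy).mdifferentiableAt (by simp)
  have h3 := mfderiv_comp y h1 h2
  have h4 : mfderiv I I ((κ.extend I).symm ∘ κ.extend I) y = ContinuousLinearMap.id ℝ _ := by
    rw [Filter.EventuallyEq.mfderiv_eq (f := id), mfderiv_id]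
    filter_upwards [κ.open_source.mem_nhds hy] with z hz using κ.extend_left_inv hz
  intro a b hab
  have ha := congrArg (fun L => L a) (h3.symm.trans h4)
  have hb := congrArg (fun L => L b) (h3.symm.trans h4)
  change mfderiv 𝓘(ℝ, E) I (κ.extend I).symm (κ.extend I y) (mfderiv I 𝓘(ℝ, E) (κ.extend I) y a) = a
    at ha
  change mfderiv 𝓘(ℝ, E) I (κ.extend I).symm (κ.extend I y) (mfderiv I 𝓘(ℝ, E) (κ.extend I) y b) = b
    at hb
  rw [← ha, ← hb, hab]

/-- Interior points are defined through the preferred chart. Any other chart of the maximal atlas is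
a local diffeomorphism to the model space, and these preserve interior points. -/
lemma extend_mem_interior_target [IsManifold I ∞ S] {κ : OpenPartialHomeomorph S H}
    (hκ : κ ∈ IsManifold.maximalAtlas I ∞ S) {y : S} (hy : y ∈ κ.source)
    (hi : I.IsInteriorPoint y) : κ.extend I y ∈ interior (κ.extend I).target := by
  have h1 : IsLocalDiffeomorphAt I I ∞ κ y :=
    ⟨⟨κ.toPartialEquiv, κ.open_source, κ.open_target, contMDiffOn_of_mem_maximalAtlas hκ,
      contMDiffOn_symm_of_mem_maximalAtlas hκ⟩, hy, fun z _ => rfl⟩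
  have h2 := (h1.isInteriorPoint_iff (by simp)).1 hi
  refine κ.mem_interior_extend_target (κ.map_source hy) ?_
  exact h2

/-- An immersion admits a smooth left inverse in charts. -/
lemma exists_chart_leftInverse {f : S → N} {x : S} (hf : IsImmersionAt I J ∞ f x) :
    ∃ κ ∈ IsManifold.maximalAtlas I ∞ S, x ∈ κ.source ∧ ∃ ρ : N → E,
      ContMDiffAt J 𝓘(ℝ, E) ∞ ρ (f x) ∧ ∀ y ∈ κ.source, ρ (f y) = κ.extend I y := by
  refine ⟨hf.domChart, hf.domChart_mem_maximalAtlas, hf.mem_domChart_source,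
    fun p => (hf.equiv.symm (hf.codChart.extend J p)).1, ?_, ?_⟩
  · have h1 := hf.codChart.contMDiffAt_extend hf.codChart_mem_maximalAtlas hf.mem_codChart_source
    have h2 : ContDiff ℝ ∞ (fun z => (hf.equiv.symm z).1) :=
      contDiff_fst.comp hf.equiv.symm.contDiff
    exact h2.contMDiff.contMDiffAt.comp (f x) h1
  · intro y hy
    have hy' : hf.domChart.extend I y ∈ (hf.domChart.extend I).target :=
      (hf.domChart.extend I).map_source (by simpa using hy)
    have h := hf.writtenInCharts hy'
    simp only [Function.comp_apply] at h
    rw [hf.domChart.extend_left_inv hy] at h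
    change (hf.equiv.symm (hf.codChart.extend J (f y))).1 = _
    rw [h]; simp

end Charts

variable {n m : ℕ} [NeZero n] {M : Type*} [TopologicalSpace M]
  [ChartedSpace (EuclideanSpace ℝ (Fin (n + 1))) M] [IsManifold (𝓡 (n + 1)) ∞ M]
  {S : Type*} [TopologicalSpace S] [ChartedSpace (EuclideanHalfSpace n) S]
  [IsManifold (𝓡∂ n) ∞ S]

/-- A hypersurface is locally contained in the zero set of a function, and agrees with it near
interior points. -/
lemma exists_local_equation {σ : S → M} (hσ : IsSmoothEmbedding (𝓡∂ n) (𝓡 (n + 1)) ∞ σ) (y : S)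
    {v : TangentSpace (𝓡 (n + 1)) (σ y)} (hv : v ∉ range (mfderiv (𝓡∂ n) (𝓡 (n + 1)) σ y)) :
    ∃ h : M → ℝ, ContMDiffAt (𝓡 (n + 1)) 𝓘(ℝ, ℝ) ∞ h (σ y) ∧
      (∀ᶠ p in 𝓝 (σ y), p ∈ range σ → h p = 0) ∧
      ((𝓡∂ n).IsInteriorPoint y → ∀ᶠ p in 𝓝 (σ y), h p = 0 → p ∈ range σ) ∧
      mfderiv (𝓡 (n + 1)) 𝓘(ℝ, ℝ) h (σ y) v ≠ 0 := by
  have him : IsImmersionAt (𝓡∂ n) (𝓡 (n + 1)) ∞ σ y := hσ.isImmersion.isImmersionAt y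
  obtain ⟨F, _, _, hf⟩ := him
  set κ := hf.domChart
  set ψ := hf.codChart
  have hκ := hf.domChart_mem_maximalAtlas
  have hψ := hf.codChart_mem_maximalAtlas
  have hy : y ∈ κ.source := hf.mem_domChart_source
  have hσy : σ y ∈ ψ.source := hf.mem_codChart_source
  set A := hf.equiv
  have : FiniteDimensional ℝ (EuclideanSpace ℝ (Fin n) × F) :=
    A.symm.toLinearEquiv.finiteDimensional
  have : FiniteDimensional ℝ F :=
    Module.Finite.of_surjective (LinearMap.snd ℝ (EuclideanSpace ℝ (Fin n)) F)
      LinearMap.snd_surjective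
  -- Codimension one: the complement in the immersion charts is a line, and its coordinate is the
  -- local equation.
  have hF : Module.finrank ℝ F = Module.finrank ℝ ℝ := by
    have := A.toLinearEquiv.finrank_eq
    rw [Module.finrank_prod] at this
    simp at this ⊢
    omega
  let ℓ : F ≃L[ℝ] ℝ := ContinuousLinearEquiv.ofFinrankEq hF
  let Ψ : M → EuclideanSpace ℝ (Fin n) × F := fun p => A.symm (ψ.extend (𝓡 (n + 1)) p)
  have hΨ : ContMDiffAt (𝓡 (n + 1)) 𝓘(ℝ, EuclideanSpace ℝ (Fin n) × F) ∞ Ψ (σ y) :=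
    A.symm.contDiff.contMDiff.contMDiffAt.comp _ (ψ.contMDiffAt_extend hψ hσy)
  have hΨσ : ∀ z ∈ κ.source, Ψ (σ z) = (κ.extend (𝓡∂ n) z, 0) := by
    intro z hz
    have hz' : κ.extend (𝓡∂ n) z ∈ (κ.extend (𝓡∂ n)).target :=
      (κ.extend (𝓡∂ n)).map_source (by simpa using hz)
    have h := hf.writtenInCharts hz'
    simp only [Function.comp_apply] at h
    rw [κ.extend_left_inv hz] at h
    simp only [Ψ]
    rw [h]; simp [A]
  have hℓ : ContMDiff 𝓘(ℝ, EuclideanSpace ℝ (Fin n) × F) 𝓘(ℝ, ℝ) ∞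
      (fun z : EuclideanSpace ℝ (Fin n) × F => ℓ z.2) :=
    (ℓ.contDiff.comp contDiff_snd).contMDiff
  refine ⟨fun p => ℓ (Ψ p).2, hℓ.contMDiffAt.comp _ hΨ, ?_, ?_, ?_⟩
  · have : κ.source ∈ comap σ (𝓝 (σ y)) := by
      rw [← hσ.isEmbedding.nhds_eq_comap]; exact κ.open_source.mem_nhds hy
    obtain ⟨O, hO, hOκ⟩ := this
    filter_upwards [hO] with p hp
    rintro ⟨z, rfl⟩
    simp [hΨσ z (hOκ hp)]
  · intro hi
    have h1 : Tendsto (fun p => (Ψ p).1) (𝓝 (σ y)) (𝓝 (κ.extend (𝓡∂ n) y)) := by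
      have : Tendsto (fun p => (Ψ p).1) (𝓝 (σ y)) (𝓝 (Ψ (σ y)).1) :=
        (continuous_fst.tendsto _).comp hΨ.continuousAt
      rwa [hΨσ y hy] at this
    have h2 := h1 (mem_interior_iff_mem_nhds.1 (extend_mem_interior_target hκ hy hi))
    filter_upwards [h2, ψ.open_source.mem_nhds hσy] with p hp hpψ h0
    have h0' : (Ψ p).2 = 0 := by simpa using h0
    have hq : (κ.extend (𝓡∂ n)).symm (Ψ p).1 ∈ κ.source := by
      simpa using (κ.extend (𝓡∂ n)).map_target hp
    refine ⟨(κ.extend (𝓡∂ n)).symm (Ψ p).1, ?_⟩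
    have h3 := hΨσ _ hq
    rw [(κ.extend (𝓡∂ n)).right_inv hp, ← h0'] at h3
    have h4 : ψ.extend (𝓡 (n + 1)) (σ ((κ.extend (𝓡∂ n)).symm (Ψ p).1))
        = ψ.extend (𝓡 (n + 1)) p := A.symm.injective h3
    refine (ψ.extend (𝓡 (n + 1))).injOn ?_ ?_ h4
    · simpa using hf.source_subset_preimage_source hq
    · simpa using hpψ
  · intro h0
    have hd : mfderiv (𝓡 (n + 1)) 𝓘(ℝ, ℝ) (fun p => ℓ (Ψ p).2) (σ y) v
        = ℓ (mfderiv (𝓡 (n + 1)) 𝓘(ℝ, EuclideanSpace ℝ (Fin n) × F) Ψ (σ y) v).2 := by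
      have := mfderiv_comp (σ y) (hℓ.contMDiffAt.mdifferentiableAt (by simp))
        (hΨ.mdifferentiableAt (by simp))
      rw [show (fun p => ℓ (Ψ p).2) = (fun z : EuclideanSpace ℝ (Fin n) × F => ℓ z.2) ∘ Ψ from rfl,
        this, mfderiv_eq_fderiv]
      have h5 : HasFDerivAt (fun z : EuclideanSpace ℝ (Fin n) × F => ℓ z.2)
          ((ℓ : F →L[ℝ] ℝ).comp (ContinuousLinearMap.snd ℝ _ F)) (Ψ (σ y)) := by
        have h5' := ((ℓ : F →L[ℝ] ℝ).comp
          (ContinuousLinearMap.snd ℝ (EuclideanSpace ℝ (Fin n)) F)).hasFDerivAt (x := Ψ (σ y))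
        exact h5'
      rw [h5.fderiv]; rfl
    rw [hd] at h0
    have h0' : (mfderiv (𝓡 (n + 1)) 𝓘(ℝ, EuclideanSpace ℝ (Fin n) × F) Ψ (σ y) v).2 = 0 :=
      ℓ.injective (h0.trans ℓ.map_zero.symm)
    -- If the equation has derivative zero along `v`, then `dΨ v` lies in the model hyperplane,
    -- which is filled by `dΨ ∘ dσ`. Injectivity of `dΨ` then makes `v` tangent to the hypersurface,
    -- against the hypothesis.
    obtain ⟨w, hw⟩ := mfderiv_extend_surjective hκ hy
      (mfderiv (𝓡 (n + 1)) 𝓘(ℝ, EuclideanSpace ℝ (Fin n) × F) Ψ (σ y) v).1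
    refine hv ⟨w, ?_⟩
    have h6 : mfderiv (𝓡∂ n) 𝓘(ℝ, EuclideanSpace ℝ (Fin n) × F) (Ψ ∘ σ) y w
        = (mfderiv (𝓡∂ n) 𝓘(ℝ, EuclideanSpace ℝ (Fin n)) (κ.extend (𝓡∂ n)) y w, 0) := by
      have h7 : Ψ ∘ σ =ᶠ[𝓝 y] (fun u : EuclideanSpace ℝ (Fin n) => ((u, 0) : _ × F))
          ∘ κ.extend (𝓡∂ n) := by
        filter_upwards [κ.open_source.mem_nhds hy] with z hz using hΨσ z hz
      have h8 : HasFDerivAt (fun u : EuclideanSpace ℝ (Fin n) => ((u, 0) : _ × F))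
          (ContinuousLinearMap.inl ℝ _ F) (κ.extend (𝓡∂ n) y) :=
        (ContinuousLinearMap.inl ℝ (EuclideanSpace ℝ (Fin n)) F).hasFDerivAt
      rw [h7.mfderiv_eq, mfderiv_comp y h8.differentiableAt.mdifferentiableAt
        ((κ.contMDiffAt_extend hκ hy).mdifferentiableAt (by simp)), mfderiv_eq_fderiv, h8.fderiv]
      rfl
    rw [mfderiv_comp y (hΨ.mdifferentiableAt (by simp))
      (hσ.contMDiff.contMDiffAt.mdifferentiableAt (by simp))] at h6
    have h9 : mfderiv (𝓡 (n + 1)) 𝓘(ℝ, EuclideanSpace ℝ (Fin n) × F) Ψ (σ y)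
        (mfderiv (𝓡∂ n) (𝓡 (n + 1)) σ y w)
        = mfderiv (𝓡 (n + 1)) 𝓘(ℝ, EuclideanSpace ℝ (Fin n) × F) Ψ (σ y) v :=
      h6.trans (Prod.ext hw h0'.symm)
    have h10 : ∀ u, mfderiv (𝓡 (n + 1)) 𝓘(ℝ, EuclideanSpace ℝ (Fin n) × F) Ψ (σ y) u
        = A.symm (mfderiv (𝓡 (n + 1)) 𝓘(ℝ, EuclideanSpace ℝ (Fin (n + 1)))
          (ψ.extend (𝓡 (n + 1))) (σ y) u) := by
      intro u
      rw [show Ψ = A.symm ∘ ψ.extend (𝓡 (n + 1)) from rfl,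
        mfderiv_comp (σ y) A.symm.differentiableAt.mdifferentiableAt
          ((ψ.contMDiffAt_extend hψ hσy).mdifferentiableAt (by simp)), mfderiv_eq_fderiv,
        A.symm.fderiv]
      rfl
    rw [h10, h10] at h9
    exact mfderiv_extend_injective hψ hσy (A.symm.injective h9)

/-! ### Hitting a cross-section -/

section Hitting

variable {n : ℕ} [NeZero n] {M : Type*} [TopologicalSpace M]
  [ChartedSpace (EuclideanSpace ℝ (Fin (n + 1))) M] [IsManifold (𝓡 (n + 1)) ∞ M]
  {S : Type*} [TopologicalSpace S] [ChartedSpace (EuclideanHalfSpace n) S]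
  [IsManifold (𝓡∂ n) ∞ S]

variable (n) in
/-- The properties of a flow and of a cross-section that are used to follow trajectories. Unlike
`IsC1FlowOf` and `IsCrossSection`, they are symmetric under time reversal. -/
structure IsTransversal (φ : Flow ℝ M) (σ : S → M) : Prop where
  contMDiff_flow : ContMDiff (𝓘(ℝ, ℝ).prod (𝓡 (n + 1))) (𝓡 (n + 1)) 1
    (fun q : ℝ × M => φ q.1 q.2)
  isSmoothEmbedding : IsSmoothEmbedding (𝓡∂ n) (𝓡 (n + 1)) ∞ σ
  exists_field : ∃ X : ∀ p : M, TangentSpace (𝓡 (n + 1)) p,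
    (∀ p : M, IsMIntegralCurve (I := 𝓡 (n + 1)) (fun t : ℝ => φ t p) X) ∧
    ∀ y : S, X (σ y) ∉ range (mfderiv (𝓡∂ n) (𝓡 (n + 1)) σ y)

lemma IsTransversal.of_isC1FlowOf {X : ∀ p : M, TangentSpace (𝓡 (n + 1)) p} {φ : Flow ℝ M}
    (hφ : IsC1FlowOf X φ) {σ : S → M} (hσ : IsCrossSection X σ) : IsTransversal n φ σ :=
  ⟨hφ.contMDiff_flow, hσ.isSmoothEmbedding, X, hφ.isMIntegralCurve, hσ.transversal⟩

lemma IsTransversal.reverse {φ : Flow ℝ M} {σ : S → M} (h : IsTransversal n φ σ) :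
    IsTransversal n φ.reverse σ := by
  obtain ⟨X, hX, hXσ⟩ := h.exists_field
  refine ⟨?_, h.isSmoothEmbedding, -X, fun p => ?_, fun y hy => ?_⟩
  · have : ContMDiff (𝓘(ℝ, ℝ).prod (𝓡 (n + 1))) (𝓘(ℝ, ℝ).prod (𝓡 (n + 1))) 1
        (fun q : ℝ × M => (-q.1, q.2)) :=
      (contDiff_neg.contMDiff.comp contMDiff_fst).prodMk contMDiff_snd
    exact h.contMDiff_flow.comp this
  · have := (hX p).comp_mul (-1)
    simpa [Function.comp_def, Flow.reverse_apply] using this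
  · obtain ⟨w, hw⟩ := hy
    refine hXσ y ⟨-w, ?_⟩
    rw [map_neg, hw]
    simp

/-- Implicit function theorem for `g (φ t p) = 0`, with `g` a local equation of the section: the
time derivative is `dg(X)`, nonzero by transversality. Uniqueness of the hitting time needs only
that the section lies in `{g = 0}` and holds at boundary points. Existence for all nearby `p` needs
equality of the two sets, hence an interior point. -/
lemma IsTransversal.hitting {φ : Flow ℝ M} {σ : S → M} (h : IsTransversal n φ σ) {p₀ : M} {t₀ : ℝ}
    {y₀ : S} (h₀ : φ t₀ p₀ = σ y₀) :
    ∃ τ : M → ℝ, ContMDiffAt (𝓡 (n + 1)) 𝓘(ℝ, ℝ) 1 τ p₀ ∧ τ p₀ = t₀ ∧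
      (∀ᶠ q : M × ℝ in 𝓝 (p₀, t₀), φ q.2 q.1 ∈ range σ → q.2 = τ q.1) ∧
      ((𝓡∂ n).IsInteriorPoint y₀ → ∀ᶠ p in 𝓝 p₀, φ (τ p) p ∈ range σ) := by
  obtain ⟨X, hX, hXσ⟩ := h.exists_field
  obtain ⟨g, hg, hg0, hgi, hgX⟩ := exists_local_equation h.isSmoothEmbedding y₀ (hXσ y₀)
  have hgy : g (σ y₀) = 0 := hg0.self_of_nhds ⟨y₀, rfl⟩
  set χ := extChartAt (𝓡 (n + 1)) p₀
  set u : EuclideanSpace ℝ (Fin (n + 1)) × ℝ := (χ p₀, t₀)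
  set f : EuclideanSpace ℝ (Fin (n + 1)) × ℝ → ℝ := fun z => g (φ z.2 (χ.symm z.1))
  have hχ : χ.symm (χ p₀) = p₀ := extChartAt_to_inv p₀
  have hflow : ContMDiffAt 𝓘(ℝ, EuclideanSpace ℝ (Fin (n + 1)) × ℝ) (𝓡 (n + 1)) 1
      (fun z : EuclideanSpace ℝ (Fin (n + 1)) × ℝ => φ z.2 (χ.symm z.1)) u := by
    have h1 : ContMDiffAt 𝓘(ℝ, EuclideanSpace ℝ (Fin (n + 1)) × ℝ) (𝓡 (n + 1)) 1
        (fun z : EuclideanSpace ℝ (Fin (n + 1)) × ℝ => χ.symm z.1) u := by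
      have h2 : ContMDiffAt 𝓘(ℝ, EuclideanSpace ℝ (Fin (n + 1))) (𝓡 (n + 1)) 1 χ.symm (χ p₀) :=
        ((contMDiffOn_extChartAt_symm (n := ∞) p₀).contMDiffAt
          (extChartAt_target_mem_nhds p₀)).of_le (by norm_cast)
      exact ContMDiffAt.comp u (g := χ.symm) h2 (contDiff_fst.contMDiff.contMDiffAt)
    have h3 : ContMDiffAt 𝓘(ℝ, EuclideanSpace ℝ (Fin (n + 1)) × ℝ) 𝓘(ℝ, ℝ) 1
        (fun z : EuclideanSpace ℝ (Fin (n + 1)) × ℝ => z.2) u := contDiff_snd.contMDiff.contMDiffAt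
    exact (h.contMDiff_flow (u.2, χ.symm u.1)).comp u (h3.prodMk h1)
  have hfu : φ u.2 (χ.symm u.1) = σ y₀ := by simp [u, hχ, h₀]
  have hf : ContDiffAt ℝ 1 f u := by
    rw [← contMDiffAt_iff_contDiffAt]
    have hg' : ContMDiffAt (𝓡 (n + 1)) 𝓘(ℝ, ℝ) 1 g (φ u.2 (χ.symm u.1)) := by
      rw [hfu]; exact hg.of_le (by norm_cast)
    exact hg'.comp u hflow
  have hfu0 : f u = 0 := by simp only [f]; rw [hfu, hgy]
  set c : ℝ := mfderiv (𝓡 (n + 1)) 𝓘(ℝ, ℝ) g (σ y₀) (X (σ y₀))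
  have hc : c ≠ 0 := hgX
  have hinv : (fderiv ℝ f u ∘L .inr ℝ (EuclideanSpace ℝ (Fin (n + 1))) ℝ).IsInvertible := by
    have h1 : HasFDerivAt (fun t : ℝ => f (χ p₀, t))
        (fderiv ℝ f u ∘L .inr ℝ (EuclideanSpace ℝ (Fin (n + 1))) ℝ) t₀ := by
      have h2 : HasFDerivAt f (fderiv ℝ f u) (χ p₀, t₀) :=
        (hf.differentiableAt one_ne_zero).hasFDerivAt
      exact h2.comp t₀ (hasFDerivAt_prodMk_right (χ p₀) t₀)
    have h3 : HasMFDerivAt 𝓘(ℝ, ℝ) 𝓘(ℝ, ℝ) (fun t : ℝ => g (φ t p₀)) t₀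
        ((mfderiv (𝓡 (n + 1)) 𝓘(ℝ, ℝ) g (φ t₀ p₀)).comp
          ((1 : ℝ →L[ℝ] ℝ).smulRight (X (φ t₀ p₀)))) := by
      refine HasMFDerivAt.comp t₀ (g := g) (f := fun t => φ t p₀) ?_ (hX p₀ t₀)
      rw [h₀]
      exact (hg.mdifferentiableAt (by simp)).hasMFDerivAt
    have h4 := h3.hasFDerivAt
    have h5 : (fun t : ℝ => f (χ p₀, t)) = fun t : ℝ => g (φ t p₀) := by
      ext t; simp only [f]; rw [hχ]
    rw [h5] at h1
    have h6 := h1.unique h4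
    refine ⟨ContinuousLinearEquiv.unitsEquivAut ℝ (Units.mk0 c hc), ?_⟩
    rw [h6]
    ext
    have h7 : ∀ p (hp : p = σ y₀), mfderiv (𝓡 (n + 1)) 𝓘(ℝ, ℝ) g p (X p) = c := by
      rintro p rfl; rfl
    have h8 := h7 _ h₀
    change (1 : ℝ) * c = mfderiv (𝓡 (n + 1)) 𝓘(ℝ, ℝ) g (φ t₀ p₀) ((1 : ℝ) • X (φ t₀ p₀))
    rw [one_smul, h8, one_mul]
  set ψ := hf.implicitFunction one_ne_zero hinv
  have hcont : ContinuousAt χ p₀ := continuousAt_extChartAt p₀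
  refine ⟨fun p => ψ (χ p), ?_, ?_, ?_, ?_⟩
  · have h1 : ContMDiffAt 𝓘(ℝ, EuclideanSpace ℝ (Fin (n + 1))) 𝓘(ℝ, ℝ) 1 ψ (χ p₀) :=
      (hf.contDiffAt_implicitFunction one_ne_zero hinv).contMDiffAt
    exact h1.comp p₀ (contMDiffAt_extChartAt (n := 1))
  · exact hf.implicitFunction_apply_self one_ne_zero hinv
  · have h1 := hf.eventually_apply_eq_iff_implicitFunction one_ne_zero hinv
    have h2 : Tendsto (fun q : M × ℝ => (χ q.1, q.2)) (𝓝 (p₀, t₀)) (𝓝 u) :=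
      (hcont.comp (f := fun q : M × ℝ => q.1) (x := (p₀, t₀)) continuousAt_fst).prodMk
        continuousAt_snd
    have h3 : Tendsto (fun q : M × ℝ => φ q.2 q.1) (𝓝 (p₀, t₀)) (𝓝 (σ y₀)) := by
      rw [← h₀]
      exact (h.contMDiff_flow.continuous.comp
        (continuous_snd.prodMk continuous_fst)).continuousAt (x := (p₀, t₀))
    have h4 : ∀ᶠ q : M × ℝ in 𝓝 (p₀, t₀), q.1 ∈ χ.source :=
      continuousAt_fst.eventually (extChartAt_source_mem_nhds p₀)
    filter_upwards [h2.eventually h1, h3.eventually hg0, h4] with q hq1 hq2 hq3 hq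
    refine (hq1.1 ?_).symm
    rw [hfu0]
    simp only [f]
    rw [χ.left_inv hq3]
    exact hq2 hq
  · intro hi
    have h1 := hf.eventually_apply_implicitFunction one_ne_zero hinv
    have h2 : Tendsto (fun p : M => (χ p, ψ (χ p))) (𝓝 p₀) (𝓝 u) := by
      have h3 : ContinuousAt ψ (χ p₀) :=
        (hf.contDiffAt_implicitFunction one_ne_zero hinv).continuousAt
      have h4 : ψ (χ p₀) = t₀ := hf.implicitFunction_apply_self one_ne_zero hinv
      have h5 : Tendsto (fun p : M => ψ (χ p)) (𝓝 p₀) (𝓝 t₀) := by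
        have := h3.comp hcont
        rw [ContinuousAt, Function.comp, h4] at this
        exact this
      exact hcont.tendsto.prodMk_nhds h5
    have h6 : Tendsto (fun z : EuclideanSpace ℝ (Fin (n + 1)) × ℝ => φ z.2 (χ.symm z.1)) (𝓝 u)
        (𝓝 (σ y₀)) := by
      rw [← hfu]; exact hflow.continuousAt
    filter_upwards [hcont.eventually h1, (h6.comp h2).eventually (hgi hi),
      extChartAt_source_mem_nhds (I := 𝓡 (n + 1)) p₀] with p hp1 hp2 hp3
    simp only [Function.comp_apply] at hp2
    rw [χ.left_inv hp3] at hp2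
    refine hp2 ?_
    rw [hfu0] at hp1
    simp only [f] at hp1
    rw [χ.left_inv hp3] at hp1
    exact hp1

end Hitting

/-! ### Lipschitz domination -/

section Domination

variable {Q X Y Z : Type*} [PseudoMetricSpace X] [PseudoMetricSpace Y] [PseudoMetricSpace Z]

/-- Along the filter `l`, distances of values of `f` are bounded by a multiple of the distances of
the corresponding values of `g`. -/
def Dominated (l : Filter Q) (f : Q → X) (g : Q → Y) : Prop :=
  ∃ C : ℝ≥0, ∃ U ∈ l, ∀ c ∈ U, ∀ c' ∈ U, dist (f c) (f c') ≤ C * dist (g c) (g c')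

lemma Dominated.trans {l : Filter Q} {f : Q → X} {g : Q → Y} {h : Q → Z}
    (hfg : Dominated l f g) (hgh : Dominated l g h) : Dominated l f h := by
  obtain ⟨C, U, hU, h1⟩ := hfg
  obtain ⟨C', U', hU', h2⟩ := hgh
  refine ⟨C * C', U ∩ U', inter_mem hU hU', fun c hc c' hc' => (h1 c hc.1 c' hc'.1).trans ?_⟩
  rw [NNReal.coe_mul, mul_assoc]
  exact mul_le_mul_of_nonneg_left (h2 c hc.2 c' hc'.2) C.2

lemma Dominated.comp_tendsto {P : Type*} {l : Filter Q} {f : Q → X} {g : Q → Y}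
    (hfg : Dominated l f g) {k : Filter P} {u : P → Q} (hu : Tendsto u k l) :
    Dominated k (fun c => f (u c)) (fun c => g (u c)) := by
  obtain ⟨C, U, hU, h1⟩ := hfg
  exact ⟨C, u ⁻¹' U, hu hU, fun c hc c' hc' => h1 _ hc _ hc'⟩

lemma Dominated.refl (l : Filter Q) (f : Q → X) : Dominated l f f :=
  ⟨1, univ, univ_mem, fun _ _ _ _ => by simp⟩

lemma Dominated.sub {E : Type*} [NormedAddCommGroup E] {l : Filter Q} {f f' : Q → E} {g : Q → Y}
    (h : Dominated l f g) (h' : Dominated l f' g) : Dominated l (fun c => f c - f' c) g := by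
  obtain ⟨C, U, hU, h1⟩ := h
  obtain ⟨C', U', hU', h2⟩ := h'
  refine ⟨C + C', U ∩ U', inter_mem hU hU', fun c hc c' hc' => ?_⟩
  have := dist_sub_sub_le (f c) (f' c) (f c') (f' c')
  rw [NNReal.coe_add, add_mul]
  exact this.trans (add_le_add (h1 c hc.1 c' hc'.1) (h2 c hc.2 c' hc'.2))

lemma Dominated.congr {l : Filter Q} {f f' : Q → X} {g : Q → Y} (h : Dominated l f g)
    (hf : f' =ᶠ[l] f) : Dominated l f' g := by
  obtain ⟨C, U, hU, h1⟩ := h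
  refine ⟨C, U ∩ {c | f' c = f c}, inter_mem hU hf, fun c hc c' hc' => ?_⟩
  rw [hc.2, hc'.2]
  exact h1 c hc.1 c' hc'.1

lemma LipschitzOnWith.dominated {K : ℝ≥0} {f : X → Y} {s : Set X} (h : LipschitzOnWith K f s)
    {l : Filter Q} {g : Q → X} (hg : ∀ᶠ c in l, g c ∈ s) : Dominated l (fun c => f (g c)) g :=
  ⟨K, {c | g c ∈ s}, hg, fun _ hc _ hc' => h.dist_le_mul _ hc _ hc'⟩

open MeasureTheory in
/-- A map that is locally dominated by a map with image of Hausdorff measure zero has an image of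
Hausdorff measure zero. -/
lemma hausdorffMeasure_image_eq_zero {X Y : Type*} [MetricSpace X] [MetricSpace Y]
    [MeasurableSpace X] [BorelSpace X] [MeasurableSpace Y] [BorelSpace Y]
    [TopologicalSpace Q] [SecondCountableTopology Q] {A : Set Q} {f : Q → X} {g : Q → Y} {d : ℝ}
    (hd : 0 ≤ d) (h : ∀ c ∈ A, Dominated (𝓝[A] c) f g) (h0 : μH[d] (g '' A) = 0) :
    μH[d] (f '' A) = 0 := by
  have hloc : ∀ c ∈ A, ∃ U ∈ 𝓝[A] c, μH[d] (f '' (U ∩ A)) = 0 := by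
    intro c hc
    obtain ⟨C, U, hU, h1⟩ := h c hc
    refine ⟨U, hU, ?_⟩
    rcases (U ∩ A).eq_empty_or_nonempty with he | ⟨c₀, -⟩
    · simp [he]
    -- Points of `U` with the same value of `g` have the same value of `f`, so `f` factors through
    -- `g` there; a choice `s` of preimages writes `f` as the Lipschitz map `f ∘ s` on the image of
    -- `g`.
    have : Nonempty Q := ⟨c₀⟩
    have h2 : ∀ z ∈ g '' (U ∩ A), ∃ c ∈ U ∩ A, g c = z := fun z hz => hz
    choose! s hs hgs using h2
    have hlip : LipschitzOnWith C (fun z => f (s z)) (g '' (U ∩ A)) := by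
      refine LipschitzOnWith.of_dist_le_mul fun z hz w hw => ?_
      have := h1 _ (hs z hz).1 _ (hs w hw).1
      rwa [hgs z hz, hgs w hw] at this
    have him : f '' (U ∩ A) ⊆ (fun z => f (s z)) '' (g '' (U ∩ A)) := by
      rintro _ ⟨c, hc, rfl⟩
      refine ⟨g c, ⟨c, hc, rfl⟩, ?_⟩
      have h3 := hs (g c) ⟨c, hc, rfl⟩
      have h4 := h1 _ h3.1 _ hc.1
      rw [hgs (g c) ⟨c, hc, rfl⟩, dist_self, mul_zero] at h4
      exact dist_le_zero.1 h4
    have h5 : μH[d] (g '' (U ∩ A)) = 0 :=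
      measure_mono_null (image_mono inter_subset_right) h0
    refine measure_mono_null him (le_antisymm ((hlip.hausdorffMeasure_image_le hd).trans ?_)
        zero_le)
    rw [h5, mul_zero]
  choose! U hU hU0 using hloc
  obtain ⟨t, htA, htc, ht⟩ := TopologicalSpace.countable_cover_nhdsWithin hU
  have : f '' A ⊆ ⋃ c ∈ t, f '' (U c ∩ A) := by
    rintro _ ⟨c, hc, rfl⟩
    obtain ⟨c', hc', h'⟩ := mem_iUnion₂.1 (ht hc)
    exact mem_iUnion₂.2 ⟨c', hc', c, ⟨h', hc⟩, rfl⟩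
  exact measure_mono_null this ((measure_biUnion_null_iff htc).2 fun c hc => hU0 c (htA hc))

end Domination

/-! ### Retractions -/

section Retraction

variable {E H : Type*} [NormedAddCommGroup E] [NormedSpace ℝ E] [TopologicalSpace H]
  {I : ModelWithCorners ℝ E H} {S : Type*} [TopologicalSpace S] [ChartedSpace H S]

/-- Two Lipschitz bounds are composed. Read in the chart, `f` is `C¹` within the convex set `range
I` and so locally Lipschitz, even at boundary points. The chart itself is the `C¹` function `r` of
`j`. -/
lemma dominated_of_chart_leftInverse {V W : Type*} [NormedAddCommGroup V] [NormedSpace ℝ V]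
    [NormedAddCommGroup W] [NormedSpace ℝ W] {j : S → V} {y₀ : S} (hj : ContinuousAt j y₀)
    {κ : OpenPartialHomeomorph S H} (hκ : κ ∈ IsManifold.maximalAtlas I ∞ S) (hy₀ : y₀ ∈ κ.source)
    {r : V → E} (hr : ContDiffAt ℝ 1 r (j y₀)) (hrj : ∀ᶠ y in 𝓝 y₀, r (j y) = κ.extend I y)
    {f : S → W} (hf : ContMDiffAt I 𝓘(ℝ, W) 1 f y₀) : Dominated (𝓝 y₀) f j := by
  obtain ⟨K, s, hs, hlip⟩ := hr.exists_lipschitzOnWith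
  have h1 : ContDiffWithinAt ℝ 1 (f ∘ (κ.extend I).symm) (range I) (κ.extend I y₀) := by
    rw [← contMDiffWithinAt_iff_contDiffWithinAt]
    have hf' : ContMDiffAt I 𝓘(ℝ, W) 1 f ((κ.extend I).symm (κ.extend I y₀)) := by
      rwa [κ.extend_left_inv hy₀]
    exact hf'.comp_contMDiffWithinAt _
      ((contMDiffWithinAt_extend_symm hκ hy₀).of_le (by norm_cast))
  obtain ⟨K', s', hs', hlip'⟩ := h1.exists_lipschitzOnWith I.convex_range
  have hκs : ∀ᶠ y in 𝓝 y₀, κ.extend I y ∈ s' := by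
    have h2 : Tendsto (κ.extend I) (𝓝 y₀) (𝓝[range I] (κ.extend I y₀)) := by
      refine tendsto_nhdsWithin_iff.2 ⟨(κ.continuousAt_extend hy₀), Eventually.of_forall fun y =>
          ?_⟩
      exact ⟨κ y, rfl⟩
    exact h2 hs'
  have h3 : Dominated (𝓝 y₀) f (κ.extend I) := by
    refine (LipschitzOnWith.dominated hlip' hκs).congr ?_
    filter_upwards [κ.open_source.mem_nhds hy₀] with y hy
    simp only [Function.comp_apply]
    rw [κ.extend_left_inv hy]
  have h4 : Dominated (𝓝 y₀) (κ.extend I) j := by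
    refine (LipschitzOnWith.dominated (l := 𝓝 y₀) (g := j) hlip (hj hs)).congr ?_
    filter_upwards [hrj] with y hy using hy.symm
  exact h3.trans h4

end Retraction

/-! ### Extending functions from the manifold and the sections to the ambient Euclidean space. -/

section Sections

variable {n m : ℕ} [NeZero n] {M : Type*} [TopologicalSpace M]
  [ChartedSpace (EuclideanSpace ℝ (Fin (n + 1))) M] [IsManifold (𝓡 (n + 1)) ∞ M]
  {S : Type*} [TopologicalSpace S] [ChartedSpace (EuclideanHalfSpace n) S]
  [IsManifold (𝓡∂ n) ∞ S] {e : M → EuclideanSpace ℝ (Fin m)}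
  (he : IsSmoothEmbedding (𝓡 (n + 1)) (𝓡 m) ∞ e)
include he

/-- Composition with `B` turns maps on `M` into maps on an open set of a Euclidean space, where
`fderiv` and Lipschitz estimates apply. -/
lemma exists_retraction (p : M) : ∃ B : EuclideanSpace ℝ (Fin m) → M,
    ContMDiffAt (𝓡 m) (𝓡 (n + 1)) ∞ B (e p) ∧ ∀ᶠ q in 𝓝 p, B (e q) = q := by
  obtain ⟨κ, hκ, hp, ρ, hρ, hρe⟩ := exists_chart_leftInverse (he.isImmersion.isImmersionAt p)
  refine ⟨fun z => (κ.extend (𝓡 (n + 1))).symm (ρ z), ?_, ?_⟩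
  · have h1 := contMDiffWithinAt_extend_symm hκ hp
    rw [ModelWithCorners.range_eq_univ] at h1
    have h2 := h1.contMDiffAt univ_mem
    rw [← hρe p hp] at h2
    exact h2.comp (e p) hρ
  · filter_upwards [κ.open_source.mem_nhds hp] with q hq
    rw [hρe q hq, κ.extend_left_inv hq]

lemma exists_chart_leftInverse_comp {σ : S → M} (hσ : IsSmoothEmbedding (𝓡∂ n) (𝓡 (n + 1)) ∞ σ)
    (y : S) : ∃ κ ∈ IsManifold.maximalAtlas (𝓡∂ n) ∞ S, y ∈ κ.source ∧
      ∃ r : EuclideanSpace ℝ (Fin m) → EuclideanSpace ℝ (Fin n),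
        ContDiffAt ℝ ∞ r (e (σ y)) ∧ ∀ᶠ z in 𝓝 y, r (e (σ z)) = κ.extend (𝓡∂ n) z := by
  obtain ⟨κ, hκ, hy, ρ, hρ, hρσ⟩ := exists_chart_leftInverse (hσ.isImmersion.isImmersionAt y)
  obtain ⟨B, hB, hBe⟩ := exists_retraction he (σ y)
  refine ⟨κ, hκ, hy, ρ ∘ B, ?_, ?_⟩
  · rw [← contMDiffAt_iff_contDiffAt]
    rw [← hBe.self_of_nhds] at hρ
    exact hρ.comp _ hB
  · filter_upwards [κ.open_source.mem_nhds hy,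
      hσ.contMDiff.continuous.continuousAt.eventually hBe] with z hz hz'
    simp only [Function.comp_apply]
    rw [hz', hρσ z hz]

/-- At an interior point the inverse chart is smooth on a full neighbourhood and can follow the left
inverse `r`. At a boundary point it is smooth only within the half-space, and only the chart-valued
left inverse of `exists_chart_leftInverse_comp` is available. -/
lemma exists_retraction_section {σ : S → M} (hσ : IsSmoothEmbedding (𝓡∂ n) (𝓡 (n + 1)) ∞ σ)
    {y : S} (hy : (𝓡∂ n).IsInteriorPoint y) : ∃ B : EuclideanSpace ℝ (Fin m) → S,
      ContMDiffAt (𝓡 m) (𝓡∂ n) ∞ B (e (σ y)) ∧ ∀ᶠ z in 𝓝 y, B (e (σ z)) = z := by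
  obtain ⟨κ, hκ, hyκ, r, hr, hrσ⟩ := exists_chart_leftInverse_comp he hσ y
  refine ⟨fun z => (κ.extend (𝓡∂ n)).symm (r z), ?_, ?_⟩
  · have h1 := contMDiffWithinAt_extend_symm hκ hyκ
    have h3 : range (𝓡∂ n) ∈ 𝓝 (κ.extend (𝓡∂ n) y) := mem_of_superset
      (mem_interior_iff_mem_nhds.1 (extend_mem_interior_target hκ hyκ hy))
      (κ.extend_target_subset_range)
    have h2 := h1.contMDiffAt h3
    rw [← hrσ.self_of_nhds] at h2
    exact h2.comp (e (σ y)) hr.contMDiffAt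
  · filter_upwards [κ.open_source.mem_nhds hyκ, hrσ] with z hz hz'
    rw [hz', κ.extend_left_inv hz]

/-- `C¹` maps on a hypersurface are locally Lipschitz with respect to the ambient metric. -/
lemma dominated_section {σ : S → M} (hσ : IsSmoothEmbedding (𝓡∂ n) (𝓡 (n + 1)) ∞ σ) {y : S}
    {W : Type*} [NormedAddCommGroup W] [NormedSpace ℝ W] {f : S → W}
    (hf : ContMDiffAt (𝓡∂ n) 𝓘(ℝ, W) 1 f y) : Dominated (𝓝 y) f (fun z => e (σ z)) := by
  obtain ⟨κ, hκ, hyκ, r, hr, hrσ⟩ := exists_chart_leftInverse_comp he hσ y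
  exact dominated_of_chart_leftInverse
    (he.contMDiff.continuous.comp hσ.contMDiff.continuous).continuousAt hκ hyκ
    (hr.of_le (by norm_cast)) hrσ hf

/-- `C¹` maps on the ambient manifold are locally Lipschitz with respect to the ambient metric. -/
lemma dominated_ambient {p : M} {W : Type*} [NormedAddCommGroup W] [NormedSpace ℝ W] {f : M → W}
    (hf : ContMDiffAt (𝓡 (n + 1)) 𝓘(ℝ, W) 1 f p) : Dominated (𝓝 p) f e := by
  obtain ⟨B, hB, hBe⟩ := exists_retraction he p
  have hp : B (e p) = p := hBe.self_of_nhds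
  have h1 : ContDiffAt ℝ 1 (f ∘ B) (e p) := by
    rw [← contMDiffAt_iff_contDiffAt]
    rw [← hp] at hf
    exact hf.comp _ (hB.of_le (by norm_cast))
  obtain ⟨K, s, hs, hlip⟩ := h1.exists_lipschitzOnWith
  refine (LipschitzOnWith.dominated (l := 𝓝 p) (g := e) hlip
    (he.contMDiff.continuous.continuousAt hs)).congr ?_
  filter_upwards [hBe] with q hq
  simp [hq]

/-- The point where a trajectory hits a section depends in a Lipschitz way on its origin. -/
lemma IsTransversal.dominated {φ : Flow ℝ M} {σ : S → M} (h : IsTransversal n φ σ) {p₀ : M} {t₀ : ℝ}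
    {y₀ : S} (h₀ : φ t₀ p₀ = σ y₀) {Q : Type*} {l : Filter Q} {p : Q → M} {t : Q → ℝ} {y : Q → S}
    (hp : Tendsto p l (𝓝 p₀)) (ht : Tendsto t l (𝓝 t₀)) (hQ : ∀ᶠ c in l, φ (t c) (p c) = σ (y c)) :
    Dominated l (fun c => e (σ (y c))) (fun c => e (p c)) := by
  obtain ⟨τ, hτ, hτ0, hτu, -⟩ := h.hitting h₀
  have h1 : ContMDiffAt (𝓡 (n + 1)) (𝓡 m) 1 (fun p => e (φ (τ p) p)) p₀ := by
    have h2 : ContMDiffAt (𝓡 (n + 1)) (𝓡 (n + 1)) 1 (fun p => φ (τ p) p) p₀ :=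
      ContMDiffAt.comp (g := fun q : ℝ × M => φ q.1 q.2) (f := fun p => (τ p, p)) p₀
        (h.contMDiff_flow (τ p₀, p₀)) (hτ.prodMk contMDiffAt_id)
    exact ((he.contMDiff _).of_le (by norm_cast)).comp p₀ h2
  refine ((dominated_ambient he h1).comp_tendsto hp).congr ?_
  filter_upwards [hQ, (hp.prodMk_nhds ht).eventually hτu] with c hc hc'
  rw [← hc, ← hc' (hc ▸ ⟨_, rfl⟩)]

end Sections

/-! ### Local `C¹` branches of the hitting map, and a countable supply of them. -/

section Branches

variable {n : ℕ} [NeZero n] {M : Type*} [TopologicalSpace M]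
  [ChartedSpace (EuclideanSpace ℝ (Fin (n + 1))) M] [IsManifold (𝓡 (n + 1)) ∞ M]
  {S : Type*} [TopologicalSpace S] [ChartedSpace (EuclideanHalfSpace n) S]
  [IsManifold (𝓡∂ n) ∞ S]

lemma isImmersionAt_of_le {E H : Type*} [NormedAddCommGroup E] [NormedSpace ℝ E]
    [TopologicalSpace H] {I : ModelWithCorners ℝ E H} {S : Type*} [TopologicalSpace S]
    [ChartedSpace H S] {E' H' : Type*} [NormedAddCommGroup E'] [NormedSpace ℝ E']
    [TopologicalSpace H'] {J : ModelWithCorners ℝ E' H'} {N : Type*} [TopologicalSpace N]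
    [ChartedSpace H' N] {k l : ℕ∞ω} (hkl : k ≤ l) {f : S → N} {x : S}
    (hf : IsImmersionAt I J l f x) : IsImmersionAt I J k f x :=
  .mk_of_charts hf.equiv hf.domChart hf.codChart hf.mem_domChart_source hf.mem_codChart_source
    (IsManifold.maximalAtlas_subset_of_le hkl hf.domChart_mem_maximalAtlas)
    (IsManifold.maximalAtlas_subset_of_le hkl hf.codChart_mem_maximalAtlas)
    hf.source_subset_preimage_source hf.writtenInCharts

variable (n) in
/-- A `C¹` family of trajectory segments that lead from an open set of the ambient manifold to
interior points of a section, together with a smaller closed set of initial points. -/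
structure Branch (φ : Flow ℝ M) (σ : S → M) where
  dom : Set M
  core : Set M
  time : M → ℝ
  proj : M → S
  isOpen_dom : IsOpen dom
  isClosed_core : IsClosed core
  core_subset : core ⊆ dom
  contMDiffOn_time : ContMDiffOn (𝓡 (n + 1)) 𝓘(ℝ, ℝ) 1 time dom
  contMDiffOn_proj : ContMDiffOn (𝓡 (n + 1)) (𝓡∂ n) 1 proj dom
  flow_time : ∀ p ∈ dom, φ (time p) p = σ (proj p)
  isInteriorPoint : ∀ p ∈ dom, (𝓡∂ n).IsInteriorPoint (proj p)

/-- The time comes from `IsTransversal.hitting`. The hitting point is `C¹` as a map to `M`, and it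
is `C¹` as a map to the section because an embedding reflects continuity and an immersion reflects
smoothness. Regularity of `M` provides the closed core. -/
lemma IsTransversal.exists_branch [T2Space M] [CompactSpace M] {φ : Flow ℝ M} {σ : S → M}
    (h : IsTransversal n φ σ) {p₀ : M} {t₀ : ℝ} {y₀ : S} (h₀ : φ t₀ p₀ = σ y₀)
    (hy₀ : (𝓡∂ n).IsInteriorPoint y₀) :
    ∃ b : Branch n φ σ, ∀ᶠ q : M × ℝ in 𝓝 (p₀, t₀),
      q.1 ∈ b.core ∧ (φ q.2 q.1 ∈ range σ → q.2 = b.time q.1) := by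
  obtain ⟨τ, hτ, hτ0, hτu, hτi⟩ := h.hitting h₀
  have hτi := hτi hy₀
  have hΦ : ContMDiffAt (𝓡 (n + 1)) (𝓡 (n + 1)) 1 (fun p => φ (τ p) p) p₀ :=
    ContMDiffAt.comp (g := fun q : ℝ × M => φ q.1 q.2) (f := fun p => (τ p, p)) p₀
      (h.contMDiff_flow (τ p₀, p₀)) (hτ.prodMk contMDiffAt_id)
  classical
  let π : M → S := fun p => if hp : φ (τ p) p ∈ range σ then hp.choose else y₀
  have hπ : ∀ p, φ (τ p) p ∈ range σ → σ (π p) = φ (τ p) p := by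
    intro p hp
    simp only [π, dif_pos hp]
    exact hp.choose_spec
  have hπ0 : π p₀ = y₀ := by
    refine h.isSmoothEmbedding.isEmbedding.injective ?_
    rw [hπ p₀ hτi.self_of_nhds, hτ0, h₀]
  have hσπ : σ ∘ π =ᶠ[𝓝 p₀] fun p => φ (τ p) p := by
    filter_upwards [hτi] with p hp using hπ p hp
  have hπc : ContMDiffAt (𝓡 (n + 1)) (𝓡∂ n) 1 π p₀ := by
    rw [ContMDiffAt.iff_comp_isImmersionAt (isImmersionAt_of_le
        (by norm_cast : (1 : ℕ∞ω) ≤ (∞ : ℕ∞ω))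
      (h.isSmoothEmbedding.isImmersion.isImmersionAt (π p₀)))]
    refine ⟨?_, hΦ.congr_of_eventuallyEq hσπ⟩
    rw [h.isSmoothEmbedding.isEmbedding.isInducing.continuousAt_iff]
    exact hΦ.continuousAt.congr hσπ.symm
  have hint : ∀ᶠ p in 𝓝 p₀, (𝓡∂ n).IsInteriorPoint (π p) := by
    refine hπc.continuousAt.eventually (p := fun y => (𝓡∂ n).IsInteriorPoint y) ?_
    rw [hπ0]
    exact ((𝓡∂ n).isOpen_interior (M := S) (n := (∞ : ℕ∞ω)) (by simp)).mem_nhds hy₀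
  have hall := ((contMDiffAt_iff_contMDiffAt_nhds (by simp)).1 hτ).and
    (((contMDiffAt_iff_contMDiffAt_nhds (by simp)).1 hπc).and (hτi.and hint))
  obtain ⟨W, hW, hWo, hpW⟩ := eventually_nhds_iff.1 hall
  obtain ⟨C, hC, hCc, hCW⟩ := exists_mem_nhds_isClosed_subset (hWo.mem_nhds hpW)
  refine ⟨⟨W, C, τ, π, hWo, hCc, hCW, fun p hp => (hW p hp).1.contMDiffWithinAt,
    fun p hp => (hW p hp).2.1.contMDiffWithinAt, fun p hp => (hπ p (hW p hp).2.2.1).symm,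
    fun p hp => (hW p hp).2.2.2⟩, ?_⟩
  filter_upwards [hτu, continuousAt_fst.eventually hC] with q hq hq' using ⟨hq', hq⟩

lemma Branch.continuousAt_time {φ : Flow ℝ M} {σ : S → M} (b : Branch n φ σ) {p : M}
    (hp : p ∈ b.dom) : ContinuousAt b.time p :=
  (b.contMDiffOn_time.continuousOn).continuousAt (b.isOpen_dom.mem_nhds hp)

lemma Branch.contMDiffAt_proj {φ : Flow ℝ M} {σ : S → M} (b : Branch n φ σ) {p : M}
    (hp : p ∈ b.dom) : ContMDiffAt (𝓡 (n + 1)) (𝓡∂ n) 1 b.proj p :=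
  b.contMDiffOn_proj.contMDiffAt (b.isOpen_dom.mem_nhds hp)

/-- Countably many branches suffice to describe all trajectories that lead to interior points of a
section. -/
lemma IsTransversal.exists_countable_branches [T2Space M] [CompactSpace M] {φ : Flow ℝ M}
    {σ : S → M} (h : IsTransversal n φ σ) {p₀ : M} {t₀ : ℝ} {y₀ : S} (h₀ : φ t₀ p₀ = σ y₀)
    (hy₀ : (𝓡∂ n).IsInteriorPoint y₀) :
    ∃ B : ℕ → Branch n φ σ, ∀ p t y, φ t p = σ y → (𝓡∂ n).IsInteriorPoint y →
      ∃ i, p ∈ (B i).core ∧ (B i).time p = t ∧ (B i).proj p = y := by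
  have : SecondCountableTopology M :=
    ChartedSpace.secondCountable_of_sigmaCompact (EuclideanSpace ℝ (Fin (n + 1))) M
  let R : Set (M × ℝ) := {q | ∃ y, φ q.2 q.1 = σ y ∧ (𝓡∂ n).IsInteriorPoint y}
  have hR : ∀ q ∈ R, ∃ b : Branch n φ σ, ∀ᶠ q' : M × ℝ in 𝓝[R] q,
      q'.1 ∈ b.core ∧ (φ q'.2 q'.1 ∈ range σ → q'.2 = b.time q'.1) := by
    rintro ⟨p, t⟩ ⟨y, hy, hyi⟩
    obtain ⟨b, hb⟩ := h.exists_branch hy hyi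
    exact ⟨b, nhdsWithin_le_nhds hb⟩
  -- The given trajectory supplies one branch, so the countable family can be indexed by `ℕ`. The
  -- Lindelöf argument runs over pairs (starting point, time), since one point may reach the section
  -- at many times.
  have hne : Nonempty (Branch n φ σ) := ⟨(hR (p₀, t₀) ⟨y₀, h₀, hy₀⟩).choose⟩
  choose! b hb using hR
  obtain ⟨s, hsR, hsc, hs⟩ := TopologicalSpace.countable_cover_nhdsWithin hb
  have hsne : s.Nonempty := by
    by_contra hempty
    rw [not_nonempty_iff_eq_empty] at hempty
    have : (p₀, t₀) ∈ R := ⟨y₀, h₀, hy₀⟩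
    simpa [hempty] using hs this
  obtain ⟨u, hu⟩ := hsc.exists_eq_range hsne
  refine ⟨fun i => b (u i), fun p t y hy hyi => ?_⟩
  have hq : (p, t) ∈ R := ⟨y, hy, hyi⟩
  obtain ⟨q, hqs, hq'⟩ := mem_iUnion₂.1 (hs hq)
  rw [hu] at hqs
  obtain ⟨i, rfl⟩ := hqs
  have hq1 : p ∈ (b (u i)).core := hq'.1
  have hq2 : t = (b (u i)).time p := hq'.2 ⟨y, hy.symm⟩
  refine ⟨i, hq1, hq2.symm, h.isSmoothEmbedding.isEmbedding.injective ?_⟩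
  rw [← (b (u i)).flow_time p ((b (u i)).core_subset hq1), ← hq2, hy]

end Branches

/-! ### Families of maps that are jointly `C¹` -/

section JointC1

variable {P V W Z : Type*} [TopologicalSpace P] [NormedAddCommGroup V] [NormedSpace ℝ V]
  [NormedAddCommGroup W] [NormedSpace ℝ W] [NormedAddCommGroup Z] [NormedSpace ℝ Z]

/-- The family of maps `f p`, `p ∈ P`, is differentiable near `q`, and the maps and their
derivatives depend continuously on both arguments at `q`. -/
def JointC1At (f : P → V → W) (q : P × V) : Prop :=
  (∀ᶠ r in 𝓝 q, DifferentiableAt ℝ (f r.1) r.2) ∧ ContinuousAt (fun r : P × V => f r.1 r.2) q ∧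
    ContinuousAt (fun r : P × V => fderiv ℝ (f r.1) r.2) q

lemma JointC1At.comp {g : P → W → Z} {f : P → V → W} {q : P × V}
    (hg : JointC1At g (q.1, f q.1 q.2)) (hf : JointC1At f q) :
    JointC1At (fun p v => g p (f p v)) q := by
  have ht : Tendsto (fun r : P × V => (r.1, f r.1 r.2)) (𝓝 q) (𝓝 (q.1, f q.1 q.2)) :=
    continuousAt_fst.prodMk hf.2.1
  have hd : ∀ᶠ r : P × V in 𝓝 q, DifferentiableAt ℝ (g r.1) (f r.1 r.2) := ht.eventually hg.1
  refine ⟨?_, ?_, ?_⟩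
  · filter_upwards [hf.1, hd] with r h1 h2 using h2.comp r.2 h1
  · exact ContinuousAt.comp (g := fun r : P × W => g r.1 r.2)
      (f := fun r : P × V => (r.1, f r.1 r.2)) hg.2.1 ht
  · have h3 : ContinuousAt (fun r : P × V => fderiv ℝ (g r.1) (f r.1 r.2)) q :=
      ContinuousAt.comp (g := fun r : P × W => fderiv ℝ (g r.1) r.2)
        (f := fun r : P × V => (r.1, f r.1 r.2)) hg.2.2 ht
    refine (h3.clm_comp hf.2.2).congr ?_
    filter_upwards [hf.1, hd] with r h1 h2 using (fderiv_comp r.2 h2 h1).symm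

lemma JointC1At.of_contDiffAt {g : V → W} {z : V} (hg : ContDiffAt ℝ 1 g z) (p : P) :
    JointC1At (fun _ : P => g) (p, z) := by
  refine ⟨?_, ?_, ?_⟩
  · have : ∀ᶠ v in 𝓝 z, DifferentiableAt ℝ g v := by
      filter_upwards [hg.eventually (by simp)] with v hv using hv.differentiableAt one_ne_zero
    exact (continuousAt_snd (p := (p, z))).eventually this
  · exact ContinuousAt.comp (g := g) (x := (p, z)) hg.continuousAt continuousAt_snd
  · exact ContinuousAt.comp (g := fderiv ℝ g) (x := (p, z))
      (hg.continuousAt_fderiv one_ne_zero) continuousAt_snd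

lemma JointC1At.congr {f g : P → V → W} {q : P × V} (hf : JointC1At f q)
    (h : ∀ᶠ r in 𝓝 q, g r.1 r.2 = f r.1 r.2) : JointC1At g q := by
  have h' : ∀ᶠ r in 𝓝 q, g r.1 =ᶠ[𝓝 r.2] f r.1 := by
    filter_upwards [h.eventually_nhds] with r hr
    have : Tendsto (fun v : V => (r.1, v)) (𝓝 r.2) (𝓝 r) :=
      (Continuous.prodMk_right r.1).continuousAt
    exact this.eventually hr
  refine ⟨?_, hf.2.1.congr (h.mono fun r hr => hr.symm), hf.2.2.congr ?_⟩
  · filter_upwards [hf.1, h'] with r h1 h2 using h1.congr_of_eventuallyEq h2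
  · filter_upwards [h'] with r h2 using h2.fderiv_eq.symm

end JointC1

/-! ### The space of impulses as a topological space -/

section ImpulseSpace

variable {n m : ℕ} [NeZero n] {M : Type*} [TopologicalSpace M]
  [ChartedSpace (EuclideanSpace ℝ (Fin (n + 1))) M] [IsManifold (𝓡 (n + 1)) ∞ M]
  {D D' : Type*} [TopologicalSpace D] [ChartedSpace (EuclideanHalfSpace n) D]
  [IsManifold (𝓡∂ n) ∞ D] [TopologicalSpace D'] [ChartedSpace (EuclideanHalfSpace n) D']
  [IsManifold (𝓡∂ n) ∞ D']

variable (n) in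
/-- The space of impulses with the `C¹` distance. -/
@[nolint unusedArguments]
def ImpulseSpace (_ι : D → M) (_ι' : D' → M) (_e : M → EuclideanSpace ℝ (Fin m)) : Type _ :=
  Impulses n D D'

instance (ι : D → M) (ι' : D' → M) (e : M → EuclideanSpace ℝ (Fin m)) :
    PseudoEMetricSpace (ImpulseSpace n ι ι' e) := c1PseudoEMetric ι ι' e

variable {ι : D → M} {ι' : D' → M} {e : M → EuclideanSpace ℝ (Fin m)}

/-- The diffeomorphism underlying a point of the space of impulses. -/
def ImpulseSpace.diffeo (J : ImpulseSpace n ι ι' e) : Impulses n D D' := J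

lemma edist_apply_le (I J : ImpulseSpace n ι ι' e) (y : D) :
    edist (e (ι' (I.diffeo y))) (e (ι' (J.diffeo y))) ≤ edist I J :=
  le_max_of_le_left (le_iSup (fun y : D => edist (e (ι' (I.diffeo y))) (e (ι' (J.diffeo y)))) y)

/-- The distance controls only vectors of ambient length at most one; homogeneity extends this to
all vectors. -/
lemma norm_derivAt_sub_le (I J : ImpulseSpace n ι ι' e) {δ : ℝ} (hδ : 0 ≤ δ)
    (h : edist I J ≤ ENNReal.ofReal δ) (y : D) (v : EuclideanSpace ℝ (Fin n)) :
    ‖derivAt (e ∘ ι' ∘ I.diffeo) y v - derivAt (e ∘ ι' ∘ J.diffeo) y v‖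
      ≤ δ * ‖derivAt (e ∘ ι) y v‖ := by
  have key : ∀ w : EuclideanSpace ℝ (Fin n), ‖derivAt (e ∘ ι) y w‖ ≤ 1 →
      ‖derivAt (e ∘ ι' ∘ I.diffeo) y w - derivAt (e ∘ ι' ∘ J.diffeo) y w‖ ≤ δ := by
    intro w hw
    have h1 : edist (derivAt (e ∘ ι' ∘ I.diffeo) y w) (derivAt (e ∘ ι' ∘ J.diffeo) y w)
        ≤ edist I J :=
      le_max_of_le_right (le_iSup_of_le y (le_iSup_of_le w (le_iSup_of_le hw le_rfl)))
    have h2 := h1.trans h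
    rwa [edist_dist, dist_eq_norm, ENNReal.ofReal_le_ofReal_iff hδ] at h2
  refine le_of_forall_pos_le_add fun ε hε => ?_
  -- Rescaling by some `s` slightly larger than the length of `v` avoids dividing by a length that
  -- may vanish.
  obtain ⟨s, hs, hsε⟩ : ∃ s : ℝ, ‖derivAt (e ∘ ι) y v‖ < s ∧ δ * s ≤
      δ * ‖derivAt (e ∘ ι) y v‖ + ε := by
    refine ⟨‖derivAt (e ∘ ι) y v‖ + ε / (δ + 1), by linarith [show 0 < ε / (δ + 1) by positivity],
        ?_⟩
    rw [mul_add]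
    gcongr
    rw [mul_div_assoc', div_le_iff₀ (by positivity)]
    nlinarith
  have hs0 : 0 < s := (norm_nonneg _).trans_lt hs
  have h3 := key (s⁻¹ • v) (by
    rw [map_smul, norm_smul, norm_inv, Real.norm_of_nonneg hs0.le, inv_mul_le_iff₀ hs0]
    linarith)
  rw [map_smul, map_smul, ← smul_sub, norm_smul, norm_inv, Real.norm_of_nonneg hs0.le,
    inv_mul_le_iff₀ hs0] at h3
  linarith [mul_comm s δ]

variable (he : IsSmoothEmbedding (𝓡 (n + 1)) (𝓡 m) ∞ e)
  (hι : IsSmoothEmbedding (𝓡∂ n) (𝓡 (n + 1)) ∞ ι)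
  (hι' : IsSmoothEmbedding (𝓡∂ n) (𝓡 (n + 1)) ∞ ι')

include he hι' in
-- The `C⁰` part of the distance is uniform in the point, so joint continuity follows from
-- continuity of the single impulse `J₀`.
lemma continuous_impulse_apply :
    Continuous fun q : ImpulseSpace n ι ι' e × D => q.1.diffeo q.2 := by
  rw [(he.isEmbedding.isInducing.comp hι'.isEmbedding.isInducing).continuous_iff,
    continuous_iff_continuousAt]
  rintro ⟨J₀, y₀⟩
  rw [ContinuousAt, tendsto_iff_edist_tendsto_0]
  have h1 : Tendsto (fun q : ImpulseSpace n ι ι' e × D => edist q.1 J₀ +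
      edist (e (ι' (J₀.diffeo q.2))) (e (ι' (J₀.diffeo y₀)))) (𝓝 (J₀, y₀)) (𝓝 (0 + 0)) := by
    refine Tendsto.add ?_ ?_
    · rw [← tendsto_iff_edist_tendsto_0]
      exact continuousAt_fst
    · rw [← tendsto_iff_edist_tendsto_0]
      have : Continuous fun y => e (ι' (J₀.diffeo y)) :=
        he.isEmbedding.continuous.comp (hι'.isEmbedding.continuous.comp J₀.diffeo.continuous)
      exact (this.comp continuous_snd).continuousAt (x := (J₀, y₀))
  rw [add_zero] at h1
  refine tendsto_of_tendsto_of_tendsto_of_le_of_le tendsto_const_nhds h1 (fun _ => zero_le)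
    fun q => ?_
  exact (edist_triangle _ (e (ι' (J₀.diffeo q.2))) _).trans
    (add_le_add (edist_apply_le _ _ _) le_rfl)

include he hι' in
lemma contMDiff_impulse (J : ImpulseSpace n ι ι' e) :
    ContMDiff (𝓡∂ n) (𝓡 m) 1 (e ∘ ι' ∘ J.diffeo) :=
  (he.contMDiff.of_le (by norm_cast)).comp
    ((hι'.contMDiff.of_le (by norm_cast)).comp J.diffeo.contMDiff)

include he hι hι' in
/-- Impulses and their derivatives depend continuously on the impulse and the point. -/
lemma jointC1At_impulse {V : Type*} [NormedAddCommGroup V] [NormedSpace ℝ V] {B : V → D} {ζ₀ : V}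
    (hB : ContMDiffAt 𝓘(ℝ, V) (𝓡∂ n) 1 B ζ₀) (J₀ : ImpulseSpace n ι ι' e) :
    JointC1At (fun (J : ImpulseSpace n ι ι' e) ζ => e (ι' (J.diffeo (B ζ)))) (J₀, ζ₀) := by
  have hBd : ∀ᶠ ζ in 𝓝 ζ₀, MDifferentiableAt 𝓘(ℝ, V) (𝓡∂ n) B ζ := by
    filter_upwards [(contMDiffAt_iff_contMDiffAt_nhds (by simp)).1 hB] with ζ hζ
      using hζ.mdifferentiableAt one_ne_zero
  have hchain : ∀ (f : D → EuclideanSpace ℝ (Fin m)) (_ : ContMDiff (𝓡∂ n) (𝓡 m) 1 f) (ζ : V),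
      MDifferentiableAt 𝓘(ℝ, V) (𝓡∂ n) B ζ → DifferentiableAt ℝ (fun ζ => f (B ζ)) ζ ∧
        ∀ p, fderiv ℝ (fun ζ => f (B ζ)) ζ p
          = derivAt f (B ζ) (mfderiv 𝓘(ℝ, V) (𝓡∂ n) B ζ p) := by
    intro f hf ζ hζ
    have h1 : MDifferentiableAt (𝓡∂ n) (𝓡 m) f (B ζ) := (hf _).mdifferentiableAt one_ne_zero
    refine ⟨(h1.comp ζ hζ).differentiableAt, fun p => ?_⟩
    have h2 := mfderiv_comp ζ h1 hζ
    rw [mfderiv_eq_fderiv] at h2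
    exact congrArg (fun L => L p) h2
  have hsnd : Tendsto (fun q : ImpulseSpace n ι ι' e × V => q.2) (𝓝 (J₀, ζ₀)) (𝓝 ζ₀) :=
    continuousAt_snd
  have hfst : Tendsto (fun q : ImpulseSpace n ι ι' e × V => q.1) (𝓝 (J₀, ζ₀)) (𝓝 J₀) :=
    continuousAt_fst
  have hC1 : ContDiffAt ℝ 1 (fun ζ => e (ι' (J₀.diffeo (B ζ)))) ζ₀ := by
    rw [← contMDiffAt_iff_contDiffAt]
    exact ((contMDiff_impulse he hι' J₀) _).comp ζ₀ hB
  have hιe : ContMDiff (𝓡∂ n) (𝓡 m) 1 (e ∘ ι) :=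
    (he.contMDiff.of_le (by norm_cast)).comp (hι.contMDiff.of_le (by norm_cast))
  have hC2 : ContDiffAt ℝ 1 (fun ζ => (e ∘ ι) (B ζ)) ζ₀ := by
    rw [← contMDiffAt_iff_contDiffAt]
    exact (hιe _).comp ζ₀ hB
  refine ⟨?_, ?_, ?_⟩
  · filter_upwards [hsnd.eventually hBd] with q hq
    exact (hchain _ (contMDiff_impulse he hι' q.1) q.2 hq).1
  · have h1 : ContinuousAt (fun q : ImpulseSpace n ι ι' e × V => (q.1, B q.2)) (J₀, ζ₀) :=
      continuousAt_fst.prodMk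
        (ContinuousAt.comp (g := B) (x := (J₀, ζ₀)) hB.continuousAt continuousAt_snd)
    have h2 := (he.isEmbedding.continuous.comp (hι'.isEmbedding.continuous.comp
      (continuous_impulse_apply (ι := ι) he hι'))).continuousAt (x := (J₀, B ζ₀))
    exact ContinuousAt.comp (g := e ∘ ι' ∘ fun q : ImpulseSpace n ι ι' e × D => q.1.diffeo q.2)
      (f := fun q : ImpulseSpace n ι ι' e × V => (q.1, B q.2)) h2 h1
  · have h1 : Tendsto (fun q : ImpulseSpace n ι ι' e × V =>
        fderiv ℝ (fun ζ => e (ι' (J₀.diffeo (B ζ)))) q.2) (𝓝 (J₀, ζ₀))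
        (𝓝 (fderiv ℝ (fun ζ => e (ι' (J₀.diffeo (B ζ)))) ζ₀)) :=
      (hC1.continuousAt_fderiv one_ne_zero).tendsto.comp hsnd
    have h2 : Tendsto (fun q : ImpulseSpace n ι ι' e × V =>
        ‖fderiv ℝ (fun ζ => (e ∘ ι) (B ζ)) q.2‖) (𝓝 (J₀, ζ₀))
        (𝓝 ‖fderiv ℝ (fun ζ => (e ∘ ι) (B ζ)) ζ₀‖) :=
      ((hC2.continuousAt_fderiv one_ne_zero).tendsto.comp hsnd).norm
    -- Near `ζ₀`, `K` bounds the stretching of `e ∘ ι ∘ B`. It converts the `C¹` distance, which is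
    -- relative to lengths in `D`, into an operator norm on `V`; hence the threshold `ε / (4 * K)`.
    set K := ‖fderiv ℝ (fun ζ => (e ∘ ι) (B ζ)) ζ₀‖ + 1
    have h2' := h2.eventually (gt_mem_nhds (lt_add_one _))
    refine Metric.tendsto_nhds.2 fun ε hε => ?_
    have hK : 0 < K := by positivity
    have hdist : ∀ᶠ q : ImpulseSpace n ι ι' e × V in 𝓝 (J₀, ζ₀),
        edist q.1 J₀ < ENNReal.ofReal (ε / (4 * K)) := by
      have := hfst.eventually (Metric.eball_mem_nhds J₀ (ε := ENNReal.ofReal (ε / (4 * K)))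
        (by simp; positivity))
      exact this
    filter_upwards [hdist, h2', hsnd.eventually hBd,
      (Metric.tendsto_nhds.1 h1 (ε / 2) (by positivity))] with q hq1 hq2 hq3 hq4
    have h5 : dist (fderiv ℝ (fun ζ => e (ι' (q.1.diffeo (B ζ)))) q.2)
        (fderiv ℝ (fun ζ => e (ι' (J₀.diffeo (B ζ)))) q.2) ≤ ε / 4 := by
      rw [dist_eq_norm]
      refine ContinuousLinearMap.opNorm_le_bound _ (by positivity) fun p => ?_
      rw [sub_apply]
      have e1 := (hchain _ (contMDiff_impulse he hι' q.1) q.2 hq3).2 p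
      have e2 := (hchain _ (contMDiff_impulse he hι' J₀) q.2 hq3).2 p
      have e3 := (hchain _ hιe q.2 hq3).2 p
      simp only [Function.comp_apply] at e1 e2
      rw [e1, e2]
      refine (norm_derivAt_sub_le q.1 J₀ (by positivity) hq1.le _ _).trans ?_
      rw [← e3]
      calc ε / (4 * K) * ‖fderiv ℝ (fun ζ => (e ∘ ι) (B ζ)) q.2 p‖
          ≤ ε / (4 * K) * (K * ‖p‖) := by
            gcongr
            exact (ContinuousLinearMap.le_opNorm _ _).trans
              (mul_le_mul_of_nonneg_right hq2.le (norm_nonneg _))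
        _ = ε / 4 * ‖p‖ := by field_simp
    calc _ ≤ _ := dist_triangle _ (fderiv ℝ (fun ζ => e (ι' (J₀.diffeo (B ζ)))) q.2) _
      _ < ε := by linarith

end ImpulseSpace

/-! ### Generic affine perturbations of a map of a Euclidean space -/

section Generic

variable {n : ℕ}

/-- The determinant form shows that the value of the characteristic polynomial is jointly continuous
in the map and the complex number. -/
lemma aeval_charpoly_eq_det (L : (EuclideanSpace ℝ (Fin n)) →L[ℝ] EuclideanSpace ℝ (Fin n))
    (ζ : ℂ) :
    Polynomial.aeval ζ (LinearMap.charpoly (L : (EuclideanSpace ℝ (Fin n)) →ₗ[ℝ] EuclideanSpace ℝ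
        (Fin n))) =
      (Matrix.scalar (Fin n) ζ -
        (Matrix.of fun i j : Fin n => ((L (EuclideanSpace.single j 1) i : ℝ) : ℂ))).det := by
  rw [← LinearMap.charpoly_toMatrix (L : (EuclideanSpace ℝ (Fin n)) →ₗ[ℝ] EuclideanSpace ℝ
      (Fin n)) (EuclideanSpace.basisFun (Fin n) ℝ).toBasis,
    Polynomial.aeval_def, Polynomial.eval₂_eq_eval_map, ← Matrix.charpoly_map, Matrix.eval_charpoly]
  congr 2

lemma continuous_aeval_charpoly : Continuous fun q :
    (EuclideanSpace ℝ (Fin n) →L[ℝ] EuclideanSpace ℝ (Fin n)) × ℂ =>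
    Polynomial.aeval q.2 (LinearMap.charpoly (q.1 : (EuclideanSpace ℝ (Fin n)) →ₗ[ℝ]
        EuclideanSpace ℝ (Fin n))) := by
  simp_rw [aeval_charpoly_eq_det]
  refine Continuous.matrix_det (Continuous.sub ?_ ?_)
  · simp only [Matrix.scalar_apply]
    exact Continuous.matrix_diagonal (by fun_prop)
  · refine continuous_matrix fun i j => ?_
    have h1 : Continuous fun q : (EuclideanSpace ℝ (Fin n) →L[ℝ] EuclideanSpace ℝ (Fin n)) × ℂ =>
        q.1 (EuclideanSpace.single j 1) := by fun_prop
    have h2 : Continuous fun v : (EuclideanSpace ℝ (Fin n)) => v i := by fun_prop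
    exact Complex.continuous_ofReal.comp (h2.comp h1)

lemma aeval_charpoly_smul (L : (EuclideanSpace ℝ (Fin n)) →L[ℝ] EuclideanSpace ℝ (Fin n)) {c : ℝ}
    (hc : c ≠ 0) {ζ : ℂ}
    (h : Polynomial.aeval ζ (LinearMap.charpoly
        ((c • L : (EuclideanSpace ℝ (Fin n)) →L[ℝ] EuclideanSpace ℝ (Fin n)) :
        (EuclideanSpace ℝ (Fin n)) →ₗ[ℝ] EuclideanSpace ℝ (Fin n))) = 0) :
    Polynomial.aeval (ζ / c) (LinearMap.charpoly
        (L : (EuclideanSpace ℝ (Fin n)) →ₗ[ℝ] EuclideanSpace ℝ (Fin n))) = 0 := by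
  rw [aeval_charpoly_eq_det] at h ⊢
  have hc' : (c : ℂ) ≠ 0 := by exact_mod_cast hc
  have : (Matrix.scalar (Fin n) ζ - (Matrix.of fun i j : Fin n =>
      (((c • L) (EuclideanSpace.single j 1) i : ℝ) : ℂ))) = (c : ℂ) •
          (Matrix.scalar (Fin n) (ζ / c) -
        (Matrix.of fun i j : Fin n => ((L (EuclideanSpace.single j 1) i : ℝ) : ℂ))) := by
    ext i j
    by_cases hij : i = j
    · subst hij; simp [mul_sub, mul_div_cancel₀, hc']
    · simp [hij]
  rw [this, Matrix.det_smul] at h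
  exact (mul_eq_zero.1 h).resolve_left (pow_ne_zero _ hc')

/-- If `(1 + a) • L` has an eigenvalue of modulus one, then `L` has an eigenvalue `w` with `‖w‖ = 1
/ (1 + a)`. So `a = 1 / ‖w‖ - 1` for one of finitely many `w`. -/
lemma finite_setOf_not_hyperbolic (L : (EuclideanSpace ℝ (Fin n)) →L[ℝ] EuclideanSpace ℝ (Fin n)) :
    {a : ℝ | a ∈ Icc (0 : ℝ) 1 ∧ ¬ IsHyperbolicLinear ((1 + a) • L)}.Finite := by
  refine ((Polynomial.rootSet_finite (LinearMap.charpoly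
      (L : (EuclideanSpace ℝ (Fin n)) →ₗ[ℝ] EuclideanSpace ℝ (Fin n))) ℂ).image
    fun w => 1 / ‖w‖ - 1).subset ?_
  rintro a ⟨ha, hL⟩
  simp only [IsHyperbolicLinear, not_forall, not_not] at hL
  obtain ⟨ζ, hζ, hζ1⟩ := hL
  have ha' : 0 < 1 + a := by linarith [ha.1]
  refine ⟨ζ / ((1 + a : ℝ) : ℂ), ?_, ?_⟩
  · rw [Polynomial.mem_rootSet]
    exact ⟨(LinearMap.charpoly_monic _).ne_zero, aeval_charpoly_smul L ha'.ne' hζ⟩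
  · simp only [norm_div, hζ1, Complex.norm_real, Real.norm_of_nonneg ha'.le]
    field_simp
    ring

/-- A vector in the kernel would be an eigenvector for the eigenvalue `1`. Hyperbolic fixed points
are thus nondegenerate solutions of the fixed point equation. -/
lemma IsHyperbolicLinear.injective_one_sub {L : (EuclideanSpace ℝ (Fin n)) →L[ℝ] EuclideanSpace ℝ
    (Fin n)} (hL : IsHyperbolicLinear L) :
    Function.Injective (fun w => w - L w) := by
  have : ∀ w, w - L w = 0 → w = 0 := by
    intro w hw
    by_contra hne
    have h1 : Module.End.HasEigenvalue (L : (EuclideanSpace ℝ (Fin n)) →ₗ[ℝ] EuclideanSpace ℝ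
        (Fin n)) 1 :=
      Module.End.hasEigenvalue_of_hasEigenvector (x := w)
        ⟨Module.End.mem_eigenspace_iff.2 (by simpa using (sub_eq_zero.1 hw).symm), hne⟩
    have h2 := (Module.End.hasEigenvalue_iff_isRoot_charpoly _ _).1 h1
    refine hL 1 ?_ (by simp)
    have h3 := Polynomial.aeval_algebraMap_apply ℂ (1 : ℝ)
        (LinearMap.charpoly (L : (EuclideanSpace ℝ (Fin n)) →ₗ[ℝ] EuclideanSpace ℝ (Fin n)))
    rw [map_one] at h3
    rw [h3, Polynomial.aeval_def, Polynomial.eval₂_eq_eval_map]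
    simp [Polynomial.IsRoot.def.1 h2]
  intro v w h
  have h' : v - L v = w - L w := h
  refine sub_eq_zero.1 (this (v - w) ?_)
  rw [map_sub, sub_sub_sub_comm, h', sub_self]

/-- The image of a closed set with empty interior under a local diffeomorphism is meagre. -/
lemma isMeagre_image_of_isInvertible_fderiv {ψ : (EuclideanSpace ℝ (Fin n)) → EuclideanSpace ℝ
    (Fin n)} {E A : Set (EuclideanSpace ℝ (Fin n))} (hE : IsClosed E)
    (hE' : interior E = ∅) (hψ : ∀ z ∈ A, ContDiffAt ℝ 1 ψ z)
    (hinj : ∀ z ∈ A, Function.Injective (fderiv ℝ ψ z)) : IsMeagre (ψ '' (E ∩ A)) := by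
  have key : ∀ z ∈ E ∩ A, ∃ U ∈ 𝓝[E ∩ A] z, IsMeagre (ψ '' (E ∩ U)) := by
    intro z hz
    let L : (EuclideanSpace ℝ (Fin n)) ≃L[ℝ] (EuclideanSpace ℝ (Fin n)) :=
        (LinearEquiv.ofInjectiveEndo ((fderiv ℝ ψ z : (EuclideanSpace ℝ (Fin n)) →L[ℝ]
        EuclideanSpace ℝ (Fin n)) : (EuclideanSpace ℝ (Fin n)) →ₗ[ℝ] EuclideanSpace ℝ (Fin n))
      (hinj z hz.2)).toContinuousLinearEquiv
    have hL : HasStrictFDerivAt ψ (L : (EuclideanSpace ℝ (Fin n)) →L[ℝ] EuclideanSpace ℝ (Fin n))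
        z := by
      have := (hψ z hz.2).hasStrictFDerivAt one_ne_zero
      have hLe : (L : (EuclideanSpace ℝ (Fin n)) →L[ℝ] EuclideanSpace ℝ (Fin n)) = fderiv ℝ ψ z :=
          by ext v; rfl
      rw [hLe]
      exact this
    set h := hL.toOpenPartialHomeomorph ψ
    obtain ⟨r, hr, hrs⟩ := Metric.nhds_basis_closedBall.mem_iff.1
      (h.open_source.mem_nhds hL.mem_toOpenPartialHomeomorph_source)
    refine ⟨Metric.closedBall z r, mem_nhdsWithin_of_mem_nhds (Metric.closedBall_mem_nhds z hr), ?_⟩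
    refine IsNowhereDense.isMeagre ?_
    have hc : IsCompact (ψ '' (E ∩ Metric.closedBall z r)) := by
      refine ((isCompact_closedBall z r).inter_left hE).image_of_continuousOn ?_
      exact h.continuousOn.mono (inter_subset_right.trans hrs)
    rw [hc.isClosed.isNowhereDense_iff]
    by_contra hne
    obtain ⟨w, hw⟩ := nonempty_iff_ne_empty.2 hne
    obtain ⟨z', hz', rfl⟩ := interior_subset hw
    -- On the small ball `ψ` is injective, so an open set inside the image of `E` pulls back to an
    -- open subset of `E`.
    have ho : IsOpen (h.source ∩ ψ ⁻¹' interior (ψ '' (E ∩ Metric.closedBall z r))) :=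
      h.isOpen_inter_preimage isOpen_interior
    have hsub : h.source ∩ ψ ⁻¹' interior (ψ '' (E ∩ Metric.closedBall z r)) ⊆ E := by
      rintro x ⟨hx, hx'⟩
      obtain ⟨x', hx'', hxx⟩ := interior_subset hx'
      rw [← h.injOn (hrs hx''.2) hx hxx]
      exact hx''.1
    have : z' ∈ interior E := interior_maximal hsub ho ⟨hrs hz'.2, hw⟩
    rw [hE'] at this
    exact this
  choose! U hU hUm using key
  obtain ⟨t, htA, htc, ht⟩ := TopologicalSpace.countable_cover_nhdsWithin hU
  have hsub : ψ '' (E ∩ A) ⊆ ⋃ z ∈ t, ψ '' (E ∩ U z) := by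
    rintro _ ⟨z, hz, rfl⟩
    obtain ⟨z', hz', h'⟩ := mem_iUnion₂.1 (ht hz)
    exact mem_iUnion₂.2 ⟨z', hz', z, ⟨hz.1, h'⟩, rfl⟩
  exact (isMeagre_biUnion htc fun z hz => hUm z (htA hz)).mono hsub

open MeasureTheory in
/-- For suitable small `a` and `v`, all fixed points of `F + a • (F - q) + v` are hyperbolic and
avoid a closed set with empty interior. -/
lemma exists_generic_perturbation {F : (EuclideanSpace ℝ (Fin n)) → EuclideanSpace ℝ (Fin n)}
    {A E : Set (EuclideanSpace ℝ (Fin n))} (hA : IsCompact A)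
    (hF : ∀ z ∈ A, ContDiffAt ℝ 1 F z) (hE : IsClosed E) (hE' : interior E = ∅)
        (q : EuclideanSpace ℝ (Fin n)) {ε : ℝ}
    (hε : 0 < ε) : ∃ (a : ℝ) (v : EuclideanSpace ℝ (Fin n)), |a| < ε ∧ ‖v‖ < ε ∧
      ∀ z ∈ A, z = F z + a • (F z - q) + v →
        IsHyperbolicLinear ((1 + a) • fderiv ℝ F z) ∧ z ∉ E := by
  have hdF : ContinuousOn (fderiv ℝ F) A := fun z hz =>
    ((hF z hz).continuousAt_fderiv one_ne_zero).continuousWithinAt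
  -- Triples of a parameter, a point and an eigenvalue on the unit circle form a compact set. Its
  -- projection `S`, the bad pairs `(a, z)`, is compact and hence measurable, as Fubini requires.
  let T : Set ((ℝ × EuclideanSpace ℝ (Fin n)) × ℂ) :=
      ((Icc (0 : ℝ) 1 ×ˢ A) ×ˢ Metric.sphere (0 : ℂ) 1) ∩
    {x | Polynomial.aeval x.2
      (LinearMap.charpoly (((1 + x.1.1) • fderiv ℝ F x.1.2 : (EuclideanSpace ℝ (Fin n)) →L[ℝ]
          EuclideanSpace ℝ (Fin n)) : (EuclideanSpace ℝ (Fin n)) →ₗ[ℝ] EuclideanSpace ℝ (Fin n)))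
          = 0}
  have hT : IsCompact T := by
    have hK : IsCompact ((Icc (0 : ℝ) 1 ×ˢ A) ×ˢ Metric.sphere (0 : ℂ) 1) :=
      (isCompact_Icc.prod hA).prod (isCompact_sphere _ _)
    refine hK.of_isClosed_subset ?_ inter_subset_left
    refine ContinuousOn.preimage_isClosed_of_isClosed ?_ hK.isClosed isClosed_singleton
    have h1 : ContinuousOn (fun x : (ℝ × EuclideanSpace ℝ (Fin n)) × ℂ =>
        ((1 + x.1.1) • fderiv ℝ F x.1.2, x.2))
        ((Icc (0 : ℝ) 1 ×ˢ A) ×ˢ Metric.sphere (0 : ℂ) 1) := by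
      have h0 : Continuous fun x : (ℝ × EuclideanSpace ℝ (Fin n)) × ℂ => 1 + x.1.1 := by fun_prop
      exact (h0.continuousOn.smul (hdF.comp (f := fun x : (ℝ × EuclideanSpace ℝ (Fin n)) × ℂ =>
          x.1.2)
        (by fun_prop) fun x hx => hx.1.2)).prodMk continuous_snd.continuousOn
    exact continuous_aeval_charpoly.comp_continuousOn h1
  let S : Set (ℝ × EuclideanSpace ℝ (Fin n)) := Prod.fst '' T
  have hS : IsCompact S := hT.image continuous_fst
  have hSmem : ∀ a z, (a, z) ∈ S ↔ a ∈ Icc (0 : ℝ) 1 ∧ z ∈ A ∧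
      ¬ IsHyperbolicLinear ((1 + a) • fderiv ℝ F z) := by
    intro a z
    simp only [S, T, mem_image, IsHyperbolicLinear, not_forall, not_not]
    constructor
    · rintro ⟨⟨⟨a', z'⟩, ζ⟩, ⟨⟨⟨ha, hz⟩, hζ⟩, h0⟩, h⟩
      obtain ⟨rfl, rfl⟩ := Prod.mk.inj h
      exact ⟨ha, hz, ζ, h0, by simpa using hζ⟩
    · rintro ⟨ha, hz, ζ, h0, hζ⟩
      exact ⟨((a, z), ζ), ⟨⟨⟨ha, hz⟩, by simpa using hζ⟩, h0⟩, rfl⟩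
  -- Every slice of `S` with `z` fixed is finite; exchanging the order, almost every slice with `a`
  -- fixed is null.
  have hae : ∀ᵐ a : ℝ, ∀ᵐ z : EuclideanSpace ℝ (Fin n), (a, z) ∉ S := by
    rw [Measure.ae_ae_comm (p := fun a z => (a, z) ∉ S)]
    · refine Eventually.of_forall fun z => ?_
      have : {a : ℝ | (a, z) ∈ S}.Finite :=
        (finite_setOf_not_hyperbolic (fderiv ℝ F z)).subset fun a ha =>
          ⟨((hSmem a z).1 ha).1, ((hSmem a z).1 ha).2.2⟩
      exact (this.measure_zero volume : _) |> fun h => by simpa [ae_iff] using h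
    · exact hS.measurableSet.compl
  obtain ⟨a, ha, haS⟩ := (Measure.dense_of_ae hae).inter_open_nonempty (Ioo 0 (min ε 1)) isOpen_Ioo
    (nonempty_Ioo.2 (lt_min hε one_pos))
  have ha01 : a ∈ Icc (0 : ℝ) 1 := ⟨ha.1.le, ha.2.le.trans (min_le_right _ _)⟩
  let N : Set (EuclideanSpace ℝ (Fin n)) := {z | (a, z) ∈ S}
  have hN : IsCompact N := by
    have : N = Prod.snd '' (S ∩ ({a} ×ˢ univ)) := by
      ext z; constructor
      · intro hz; exact ⟨(a, z), ⟨hz, rfl, trivial⟩, rfl⟩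
      · rintro ⟨⟨a', z'⟩, ⟨h1, h2, -⟩, rfl⟩
        obtain rfl : a' = a := h2
        exact h1
    rw [this]
    exact (hS.inter_right (isClosed_singleton.prod isClosed_univ)).image continuous_snd
  have hN0 : volume N = 0 := by
    have := ae_iff.1 haS
    simpa [N] using this
  have hNA : N ⊆ A := fun z hz => ((hSmem a z).1 hz).2.1
  -- Fixed points of the map perturbed by `a` and `v` are exactly the solutions of `ψ z = v`, and
  -- `Dψ = 1 - (1 + a) DF`.
  let ψ : (EuclideanSpace ℝ (Fin n)) → EuclideanSpace ℝ (Fin n) := fun z => z - F z - a • (F z - q)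
  have hψ : ∀ z ∈ A, ContDiffAt ℝ 1 ψ z := fun z hz =>
    (contDiffAt_id.sub (hF z hz)).sub (((hF z hz).sub contDiffAt_const).const_smul a)
  have hψ' : ∀ z ∈ A, ∀ w, fderiv ℝ ψ z w = w - ((1 + a) • fderiv ℝ F z) w := by
    intro z hz w
    have hd := ((hF z hz).differentiableAt one_ne_zero).hasFDerivAt
    have := ((hasFDerivAt_id z).sub hd).sub ((hd.sub_const q).const_smul a)
    rw [show fderiv ℝ ψ z = _ from this.fderiv]
    simp [add_smul, sub_sub]
  -- A differentiable map between spaces of equal dimension preserves null sets, and a compact null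
  -- set is nowhere dense. In terms of category this image can be united with the meagre image of
  -- `E`, which need not be null.
  have hm1 : IsMeagre (ψ '' N) := by
    refine IsNowhereDense.isMeagre ?_
    have hc : IsCompact (ψ '' N) := hN.image_of_continuousOn fun z hz =>
      (hψ z (hNA hz)).continuousAt.continuousWithinAt
    rw [hc.isClosed.isNowhereDense_iff]
    refine Measure.interior_eq_empty_of_null (μ := (volume : Measure (EuclideanSpace ℝ (Fin n)))) ?_
    exact addHaar_image_eq_zero_of_differentiableOn_of_addHaar_eq_zero volume (fun z hz =>
      ((hψ z (hNA hz)).differentiableAt one_ne_zero).differentiableWithinAt) hN0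
  have hm2 : IsMeagre (ψ '' (E ∩ (A \ N))) := by
    refine isMeagre_image_of_isInvertible_fderiv hE hE' (fun z hz => hψ z hz.1) fun z hz => ?_
    have hhyp : IsHyperbolicLinear ((1 + a) • fderiv ℝ F z) := by
      by_contra h
      exact hz.2 ((hSmem a z).2 ⟨ha01, hz.1, h⟩)
    have := hhyp.injective_one_sub
    intro w w' h
    rw [hψ' z hz.1, hψ' z hz.1] at h
    exact this h
  have hd : Dense (ψ '' N ∪ ψ '' (E ∩ (A \ N)))ᶜ := dense_of_mem_residual (hm1.union hm2)
  obtain ⟨v, hv, hvS⟩ := hd.inter_open_nonempty (Metric.ball 0 ε) Metric.isOpen_ball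
    ⟨0, Metric.mem_ball_self hε⟩
  refine ⟨a, v, ?_, by simpa using hv, fun z hz hzv => ?_⟩
  · rw [abs_of_pos ha.1]
    exact ha.2.trans_le (min_le_left _ _)
  · have hψz : ψ z = v := by
      simp only [ψ]
      nth_rewrite 1 [hzv]
      abel
    have hzN : z ∉ N := fun h => hvS (Or.inl ⟨z, h, hψz⟩)
    refine ⟨?_, fun hzE => hvS (Or.inr ⟨z, ⟨hzE, hz, hzN⟩, hψz⟩)⟩
    by_contra h
    exact hzN ((hSmem a z).2 ⟨ha01, hz, h⟩)

end Generic

/-! ### Affine perturbations of the identity with compact support -/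

section Bump

variable {n : ℕ}

/-- A bump function around `q` that equals `1` on the ball of radius `2 r` and is supported in the
ball of radius `3 r`. -/
def bump (q : EuclideanSpace ℝ (Fin n)) {r : ℝ} (hr : 0 < r) : ContDiffBump q :=
    ⟨2 * r, 3 * r, by linarith, by linarith⟩

/-- The map `z ↦ z + a • (z - q) + v`, cut off outside of the ball of radius `3 r` around `q`. -/
def cutoffAffine (q : EuclideanSpace ℝ (Fin n)) {r : ℝ} (hr : 0 < r)
    (s : ℝ × EuclideanSpace ℝ (Fin n)) (z : EuclideanSpace ℝ (Fin n)) : (EuclideanSpace ℝ (Fin n))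
    :=
  z + bump q hr z • (s.1 • (z - q) + s.2)

variable {q : (EuclideanSpace ℝ (Fin n))} {r : ℝ} (hr : 0 < r)

lemma cutoffAffine_of_le {s : ℝ × EuclideanSpace ℝ (Fin n)} {z : (EuclideanSpace ℝ (Fin n))}
    (hz : 3 * r ≤ dist z q) :
    cutoffAffine q hr s z = z := by
  rw [cutoffAffine, (bump q hr).zero_of_le_dist hz, zero_smul, add_zero]

lemma cutoffAffine_of_mem {s : ℝ × EuclideanSpace ℝ (Fin n)} {z : (EuclideanSpace ℝ (Fin n))}
    (hz : z ∈ Metric.closedBall q (2 * r)) :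
    cutoffAffine q hr s z = z + s.1 • (z - q) + s.2 := by
  rw [cutoffAffine, (bump q hr).one_of_mem_closedBall hz, one_smul, add_assoc]

lemma contDiff_cutoffAffine :
    ContDiff ℝ ∞ fun x : (ℝ × EuclideanSpace ℝ (Fin n)) × EuclideanSpace ℝ (Fin n) => cutoffAffine
        q hr x.1 x.2 := by
  unfold cutoffAffine
  refine contDiff_snd.add (ContDiff.smul ((bump q hr).contDiff.comp contDiff_snd) ?_)
  exact (contDiff_fst.fst.smul (contDiff_snd.sub contDiff_const)).add contDiff_fst.snd

lemma contDiff_cutoffAffine_apply (s : ℝ × EuclideanSpace ℝ (Fin n)) : ContDiff ℝ ∞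
    (cutoffAffine q hr s) :=
  (contDiff_cutoffAffine hr).comp (contDiff_const.prodMk contDiff_id)

lemma cutoffAffine_zero : cutoffAffine q hr 0 = id := by
  ext1 z
  simp [cutoffAffine]

lemma jointC1At_cutoffAffine (x : (ℝ × EuclideanSpace ℝ (Fin n)) × EuclideanSpace ℝ (Fin n)) :
    JointC1At (cutoffAffine q hr) x := by
  refine ⟨Eventually.of_forall fun y =>
    (contDiff_cutoffAffine_apply hr y.1).differentiable (by simp) y.2,
    (contDiff_cutoffAffine hr).continuous.continuousAt, ?_⟩
  have h1 : ContDiff ℝ 0 (fun y : (ℝ × EuclideanSpace ℝ (Fin n)) × EuclideanSpace ℝ (Fin n) =>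
      fderiv ℝ (cutoffAffine q hr y.1) y.2) := by
    refine ContDiff.fderiv (n := 0) (m := ∞) (f := fun
        (y : (ℝ × EuclideanSpace ℝ (Fin n)) × EuclideanSpace ℝ (Fin n))
        (z : EuclideanSpace ℝ (Fin n)) => cutoffAffine q hr y.1 z)
      (g := fun y : (ℝ × EuclideanSpace ℝ (Fin n)) × EuclideanSpace ℝ (Fin n) => y.2) ?_
          contDiff_snd (by norm_cast)
    exact (contDiff_cutoffAffine hr).comp (contDiff_fst.fst.prodMk contDiff_snd)
  exact h1.continuous.continuousAt

/-- Uniformity comes from compactness on the closed ball of radius `3 r`, since the map is the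
identity outside it. Any bound below `1` would do for inverting the map. -/
lemma eventually_norm_fderiv_cutoffAffine_sub_le : ∀ᶠ s : ℝ × EuclideanSpace ℝ (Fin n) in 𝓝 0, ∀ z
    : EuclideanSpace ℝ (Fin n),
    ‖fderiv ℝ (cutoffAffine q hr s) z - ContinuousLinearMap.id ℝ (EuclideanSpace ℝ (Fin n))‖ ≤ 1 /
        2 := by
  have h1 : ∀ᶠ s : ℝ × EuclideanSpace ℝ (Fin n) in 𝓝 0, ∀ z ∈ Metric.closedBall q (3 * r),
      ‖fderiv ℝ (cutoffAffine q hr s) z - ContinuousLinearMap.id ℝ (EuclideanSpace ℝ (Fin n))‖ ≤ 1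
          / 2 := by
    refine (isCompact_closedBall q (3 * r)).eventually_forall_of_forall_eventually fun z _ => ?_
    have h2 := (jointC1At_cutoffAffine (q := q) hr ((0 : ℝ × EuclideanSpace ℝ (Fin n)), z)).2.2
    have h3 : fderiv ℝ (cutoffAffine q hr (0 : ℝ × EuclideanSpace ℝ (Fin n))) z =
        ContinuousLinearMap.id ℝ (EuclideanSpace ℝ (Fin n)) := by
      rw [cutoffAffine_zero]; exact fderiv_id
    have h4 : Tendsto (fun x : (ℝ × EuclideanSpace ℝ (Fin n)) × EuclideanSpace ℝ (Fin n) =>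
        ‖fderiv ℝ (cutoffAffine q hr x.1) x.2 -
        ContinuousLinearMap.id ℝ (EuclideanSpace ℝ (Fin n))‖)
            (𝓝 ((0 : ℝ × EuclideanSpace ℝ (Fin n)), z)) (𝓝 0) := by
      have := (h2.tendsto.sub_const (ContinuousLinearMap.id ℝ (EuclideanSpace ℝ (Fin n)))).norm
      simp only [h3, sub_self, norm_zero] at this
      exact this
    exact (h4.eventually (gt_mem_nhds (by norm_num : (0 : ℝ) < 1 / 2))).mono fun x hx => hx.le
  filter_upwards [h1] with s hs z
  by_cases hz : z ∈ Metric.closedBall q (3 * r)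
  · exact hs z hz
  · have : cutoffAffine q hr s =ᶠ[𝓝 z] id := by
      filter_upwards [Metric.isClosed_closedBall.isOpen_compl.mem_nhds hz] with w hw
      refine cutoffAffine_of_le hr ?_
      simp only [mem_compl_iff, Metric.mem_closedBall, not_le] at hw
      exact hw.le
    rw [this.fderiv_eq, fderiv_id, sub_self, norm_zero]
    norm_num

lemma eventually_dist_cutoffAffine_lt : ∀ᶠ s : ℝ × EuclideanSpace ℝ (Fin n) in 𝓝 0, ∀ z :
    EuclideanSpace ℝ (Fin n),
    dist (cutoffAffine q hr s z) z < r := by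
  have h1 : ∀ᶠ s : ℝ × EuclideanSpace ℝ (Fin n) in 𝓝 0, ∀ z ∈ Metric.closedBall q (3 * r),
      dist (cutoffAffine q hr s z) z < r := by
    refine (isCompact_closedBall q (3 * r)).eventually_forall_of_forall_eventually fun z _ => ?_
    have h2 : Continuous fun x : (ℝ × EuclideanSpace ℝ (Fin n)) × EuclideanSpace ℝ (Fin n) => dist
        (cutoffAffine q hr x.1 x.2) x.2 :=
      (contDiff_cutoffAffine hr).continuous.dist continuous_snd
    have h3 := h2.tendsto ((0 : ℝ × EuclideanSpace ℝ (Fin n)), z)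
    simp only [cutoffAffine_zero, id, dist_self] at h3
    exact h3.eventually (gt_mem_nhds hr)
  filter_upwards [h1] with s hs z
  by_cases hz : z ∈ Metric.closedBall q (3 * r)
  · exact hs z hz
  · simp only [Metric.mem_closedBall, not_le] at hz
    rw [cutoffAffine_of_le hr hz.le, dist_self]
    exact hr

/-- Small cut-off affine maps are diffeomorphisms. -/
lemma eventually_exists_inverse_cutoffAffine : ∀ᶠ s : ℝ × EuclideanSpace ℝ (Fin n) in 𝓝 0, ∃ g :
    (EuclideanSpace ℝ (Fin n)) → EuclideanSpace ℝ (Fin n),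
    ContDiff ℝ ∞ g ∧ Function.LeftInverse g (cutoffAffine q hr s) ∧
      Function.RightInverse g (cutoffAffine q hr s) := by
  filter_upwards [eventually_norm_fderiv_cutoffAffine_sub_le hr] with s hs
  have hdiff : Differentiable ℝ (cutoffAffine q hr s) :=
    (contDiff_cutoffAffine_apply hr s).differentiable (by simp)
  have happrox : ApproximatesLinearOn (cutoffAffine q hr s)
      ((ContinuousLinearEquiv.refl ℝ (EuclideanSpace ℝ (Fin n)) : (EuclideanSpace ℝ (Fin n)) ≃L[ℝ]
          (EuclideanSpace ℝ (Fin n))) : (EuclideanSpace ℝ (Fin n)) →L[ℝ] EuclideanSpace ℝ (Fin n))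
          -- The map is the identity plus a `1 / 2`-Lipschitz map, so it is a global homeomorphism;
          -- invertibility of its derivatives makes the inverse smooth.
          univ (1 / 2) := by
    have hlip : LipschitzWith (1 / 2) fun z => cutoffAffine q hr s z - z := by
      refine lipschitzWith_of_nnnorm_fderiv_le (hdiff.sub differentiable_id) fun z => ?_
      have : fderiv ℝ (fun z => cutoffAffine q hr s z - z) z
          = fderiv ℝ (cutoffAffine q hr s) z - ContinuousLinearMap.id ℝ (EuclideanSpace ℝ (Fin n))
              := by
        have := (hdiff z).hasFDerivAt.sub (hasFDerivAt_id z)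
        exact this.fderiv
      rw [this, ← NNReal.coe_le_coe]
      simpa using hs z
    intro x _ y _
    have := hlip.norm_sub_le x y
    simpa [sub_sub_sub_comm] using this
  -- The dimension may be zero here, in which case the identity has norm `0` and the quantitative
  -- condition has to be bypassed.
  have hcond : Subsingleton (EuclideanSpace ℝ (Fin n)) ∨
      (1 / 2 : ℝ≥0) < ‖((ContinuousLinearEquiv.refl ℝ (EuclideanSpace ℝ (Fin n))).symm :
          (EuclideanSpace ℝ (Fin n)) →L[ℝ] EuclideanSpace ℝ (Fin n))‖₊⁻¹ := by
    rcases subsingleton_or_nontrivial (EuclideanSpace ℝ (Fin n)) with h | h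
    · exact Or.inl h
    · right
      have : ‖((ContinuousLinearEquiv.refl ℝ (EuclideanSpace ℝ (Fin n))).symm :
          (EuclideanSpace ℝ (Fin n)) →L[ℝ] EuclideanSpace ℝ (Fin n))‖₊ = 1 := by
        have := ContinuousLinearMap.nnnorm_id (𝕜 := ℝ) (E := (EuclideanSpace ℝ (Fin n)))
        exact this
      rw [this, inv_one, ← NNReal.coe_lt_coe]
      norm_num
  let h : (EuclideanSpace ℝ (Fin n)) ≃ₜ (EuclideanSpace ℝ (Fin n)) := happrox.toHomeomorph _ hcond
  have hh : ∀ z, h z = cutoffAffine q hr s z := fun z => rfl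
  refine ⟨h.symm, ?_, h.left_inv, h.right_inv⟩
  have hinv : ∀ z, ∃ L : (EuclideanSpace ℝ (Fin n)) ≃L[ℝ] (EuclideanSpace ℝ (Fin n)),
      (L : (EuclideanSpace ℝ (Fin n)) →L[ℝ] EuclideanSpace ℝ (Fin n)) = fderiv ℝ
      (cutoffAffine q hr s) z := by
    intro z
    have hlt : ‖ContinuousLinearMap.id ℝ (EuclideanSpace ℝ (Fin n)) - fderiv ℝ
        (cutoffAffine q hr s) z‖ < 1 := by
      rw [norm_sub_rev]; exact (hs z).trans_lt (by norm_num)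
    have hu : IsUnit (fderiv ℝ (cutoffAffine q hr s) z) := by
      have := isUnit_one_sub_of_norm_lt_one
        (x := (1 : (EuclideanSpace ℝ (Fin n)) →L[ℝ] EuclideanSpace ℝ (Fin n)) - fderiv ℝ
            (cutoffAffine q hr s) z) hlt
      simpa using this
    exact ⟨ContinuousLinearEquiv.unitsEquiv ℝ (EuclideanSpace ℝ (Fin n)) hu.unit, by ext; rfl⟩
  choose L hL using hinv
  refine h.contDiff_symm (f₀' := L) (fun z => ?_) (contDiff_cutoffAffine_apply hr s)
  rw [hL]
  exact (hdiff z).hasFDerivAt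

end Bump

/-! ### Maps supported in a chart -/

section Lift

variable {n : ℕ} [NeZero n] {D' : Type*} [TopologicalSpace D'] [T2Space D']
  [ChartedSpace (EuclideanHalfSpace n) D'] [IsManifold (𝓡∂ n) ∞ D']

/-- The part of the chart at `c` that corresponds to the set `T`. -/
def chartSet (c : D') (T : Set (EuclideanSpace ℝ (Fin n))) : Set D' :=
  (extChartAt (𝓡∂ n) c).source ∩ extChartAt (𝓡∂ n) c ⁻¹' T

lemma isOpen_chartSet (c : D') {T : Set (EuclideanSpace ℝ (Fin n))} (hT : IsOpen T) : IsOpen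
    (chartSet c T) :=
  (continuousOn_extChartAt c).isOpen_inter_preimage (isOpen_extChartAt_source c) hT

lemma chartSet_eq_image (c : D') {T : Set (EuclideanSpace ℝ (Fin n))}
    (hT : T ⊆ (extChartAt (𝓡∂ n) c).target) :
    chartSet c T = (extChartAt (𝓡∂ n) c).symm '' T := by
  rw [PartialEquiv.symm_image_eq_source_inter_preimage _ hT, chartSet]

lemma isCompact_chartSet (c : D') {T : Set (EuclideanSpace ℝ (Fin n))} (hT : IsCompact T)
    (hTt : T ⊆ (extChartAt (𝓡∂ n) c).target) : IsCompact (chartSet c T) := by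
  rw [chartSet_eq_image c hTt]
  exact hT.image_of_continuousOn ((continuousOn_extChartAt_symm c).mono hTt)

lemma isInteriorPoint_of_mem_chartSet {c : D'} {T : Set (EuclideanSpace ℝ (Fin n))} (hT : IsOpen T)
    (hTt : T ⊆ (extChartAt (𝓡∂ n) c).target) {x : D'} (hx : x ∈ chartSet c T) :
    (𝓡∂ n).IsInteriorPoint x := by
  have hx1 : x ∈ (chartAt (EuclideanHalfSpace n) c).source := by simpa using hx.1
  rw [(𝓡∂ n).isInteriorPoint_iff_of_mem_atlas (n := (∞ : ℕ∞ω)) (by simp) (chart_mem_atlas _ c) hx1]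
  exact interior_maximal hTt hT hx.2

open Classical in
/-- The map of a manifold that is `f` in the part of the chart at `c` that corresponds to `T`, and
the identity elsewhere. -/
def chartLift (c : D') (T : Set (EuclideanSpace ℝ (Fin n)))
    (f : (EuclideanSpace ℝ (Fin n)) → EuclideanSpace ℝ (Fin n)) (x : D') : D' :=
  if x ∈ chartSet c T then (extChartAt (𝓡∂ n) c).symm (f (extChartAt (𝓡∂ n) c x)) else x

variable {c : D'} {T K : Set (EuclideanSpace ℝ (Fin n))}
    {f g : (EuclideanSpace ℝ (Fin n)) → EuclideanSpace ℝ (Fin n)}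

lemma chartLift_of_mem {x : D'} (hx : x ∈ chartSet c T) :
    chartLift c T f x = (extChartAt (𝓡∂ n) c).symm (f (extChartAt (𝓡∂ n) c x)) := if_pos hx

lemma chartLift_of_notMem (hf : ∀ z ∉ K, f z = z) {x : D'}
    (hx : x ∉ chartSet c K) : chartLift c T f x = x := by
  unfold chartLift
  split_ifs with h
  · rw [hf _ fun h' => hx ⟨h.1, h'⟩]
    exact (extChartAt (𝓡∂ n) c).left_inv h.1
  · rfl

lemma chartLift_mem (hTt : T ⊆ (extChartAt (𝓡∂ n) c).target) (hfT : MapsTo f T T) {x : D'}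
    (hx : x ∈ chartSet c T) : chartLift c T f x ∈ chartSet c T ∧
      extChartAt (𝓡∂ n) c (chartLift c T f x) = f (extChartAt (𝓡∂ n) c x) := by
  have h1 := hfT hx.2
  have h2 := (extChartAt (𝓡∂ n) c).map_target (hTt h1)
  have h3 := (extChartAt (𝓡∂ n) c).right_inv (hTt h1)
  rw [chartLift_of_mem hx]
  refine ⟨⟨h2, ?_⟩, h3⟩
  rw [mem_preimage, h3]
  exact h1

lemma chartLift_leftInverse (hTt : T ⊆ (extChartAt (𝓡∂ n) c).target) (hfT : MapsTo f T T)
    (h : Function.LeftInverse g f) :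
    Function.LeftInverse (chartLift c T g) (chartLift c T f) := by
  intro x
  by_cases hx : x ∈ chartSet c T
  · obtain ⟨h1, h2⟩ := chartLift_mem hTt hfT hx
    rw [chartLift_of_mem h1, h2, h]
    exact (extChartAt (𝓡∂ n) c).left_inv hx.1
  · rw [chartLift, chartLift, if_neg hx, if_neg hx]

/-- The part of the chart over `K` is compact, hence closed in the Hausdorff manifold. The chart
formula near `T` and the identity off `K` therefore live on two open sets that cover the manifold.
-/
lemma contMDiff_chartLift (hT : IsOpen T) (hTt : T ⊆ (extChartAt (𝓡∂ n) c).target)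
    (hK : IsCompact K) (hKT : K ⊆ T) (hf : ContDiff ℝ ∞ f) (hfK : ∀ z ∉ K, f z = z)
    (hfT : MapsTo f T T) : ContMDiff (𝓡∂ n) (𝓡∂ n) ∞ (chartLift c T f) := by
  intro x
  by_cases hx : x ∈ chartSet c T
  · have h1 : chartLift c T f =ᶠ[𝓝 x]
        fun x => (extChartAt (𝓡∂ n) c).symm (f (extChartAt (𝓡∂ n) c x)) := by
      filter_upwards [(isOpen_chartSet c hT).mem_nhds hx] with y hy using chartLift_of_mem hy
    refine ContMDiffAt.congr_of_eventuallyEq ?_ h1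
    have h2 : ContMDiffAt (𝓡∂ n) 𝓘(ℝ, (EuclideanSpace ℝ (Fin n))) ∞ (extChartAt (𝓡∂ n) c) x :=
      contMDiffAt_extChartAt' (by simpa using hx.1)
    have h3 : ContMDiffAt 𝓘(ℝ, (EuclideanSpace ℝ (Fin n))) (𝓡∂ n) ∞ (extChartAt (𝓡∂ n) c).symm
        (f (extChartAt (𝓡∂ n) c x)) :=
      (contMDiffOn_extChartAt_symm c).contMDiffAt
        (mem_of_superset (hT.mem_nhds (hfT hx.2)) hTt)
    exact h3.comp x ((hf.contMDiff _).comp x h2)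
  · have h1 : chartLift c T f =ᶠ[𝓝 x] id := by
      have hc := (isCompact_chartSet c hK (hKT.trans hTt)).isClosed.isOpen_compl
      have hx' : x ∈ (chartSet c K)ᶜ := fun h => hx ⟨h.1, hKT h.2⟩
      filter_upwards [hc.mem_nhds hx'] with y hy using chartLift_of_notMem hfK hy
    exact contMDiffAt_id.congr_of_eventuallyEq h1

end Lift

/-! ### Perturbations of an impulse -/

section Perturbation

variable {n m : ℕ} [NeZero n] {M : Type*} [TopologicalSpace M] [T2Space M]
  [ChartedSpace (EuclideanSpace ℝ (Fin (n + 1))) M] [IsManifold (𝓡 (n + 1)) ∞ M]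
  {D D' : Type*} [TopologicalSpace D] [ChartedSpace (EuclideanHalfSpace n) D]
  [IsManifold (𝓡∂ n) ∞ D] [TopologicalSpace D'] [ChartedSpace (EuclideanHalfSpace n) D']
  [IsManifold (𝓡∂ n) ∞ D'] [T2Space D']
  {ι : D → M} {ι' : D' → M} {e : M → EuclideanSpace ℝ (Fin m)}
  (he : IsSmoothEmbedding (𝓡 (n + 1)) (𝓡 m) ∞ e)
  (hι : IsSmoothEmbedding (𝓡∂ n) (𝓡 (n + 1)) ∞ ι)
  (hι' : IsSmoothEmbedding (𝓡∂ n) (𝓡 (n + 1)) ∞ ι')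

/-- The derivative of a map to a normed space, as a map on the model vector space. -/
def modelDeriv {W : Type*} [NormedAddCommGroup W] [NormedSpace ℝ W] (f : D → W) (y : D) :
    EuclideanSpace ℝ (Fin n) →L[ℝ] W := mfderiv (𝓡∂ n) 𝓘(ℝ, W) f y

include he hι in
-- Near `y₀` one has `f = (f ∘ B) ∘ (e ∘ ι)` with `B` a local retraction, so a bound for the
-- derivative of `f ∘ B` is the constant. This expresses chart derivatives in the ambient lengths
-- that enter the `C¹` distance.
lemma eventually_norm_mfderiv_le {W : Type*} [NormedAddCommGroup W] [NormedSpace ℝ W] {f : D → W}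
    {y₀ : D} (hy₀ : (𝓡∂ n).IsInteriorPoint y₀) (hf : ContMDiffAt (𝓡∂ n) 𝓘(ℝ, W) 1 f y₀) :
    ∃ C : ℝ, 0 ≤ C ∧ ∀ᶠ y in 𝓝 y₀, ∀ v : EuclideanSpace ℝ (Fin n),
      ‖modelDeriv f y v‖ ≤ C * ‖derivAt (e ∘ ι) y v‖ := by
  obtain ⟨B, hB, hBe⟩ := exists_retraction_section he hι hy₀
  have hιe : ContMDiff (𝓡∂ n) (𝓡 m) 1 (e ∘ ι) :=
    (he.contMDiff.of_le (by norm_cast)).comp (hι.contMDiff.of_le (by norm_cast))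
  have hB0 : B (e (ι y₀)) = y₀ := hBe.self_of_nhds
  have hfB : ContDiffAt ℝ 1 (fun ζ => f (B ζ)) (e (ι y₀)) := by
    rw [← contMDiffAt_iff_contDiffAt]
    exact ContMDiffAt.comp (g := f) (e (ι y₀)) (by rwa [hB0]) (hB.of_le (by norm_cast))
  refine ⟨‖fderiv ℝ (fun ζ => f (B ζ)) (e (ι y₀))‖ + 1, by positivity, ?_⟩
  have h1 := ((hfB.continuousAt_fderiv one_ne_zero).norm.eventually
    (gt_mem_nhds (lt_add_one _)))
  have h2 : ∀ᶠ ζ in 𝓝 (e (ι y₀)), DifferentiableAt ℝ (fun ζ => f (B ζ)) ζ := by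
    filter_upwards [hfB.eventually (by simp)] with ζ hζ using hζ.differentiableAt one_ne_zero
  have hc : ContinuousAt (fun y => e (ι y)) y₀ := hιe.continuous.continuousAt
  filter_upwards [hc.eventually h1, hc.eventually h2, hBe.eventually_nhds] with y hy1 hy2 hy3 v
  have h3 : f =ᶠ[𝓝 y] (fun ζ => f (B ζ)) ∘ (e ∘ ι) := by
    filter_upwards [hy3] with z hz
    simp only [Function.comp_apply]
    rw [hz]
  have h4 := mfderiv_comp y (I := 𝓡∂ n) (I' := 𝓡 m) (I'' := 𝓘(ℝ, W)) (g := fun ζ => f (B ζ))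
    (f := e ∘ ι) hy2.mdifferentiableAt ((hιe y).mdifferentiableAt one_ne_zero)
  rw [mfderiv_eq_fderiv] at h4
  rw [modelDeriv, h3.mfderiv_eq, h4]
  refine (ContinuousLinearMap.le_opNorm (fderiv ℝ (fun ζ => f (B ζ)) (e (ι y)))
    (derivAt (e ∘ ι) y v)).trans ?_
  exact mul_le_mul_of_nonneg_right hy1.le (norm_nonneg _)

include he hι in
lemma exists_norm_mfderiv_le {W : Type*} [NormedAddCommGroup W] [NormedSpace ℝ W] {f : D → W}
    {A : Set D} (hA : IsCompact A) (hAi : ∀ y ∈ A, (𝓡∂ n).IsInteriorPoint y)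
    (hf : ∀ y ∈ A, ContMDiffAt (𝓡∂ n) 𝓘(ℝ, W) 1 f y) :
    ∃ C : ℝ, 0 ≤ C ∧ ∀ y ∈ A, ∀ v : EuclideanSpace ℝ (Fin n),
      ‖modelDeriv f y v‖ ≤ C * ‖derivAt (e ∘ ι) y v‖ := by
  refine hA.induction_on (p := fun S => ∃ C : ℝ, 0 ≤ C ∧ ∀ y ∈ S, ∀ v : EuclideanSpace ℝ (Fin n),
      ‖modelDeriv f y v‖ ≤ C * ‖derivAt (e ∘ ι) y v‖) ⟨0, le_rfl, by simp⟩
    ?_ ?_ ?_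
  · rintro s t hst ⟨C, hC, h⟩
    exact ⟨C, hC, fun y hy => h y (hst hy)⟩
  · rintro s t ⟨C, hC, h⟩ ⟨C', hC', h'⟩
    refine ⟨max C C', le_max_of_le_left hC, ?_⟩
    rintro y (hy | hy) v
    · exact (h y hy v).trans (mul_le_mul_of_nonneg_right (le_max_left _ _) (norm_nonneg _))
    · exact (h' y hy v).trans (mul_le_mul_of_nonneg_right (le_max_right _ _) (norm_nonneg _))
  · intro y hy
    obtain ⟨C, hC, h⟩ := eventually_norm_mfderiv_le he hι (hAi y hy) (hf y hy)
    exact ⟨_, mem_nhdsWithin_of_mem_nhds h, C, hC, fun y hy => hy⟩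

lemma isInteriorPoint_apply_iff (I : Impulses n D D') (y : D) :
    (𝓡∂ n).IsInteriorPoint (I y) ↔ (𝓡∂ n).IsInteriorPoint y := by
  have h := I.preimage_interior (by simp)
  exact (Set.ext_iff.1 h y)

variable {c : D'} {q : EuclideanSpace ℝ (Fin n)} {r : ℝ}

lemma mem_chartSet_of_subset {T T' : Set (EuclideanSpace ℝ (Fin n))} (h : T ⊆ T') {x : D'}
    (hx : x ∈ chartSet c T) : x ∈ chartSet c T' := ⟨hx.1, h hx.2⟩

lemma contMDiffAt_chart_symm {T : Set (EuclideanSpace ℝ (Fin n))} (hT : IsOpen T)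
    (hTt : T ⊆ (extChartAt (𝓡∂ n) c).target) {z : EuclideanSpace ℝ (Fin n)} (hz : z ∈ T) :
    ContMDiffAt 𝓘(ℝ, EuclideanSpace ℝ (Fin n)) (𝓡∂ n) ∞ (extChartAt (𝓡∂ n) c).symm z :=
  (contMDiffOn_extChartAt_symm c).contMDiffAt (mem_of_superset (hT.mem_nhds hz) hTt)

include he hι' in
lemma contDiffAt_chart_symm {T : Set (EuclideanSpace ℝ (Fin n))} (hT : IsOpen T)
    (hTt : T ⊆ (extChartAt (𝓡∂ n) c).target) {z : EuclideanSpace ℝ (Fin n)} (hz : z ∈ T) :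
    ContDiffAt ℝ 1 (fun z => e (ι' ((extChartAt (𝓡∂ n) c).symm z))) z := by
  rw [← contMDiffAt_iff_contDiffAt]
  exact ((he.contMDiff.comp hι'.contMDiff) _ |>.comp z
    (contMDiffAt_chart_symm hT hTt hz)).of_le (by norm_cast)

include he hι' in
/-- Cut-off affine maps are `C¹`-close to the identity, measured in the ambient space. -/
lemma eventually_cutoffAffine_close (hr : 0 < r)
    (hTt : Metric.ball q (4 * r) ⊆ (extChartAt (𝓡∂ n) c).target) {δ : ℝ} (hδ : 0 < δ) :
    ∀ᶠ s : ℝ × EuclideanSpace ℝ (Fin n) in 𝓝 0, ∀ z ∈ Metric.closedBall q (3 * r),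
      dist (e (ι' ((extChartAt (𝓡∂ n) c).symm (cutoffAffine q hr s z))))
        (e (ι' ((extChartAt (𝓡∂ n) c).symm z))) < δ ∧
      DifferentiableAt ℝ
        (fun z => e (ι' ((extChartAt (𝓡∂ n) c).symm (cutoffAffine q hr s z)))) z ∧
      dist (fderiv ℝ (fun z => e (ι' ((extChartAt (𝓡∂ n) c).symm (cutoffAffine q hr s z)))) z)
        (fderiv ℝ (fun z => e (ι' ((extChartAt (𝓡∂ n) c).symm z))) z) < δ := by
  refine (isCompact_closedBall q (3 * r)).eventually_forall_of_forall_eventually fun z hz => ?_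
  have hz4 : z ∈ Metric.ball q (4 * r) :=
    Metric.closedBall_subset_ball (by linarith) hz
  set f := fun z => e (ι' ((extChartAt (𝓡∂ n) c).symm z)) with hf
  have hfz : ContDiffAt ℝ 1 f z := contDiffAt_chart_symm he hι' Metric.isOpen_ball hTt hz4
  have h0 : cutoffAffine q hr 0 z = z := by rw [cutoffAffine_zero]; rfl
  have h1 : JointC1At (fun (s : ℝ × EuclideanSpace ℝ (Fin n)) z => f (cutoffAffine q hr s z))
      (0, z) :=
    JointC1At.comp (g := fun _ => f) (JointC1At.of_contDiffAt (by simpa only [h0] using hfz) _)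
      (jointC1At_cutoffAffine hr _)
  have hsnd : ContinuousAt (fun x : (ℝ × EuclideanSpace ℝ (Fin n)) × EuclideanSpace ℝ (Fin n) =>
    x.2) (0, z) := continuousAt_snd
  have hfc : ContinuousAt (fun x : (ℝ × EuclideanSpace ℝ (Fin n)) × EuclideanSpace ℝ (Fin n) =>
    f x.2) (0, z) := ContinuousAt.comp (g := f) hfz.continuousAt hsnd
  have hfd : ContinuousAt (fun x : (ℝ × EuclideanSpace ℝ (Fin n)) × EuclideanSpace ℝ (Fin n) =>
    fderiv ℝ f x.2) (0, z) :=
    ContinuousAt.comp (g := fderiv ℝ f) (hfz.continuousAt_fderiv one_ne_zero) hsnd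
  have h2 := Filter.Tendsto.dist h1.2.1 hfc
  have h3 := Filter.Tendsto.dist h1.2.2 hfd
  simp only [h0, cutoffAffine_zero, id, dist_self] at h2 h3
  filter_upwards [h1.1, h2.eventually (gt_mem_nhds hδ), h3.eventually (gt_mem_nhds hδ)]
    with x a1 a2 a3 using ⟨a2, a1, a3⟩

/-- Only points within `3 r` of `q` move, and they move by less than `r`. -/
lemma mapsTo_cutoffAffine (hr : 0 < r) {s : ℝ × EuclideanSpace ℝ (Fin n)}
    (hs : ∀ z, dist (cutoffAffine q hr s z) z < r) :
    MapsTo (cutoffAffine q hr s) (Metric.ball q (4 * r)) (Metric.ball q (4 * r)) := by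
  intro z hz
  rw [Metric.mem_ball] at hz ⊢
  rcases le_or_gt (3 * r) (dist z q) with h | h
  · rwa [cutoffAffine_of_le hr h]
  · linarith [dist_triangle (cutoffAffine q hr s z) z q, hs z]

include he hι hι' in
/-- Small cut-off affine maps in a chart of the target give small perturbations of an impulse. -/
theorem eventually_exists_perturbation (I : ImpulseSpace n ι ι' e) (hr : 0 < r)
    (hTt : Metric.ball q (4 * r) ⊆ (extChartAt (𝓡∂ n) c).target) {ε : ℝ≥0∞} (hε : 0 < ε) :
    ∀ᶠ s : ℝ × EuclideanSpace ℝ (Fin n) in 𝓝 0, ∃ J : ImpulseSpace n ι ι' e, edist J I < ε ∧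
      (∀ y, I.diffeo y ∉ chartSet c (Metric.closedBall q (3 * r)) → J.diffeo y = I.diffeo y) ∧
      (∀ y, I.diffeo y ∈ chartSet c (Metric.ball q (4 * r)) →
        J.diffeo y ∈ chartSet c (Metric.ball q (4 * r)) ∧ extChartAt (𝓡∂ n) c (J.diffeo y) =
          cutoffAffine q hr s (extChartAt (𝓡∂ n) c (I.diffeo y))) ∧
      (∀ y, J.diffeo y ∈ chartSet c (Metric.closedBall q r) →
        I.diffeo y ∈ chartSet c (Metric.ball q (2 * r))) := by
  set T := Metric.ball q (4 * r) with hT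
  set K := Metric.closedBall q (3 * r) with hK
  have hKT : K ⊆ T := Metric.closedBall_subset_ball (by linarith)
  have hKc : IsCompact (chartSet c K) :=
    isCompact_chartSet c (isCompact_closedBall _ _) (hKT.trans hTt)
  have hTo : IsOpen (chartSet c T) := isOpen_chartSet c Metric.isOpen_ball
  set A := I.diffeo ⁻¹' chartSet c K with hA
  have hAc : IsCompact A := by
    have : A = I.diffeo.toHomeomorph ⁻¹' chartSet c K := rfl
    rw [this]
    exact I.diffeo.toHomeomorph.isCompact_preimage.2 hKc
  have hκI : ∀ y, I.diffeo y ∈ chartSet c T → ContMDiffAt (𝓡∂ n)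
      𝓘(ℝ, EuclideanSpace ℝ (Fin n)) 1 (fun y => extChartAt (𝓡∂ n) c (I.diffeo y)) y := by
    intro y hy
    have h2 : ContMDiffAt (𝓡∂ n) 𝓘(ℝ, EuclideanSpace ℝ (Fin n)) 1 (extChartAt (𝓡∂ n) c)
        (I.diffeo y) := contMDiffAt_extChartAt' (by simpa using hy.1)
    exact h2.comp y (I.diffeo.contMDiff y)
  obtain ⟨C, hC0, hC⟩ := exists_norm_mfderiv_le he hι hAc
    (fun y hy => (isInteriorPoint_apply_iff I.diffeo y).1 (isInteriorPoint_of_mem_chartSet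
      Metric.isOpen_ball hTt (mem_chartSet_of_subset hKT hy)))
    (fun y hy => hκI y (mem_chartSet_of_subset hKT hy))
  -- A supremum of small quantities is only bounded weakly, so a real `δ₀` strictly below `ε` is
  -- fixed first. The closeness `δ₀ / (C + 1)` used below absorbs the factor `C` of the chain rule;
  -- the `1` keeps the denominator positive.
  obtain ⟨δ₀, hδ₀, hδε⟩ : ∃ δ₀ : ℝ, 0 < δ₀ ∧ ENNReal.ofReal δ₀ < ε := by
    obtain ⟨δ, h1, h2⟩ := ENNReal.lt_iff_exists_real_btwn.1 hε
    exact ⟨δ, by simpa using h2.1, h2.2⟩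
  have hδ : 0 < δ₀ / (C + 1) := by positivity
  have hδle : δ₀ / (C + 1) ≤ δ₀ := div_le_self hδ₀.le (by linarith)
  have hδC : δ₀ / (C + 1) * C ≤ δ₀ := by
    rw [div_mul_eq_mul_div, div_le_iff₀ (by positivity)]; nlinarith
  filter_upwards [eventually_cutoffAffine_close he hι' hr hTt hδ,
    eventually_dist_cutoffAffine_lt (q := q) hr,
    eventually_exists_inverse_cutoffAffine (q := q) hr] with s hs1 hs2 hs3
  obtain ⟨g, hg, hgl, hgr⟩ := hs3
  set f := cutoffAffine q hr s with hf
  have hfK : ∀ z ∉ K, f z = z := fun z hz => cutoffAffine_of_le hr (by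
    simp only [hK, Metric.mem_closedBall, not_le] at hz; exact hz.le)
  have hgK : ∀ z ∉ K, g z = z := fun z hz => by
    conv_lhs => rw [← hfK z hz]
    exact hgl z
  have hfT : MapsTo f T T := mapsTo_cutoffAffine hr hs2
  -- If `g z` lay outside `T`, then `f` would fix it, giving `z = f (g z) = g z`, which is outside
  -- `T`.
  have hgT : MapsTo g T T := by
    intro z hz
    by_contra h
    have h1 : g z ∉ K := fun h' => h (hKT h')
    rw [← hgr z, hfK _ h1] at hz
    exact h hz
  let Ψ : Diffeomorph (𝓡∂ n) (𝓡∂ n) D' D' 1 :=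
    { toFun := chartLift c T f
      invFun := chartLift c T g
      left_inv := chartLift_leftInverse hTt hfT hgl
      right_inv := chartLift_leftInverse hTt hgT hgr
      contMDiff_toFun := (contMDiff_chartLift Metric.isOpen_ball hTt (isCompact_closedBall _ _) hKT
        (contDiff_cutoffAffine_apply hr s) hfK hfT).of_le (by norm_cast)
      contMDiff_invFun := (contMDiff_chartLift Metric.isOpen_ball hTt (isCompact_closedBall _ _)
        hKT hg hgK hgT).of_le (by norm_cast) }
  let J₁ : Impulses n D D' := I.diffeo.trans Ψ
  let J : ImpulseSpace n ι ι' e := J₁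
  have hJ : ∀ y, J.diffeo y = chartLift c T f (I.diffeo y) := fun y => rfl
  have hJK : ∀ y, I.diffeo y ∉ chartSet c K → J.diffeo y = I.diffeo y := fun y hy => by
    rw [hJ, chartLift_of_notMem hfK hy]
  have hJT : ∀ y, I.diffeo y ∈ chartSet c T → J.diffeo y ∈ chartSet c T ∧
      extChartAt (𝓡∂ n) c (J.diffeo y) = f (extChartAt (𝓡∂ n) c (I.diffeo y)) := fun y hy => by
    rw [hJ]
    exact chartLift_mem hTt hfT hy
  have hJT' : ∀ y, I.diffeo y ∈ chartSet c T → e (ι' (J.diffeo y)) =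
      e (ι' ((extChartAt (𝓡∂ n) c).symm (f (extChartAt (𝓡∂ n) c (I.diffeo y))))) := fun y hy => by
    rw [← (hJT y hy).2, (extChartAt (𝓡∂ n) c).left_inv (hJT y hy).1.1]
  have hIT' : ∀ y, I.diffeo y ∈ chartSet c T → e (ι' (I.diffeo y)) =
      e (ι' ((extChartAt (𝓡∂ n) c).symm (extChartAt (𝓡∂ n) c (I.diffeo y)))) := fun y hy => by
    rw [(extChartAt (𝓡∂ n) c).left_inv hy.1]
  refine ⟨J, ?_, hJK, hJT, ?_⟩
  · refine lt_of_le_of_lt ?_ hδε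
    refine max_le (iSup_le fun y => ?_) (iSup_le fun y => iSup_le fun v => iSup_le fun hv => ?_)
    · change edist (e (ι' (J.diffeo y))) (e (ι' (I.diffeo y))) ≤ _
      by_cases hy : I.diffeo y ∈ chartSet c K
      · have hy' := mem_chartSet_of_subset hKT hy
        rw [hJT' y hy', hIT' y hy', edist_dist]
        exact ENNReal.ofReal_le_ofReal ((hs1 _ hy.2).1.le.trans hδle)
      · rw [hJK y hy, edist_self]
        exact zero_le
    · change edist (derivAt (e ∘ ι' ∘ J.diffeo) y v) (derivAt (e ∘ ι' ∘ I.diffeo) y v) ≤ _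
      by_cases hy : I.diffeo y ∈ chartSet c K
      · have hy' := mem_chartSet_of_subset hKT hy
        obtain ⟨-, hd, hclose⟩ := hs1 _ hy.2
        have hnhds : ∀ᶠ y' in 𝓝 y, I.diffeo y' ∈ chartSet c T :=
          (hTo.preimage I.diffeo.continuous).mem_nhds hy'
        have hκ := (hκI y hy').mdifferentiableAt one_ne_zero
        have hchain : ∀ (G : EuclideanSpace ℝ (Fin n) → EuclideanSpace ℝ (Fin m))
            (F : D → EuclideanSpace ℝ (Fin m)),
            DifferentiableAt ℝ G (extChartAt (𝓡∂ n) c (I.diffeo y)) →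
            (∀ᶠ y' in 𝓝 y, F y' = G (extChartAt (𝓡∂ n) c (I.diffeo y'))) →
            derivAt F y v = fderiv ℝ G (extChartAt (𝓡∂ n) c (I.diffeo y))
              (modelDeriv
                (fun y => extChartAt (𝓡∂ n) c (I.diffeo y)) y v) := by
          intro G F hG hFG
          have h4 := mfderiv_comp y (I := 𝓡∂ n) (I' := 𝓘(ℝ, EuclideanSpace ℝ (Fin n)))
            (I'' := 𝓡 m) (g := G)
            (f := fun y => extChartAt (𝓡∂ n) c (I.diffeo y)) hG.mdifferentiableAt hκ
          rw [mfderiv_eq_fderiv] at h4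
          have h5 : F =ᶠ[𝓝 y] G ∘ (fun y => extChartAt (𝓡∂ n) c (I.diffeo y)) := hFG
          rw [derivAt, h5.mfderiv_eq]
          exact congrArg (fun L => L v) h4
        have e1 := hchain _ (e ∘ ι' ∘ J.diffeo) hd (hnhds.mono fun y' hy' => hJT' y' hy')
        have e2 := hchain _ (e ∘ ι' ∘ I.diffeo) ((contDiffAt_chart_symm he hι'
          Metric.isOpen_ball hTt hy'.2).differentiableAt one_ne_zero)
          (hnhds.mono fun y' hy' => hIT' y' hy')
        rw [e1, e2, edist_dist, dist_eq_norm, ← sub_apply]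
        refine ENNReal.ofReal_le_ofReal ((ContinuousLinearMap.le_opNorm _ _).trans ?_)
        rw [dist_eq_norm] at hclose
        refine le_trans (mul_le_mul hclose.le ((hC y hy v).trans
          (mul_le_of_le_one_right hC0 hv)) (norm_nonneg _) hδ.le) hδC
      · have : e ∘ ι' ∘ J.diffeo =ᶠ[𝓝 y] e ∘ ι' ∘ I.diffeo := by
          filter_upwards [(hKc.isClosed.isOpen_compl.preimage I.diffeo.continuous).mem_nhds hy]
            with y' hy'
          simp only [Function.comp_apply]
          rw [hJK y' hy']
        have h2 : derivAt (n := n) (e ∘ ι' ∘ J.diffeo) y = derivAt (e ∘ ι' ∘ I.diffeo) y :=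
            this.mfderiv_eq
        rw [h2, edist_self]
        exact zero_le
  -- Images move by less than `r`, so a new image within `r` of the centre comes from an old one
  -- within `2 r`, where the bump function is `1` and the perturbation is exactly affine.
  · intro y hy
    by_cases hyK : I.diffeo y ∈ chartSet c K
    · have h1 := (hJT y (mem_chartSet_of_subset hKT hyK)).2
      refine ⟨hyK.1, ?_⟩
      have h2 := hy.2
      rw [mem_preimage, h1, Metric.mem_closedBall] at h2
      rw [mem_preimage, Metric.mem_ball]
      have h3 := hs2 (extChartAt (𝓡∂ n) c (I.diffeo y))
      rw [dist_comm] at h3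
      linarith [dist_triangle (extChartAt (𝓡∂ n) c (I.diffeo y))
        (f (extChartAt (𝓡∂ n) c (I.diffeo y))) q]
    · rw [hJK y hyK] at hy
      exact absurd (mem_chartSet_of_subset (Metric.closedBall_subset_closedBall (by linarith)) hy)
        hyK

end Perturbation

/-- The tube lemma: projection along a compact factor is a closed map. This closes the sets of
impulses defined by the existence of a cycle. -/
lemma isClosed_setOf_exists_mem {P Q : Type*} [TopologicalSpace P] [TopologicalSpace Q] {K : Set Q}
    (hK : IsCompact K) {S : Set (P × Q)} (hS : IsClosed S) :
    IsClosed {J | ∃ c ∈ K, (J, c) ∈ S} := by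
  rw [← isOpen_compl_iff, isOpen_iff_mem_nhds]
  intro J hJ
  have h : ∀ᶠ J' in 𝓝 J, ∀ c ∈ K, (J', c) ∉ S :=
    hK.eventually_forall_of_forall_eventually fun c hc =>
      hS.isOpen_compl.mem_nhds fun h => hJ ⟨c, hc, h⟩
  filter_upwards [h] with J' hJ' using fun ⟨c, hc, hcS⟩ => hJ' c hc hcS

lemma isClosed_forall_lt {X : Type*} [TopologicalSpace X] {P : X → ℕ → Prop} {N : ℕ}
    (h : ∀ i < N, IsClosed {x | P x i}) : IsClosed {x | ∀ i < N, P x i} := by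
  have : {x | ∀ i < N, P x i} = ⋂ i, ⋂ (_ : i < N), {x | P x i} := by
    ext x
    simp only [mem_iInter, mem_ofPred_eq]
  rw [this]
  exact isClosed_iInter fun i => isClosed_iInter fun hi => h i hi

/-! ### Null sets in the sections -/

section Null

open MeasureTheory

variable {n m : ℕ} [NeZero n] {M : Type*} [TopologicalSpace M] [T2Space M]
  [ChartedSpace (EuclideanSpace ℝ (Fin (n + 1))) M] [IsManifold (𝓡 (n + 1)) ∞ M]
  {D' : Type*} [TopologicalSpace D'] [ChartedSpace (EuclideanHalfSpace n) D']
  [IsManifold (𝓡∂ n) ∞ D'] [SecondCountableTopology D']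
  {ι' : D' → M} {e : M → EuclideanSpace ℝ (Fin m)}
  (he : IsSmoothEmbedding (𝓡 (n + 1)) (𝓡 m) ∞ e)
  (hι' : IsSmoothEmbedding (𝓡∂ n) (𝓡 (n + 1)) ∞ ι')

lemma hausdorffMeasure_hyperplane :
    μH[(n : ℝ)] {z : EuclideanSpace ℝ (Fin n) | 0 = z 0} = 0 := by
  have hf : μH[(n : ℝ)] = (μH[(Module.finrank ℝ (EuclideanSpace ℝ (Fin n)) : ℝ)] :
      Measure (EuclideanSpace ℝ (Fin n))) := by rw [finrank_euclideanSpace_fin]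
  have hs : {z : EuclideanSpace ℝ (Fin n) | 0 = z 0}
      = LinearMap.ker (EuclideanSpace.proj (𝕜 := ℝ) (0 : Fin n)).toLinearMap := by
    ext z
    simp [eq_comm]
  rw [hf, hs]
  refine Measure.addHaar_submodule _ _ fun h => ?_
  have h1 : EuclideanSpace.single (0 : Fin n) (1 : ℝ) ∈
      LinearMap.ker (EuclideanSpace.proj (𝕜 := ℝ) (0 : Fin n)).toLinearMap := by
    rw [h]; trivial
  simp at h1

/-- The target of the chart is a neighbourhood within the half-space, so failure to be interior to
the target is failure to be interior to the half-space, whose frontier is the coordinate hyperplane.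
-/
lemma extChartAt_apply_zero_of_isBoundaryPoint {c q : D'} (hq : (𝓡∂ n).IsBoundaryPoint q)
    (hqc : q ∈ (extChartAt (𝓡∂ n) c).source) : 0 = extChartAt (𝓡∂ n) c q 0 := by
  have hqc' : q ∈ (chartAt (EuclideanHalfSpace n) c).source := by simpa using hqc
  rw [(𝓡∂ n).isBoundaryPoint_iff_of_mem_atlas (n := (∞ : ℕ∞ω)) (by simp)
    (chart_mem_atlas _ c) hqc'] at hq
  have h1 : extChartAt (𝓡∂ n) c q ∈ frontier (range (𝓡∂ n)) := by
    refine ⟨subset_closure (mem_range_self _), fun h => hq.2 ?_⟩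
    rw [mem_interior_iff_mem_nhds] at h ⊢
    have h2 := (chartAt (EuclideanHalfSpace n) c).extend_target_mem_nhdsWithin (I := 𝓡∂ n) hqc'
    change range (𝓡∂ n) ∈ 𝓝 ((chartAt (EuclideanHalfSpace n) c).extend (𝓡∂ n) q) at h
    rwa [nhdsWithin_eq_nhds.2 h] at h2
  rw [frontier_range_modelWithCornersEuclideanHalfSpace] at h1
  exact h1

include he hι' in
-- Countably many charts send `∂D'` into a hyperplane, null for the `n`-dimensional measure, and the
-- inverse charts are locally Lipschitz.
lemma hausdorffMeasure_boundary :
    μH[(n : ℝ)] ((fun x => e (ι' x)) '' (𝓡∂ n).boundary D') = 0 := by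
  obtain ⟨s, -, hs, hsu⟩ := TopologicalSpace.countable_cover_nhdsWithin (s := (univ : Set D'))
    (f := fun c => (extChartAt (𝓡∂ n) c).source)
    (fun c _ => nhdsWithin_le_nhds (extChartAt_source_mem_nhds c))
  have h1 : (fun x => e (ι' x)) '' (𝓡∂ n).boundary D' ⊆ ⋃ c ∈ s, (fun x => e (ι' x)) ''
      ((𝓡∂ n).boundary D' ∩ (extChartAt (𝓡∂ n) c).source) := by
    rintro _ ⟨x, hx, rfl⟩
    obtain ⟨c, hc, hxc⟩ := mem_iUnion₂.1 (hsu (mem_univ x))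
    exact mem_iUnion₂.2 ⟨c, hc, x, ⟨hx, hxc⟩, rfl⟩
  refine measure_mono_null h1 ((measure_biUnion_null_iff hs).2 fun c _ => ?_)
  refine hausdorffMeasure_image_eq_zero (g := extChartAt (𝓡∂ n) c) (by positivity) ?_ ?_
  · rintro q ⟨hq, hqc⟩
    have hqc' : q ∈ (chartAt (EuclideanHalfSpace n) c).source := by simpa using hqc
    have hιe : ContMDiff (𝓡∂ n) (𝓡 m) 1 (e ∘ ι') :=
      (he.contMDiff.of_le (by norm_cast)).comp (hι'.contMDiff.of_le (by norm_cast))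
    have h2 : ContDiffWithinAt ℝ 1 ((e ∘ ι') ∘ (extChartAt (𝓡∂ n) c).symm) (range (𝓡∂ n))
        (extChartAt (𝓡∂ n) c q) := by
      rw [← contMDiffWithinAt_iff_contDiffWithinAt]
      exact (hιe _).comp_contMDiffWithinAt _ ((contMDiffWithinAt_extend_symm
        (IsManifold.chart_mem_maximalAtlas c) hqc').of_le (by norm_cast))
    obtain ⟨K, t, ht, hlip⟩ := h2.exists_lipschitzOnWith (𝓡∂ n).convex_range
    have hc : Tendsto (extChartAt (𝓡∂ n) c) (𝓝 q) (𝓝[range (𝓡∂ n)] (extChartAt (𝓡∂ n) c q)) :=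
      tendsto_nhdsWithin_iff.2 ⟨continuousAt_extChartAt' hqc,
        Eventually.of_forall fun x => mem_range_self _⟩
    have h3 : Dominated (𝓝 q) (fun x => e (ι' x)) (extChartAt (𝓡∂ n) c) := by
      refine (LipschitzOnWith.dominated hlip (hc.eventually ht)).congr ?_
      filter_upwards [extChartAt_source_mem_nhds' hqc] with x hx
      simp only [Function.comp_apply]
      rw [(extChartAt (𝓡∂ n) c).left_inv hx]
    exact h3.comp_tendsto (u := id) (tendsto_id'.2 nhdsWithin_le_nhds)
  · refine measure_mono_null ?_ hausdorffMeasure_hyperplane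
    rintro _ ⟨q, ⟨hq, hqc⟩, rfl⟩
    exact extChartAt_apply_zero_of_isBoundaryPoint hq hqc

/-- The points of a section whose trajectories meet the boundary of the section, with bounds. -/
def boundaryTrace (φ : Flow ℝ M) (ι' : D' → M) (A : Set D') (k : ℝ) : Set D' :=
  {x | x ∈ A ∧ ∃ s ∈ Icc (-k) k, ∃ q ∈ A, (𝓡∂ n).IsBoundaryPoint q ∧ φ s (ι' x) = ι' q}

variable {φ : Flow ℝ M} {A : Set D'} {k : ℝ}

include hι' in
lemma isClosed_boundaryTrace (hA : IsCompact A) (hA' : IsClosed A) :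
    IsClosed (boundaryTrace (n := n) φ ι' A k) := by
  have hc : Continuous ι' := hι'.contMDiff.continuous
  have hS : IsClosed {p : D' × ℝ × D' | p.1 ∈ A ∧ p.2.2 ∈ (𝓡∂ n).boundary D' ∧
      φ p.2.1 (ι' p.1) = ι' p.2.2} := by
    refine (hA'.preimage continuous_fst).inter (IsClosed.inter
      (((𝓡∂ n).isClosed_boundary (n := (∞ : ℕ∞ω)) (by simp)).preimage
        (continuous_snd.snd)) (isClosed_eq ?_ (hc.comp continuous_snd.snd)))
    exact φ.continuous continuous_snd.fst (hc.comp continuous_fst)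
  convert isClosed_setOf_exists_mem ((isCompact_Icc (a := -k) (b := k)).prod hA) hS using 1
  ext x
  simp only [boundaryTrace, mem_ofPred_eq, Prod.exists, mem_prod]
  constructor
  · rintro ⟨hx, s, hs, q, hq, hqb, h⟩
    exact ⟨s, q, ⟨hs, hq⟩, hx, hqb, h⟩
  · rintro ⟨s, q, ⟨hs, hq⟩, hx, hqb, h⟩
    exact ⟨hx, s, hs, q, hq, hqb, h⟩

include he in
-- By transversality, a point `x` of the section reached by flowing back from `q ∈ ∂D'` is, near
-- each connecting trajectory, a Lipschitz function of `q` alone: the flow time is determined by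
-- `q`. Hence flowing between sections does not raise the dimension of `∂D'`.
lemma hausdorffMeasure_boundaryTrace (h : IsTransversal n φ ι') :
    μH[(n : ℝ)] ((fun x => e (ι' x)) '' boundaryTrace (n := n) φ ι' A k) = 0 := by
  have hc : Continuous ι' := h.isSmoothEmbedding.contMDiff.continuous
  set Q : Set (D' × ℝ × D') := {p | (𝓡∂ n).IsBoundaryPoint p.2.2 ∧ φ p.2.1 (ι' p.1) = ι' p.2.2}
  have h1 : (fun x => e (ι' x)) '' boundaryTrace (n := n) φ ι' A k ⊆
      (fun p : D' × ℝ × D' => e (ι' p.1)) '' Q := by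
    rintro _ ⟨x, ⟨-, s, -, q, -, hqb, hs⟩, rfl⟩
    exact ⟨(x, s, q), ⟨hqb, hs⟩, rfl⟩
  refine measure_mono_null h1 (hausdorffMeasure_image_eq_zero
    (g := fun p : D' × ℝ × D' => e (ι' p.2.2)) (by positivity) ?_ ?_)
  · rintro ⟨x, s, q⟩ ⟨hqb, hs⟩
    have hrev : ∀ (s : ℝ) (x q : D'), φ s (ι' x) = ι' q → φ.reverse s (ι' q) = ι' x := by
      intro s x q hs
      rw [← hs, Flow.reverse_apply, ← φ.map_add, neg_add_cancel, φ.map_zero_apply]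
    refine h.reverse.dominated he (p := fun p : D' × ℝ × D' => ι' p.2.2) (t := fun p => p.2.1)
      (y := fun p => p.1) (hrev _ _ _ hs) ?_ ?_ ?_
    · exact ((hc.comp continuous_snd.snd).continuousAt (x := (x, s, q))).mono_left
        nhdsWithin_le_nhds
    · exact (continuous_snd.fst.continuousAt (x := (x, s, q))).mono_left nhdsWithin_le_nhds
    · filter_upwards [self_mem_nhdsWithin] with p hp using hrev _ _ _ hp.2
  · refine measure_mono_null ?_ (hausdorffMeasure_boundary (n := n) he h.isSmoothEmbedding)
    rintro _ ⟨p, ⟨hp, -⟩, rfl⟩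
    exact ⟨p.2.2, hp, rfl⟩

end Null

/-! ### Cycles through a null set -/

section NullCycles

open MeasureTheory

variable {n m : ℕ} [NeZero n] {M : Type*} [TopologicalSpace M] [T2Space M]
  [ChartedSpace (EuclideanSpace ℝ (Fin (n + 1))) M] [IsManifold (𝓡 (n + 1)) ∞ M]
  {D D' : Type*} [TopologicalSpace D] [ChartedSpace (EuclideanHalfSpace n) D]
  [IsManifold (𝓡∂ n) ∞ D] [TopologicalSpace D'] [ChartedSpace (EuclideanHalfSpace n) D']
  [IsManifold (𝓡∂ n) ∞ D'] [T2Space D'] [SecondCountableTopology D] [SecondCountableTopology D']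
  {ι : D → M} {ι' : D' → M} {e : M → EuclideanSpace ℝ (Fin m)}
  (he : IsSmoothEmbedding (𝓡 (n + 1)) (𝓡 m) ∞ e) {φ : Flow ℝ M}
  (hD : IsTransversal n φ ι) (hD' : IsTransversal n φ ι')

/-- Sequences of points of the sections that are connected by trajectories and by the impulse `I`;
there are `N` trajectories and `N - 1` impulses. -/
def Chains (φ : Flow ℝ M) (ι : D → M) (ι' : D' → M) (I : D → D') (N : ℕ) :
    Set ((ℕ → D') × (ℕ → D) × (ℕ → ℝ)) :=
  {c | (∀ i < N, φ (c.2.2 i) (ι' (c.1 i)) = ι (c.2.1 i)) ∧ ∀ i, i + 1 < N → c.1 (i + 1) = I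
      (c.2.1 i)}

variable {N : ℕ}

include he hD hD' in
/-- Along chains, all points depend on each other in a locally Lipschitz way. -/
lemma dominated_chains (I : ImpulseSpace n ι ι' e) {c : (ℕ → D') × (ℕ → D) × (ℕ → ℝ)}
    (hc : c ∈ Chains φ ι ι' I.diffeo N) :
    (∀ i < N, Dominated (𝓝[Chains φ ι ι' I.diffeo N] c)
      (fun c => e (ι (c.2.1 i))) (fun c => e (ι' (c.1 i)))) ∧
    ∀ i < N, ∀ j < N, Dominated (𝓝[Chains φ ι ι' I.diffeo N] c)
      (fun c => e (ι' (c.1 i))) (fun c => e (ι' (c.1 j))) := by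
  set l := 𝓝[Chains φ ι ι' I.diffeo N] c
  have hιc : Continuous ι := hD.isSmoothEmbedding.contMDiff.continuous
  have hι'c : Continuous ι' := hD'.isSmoothEmbedding.contMDiff.continuous
  have hx : ∀ i, Tendsto (fun c : (ℕ → D') × (ℕ → D) × (ℕ → ℝ) => c.1 i) l (𝓝 (c.1 i)) := fun i =>
    (((continuous_apply i).comp continuous_fst).continuousAt (x := c)).mono_left nhdsWithin_le_nhds
  have hy : ∀ i, Tendsto (fun c : (ℕ → D') × (ℕ → D) × (ℕ → ℝ) => c.2.1 i) l (𝓝 (c.2.1 i)) :=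
    fun i => (((continuous_apply i).comp continuous_snd.fst).continuousAt (x := c)).mono_left
      nhdsWithin_le_nhds
  have ht : ∀ i, Tendsto (fun c : (ℕ → D') × (ℕ → D) × (ℕ → ℝ) => c.2.2 i) l (𝓝 (c.2.2 i)) :=
    fun i => (((continuous_apply i).comp continuous_snd.snd).continuousAt (x := c)).mono_left
      nhdsWithin_le_nhds
  have hrev : ∀ (s : ℝ) (x : D') (y : D), φ s (ι' x) = ι y → φ.reverse s (ι y) = ι' x := by
    intro s x y hs
    rw [← hs, Flow.reverse_apply, ← φ.map_add, neg_add_cancel, φ.map_zero_apply]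
  have hmem : ∀ᶠ c in l, c ∈ Chains φ ι ι' I.diffeo N := self_mem_nhdsWithin
  have hYX : ∀ i < N, Dominated l (fun c => e (ι (c.2.1 i))) (fun c => e (ι' (c.1 i))) :=
    fun i hi => hD.dominated he (hc.1 i hi) ((hι'c.tendsto _).comp (hx i)) (ht i)
      (hmem.mono fun c hc => hc.1 i hi)
  have hXY : ∀ i < N, Dominated l (fun c => e (ι' (c.1 i))) (fun c => e (ι (c.2.1 i))) :=
    fun i hi => hD'.reverse.dominated he (hrev _ _ _ (hc.1 i hi)) ((hιc.tendsto _).comp (hy i))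
      (ht i) (hmem.mono fun c hc => hrev _ _ _ (hc.1 i hi))
  have hI : ∀ y, ContMDiffAt (𝓡∂ n) (𝓡 m) 1 (fun y => e (ι' (I.diffeo y))) y :=
    contMDiff_impulse he hD'.isSmoothEmbedding I
  have hIs : ∀ x, ContMDiffAt (𝓡∂ n) (𝓡 m) 1 (fun x => e (ι (I.diffeo.symm x))) x := fun x =>
    ((he.contMDiff.of_le (by norm_cast)).comp ((hD.isSmoothEmbedding.contMDiff.of_le
      (by norm_cast)).comp I.diffeo.symm.contMDiff)) x
  have hXS : ∀ i, i + 1 < N → Dominated l (fun c => e (ι' (c.1 (i + 1))))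
      (fun c => e (ι' (c.1 i))) := fun i hi => by
    refine Dominated.trans ?_ (hYX i (by omega))
    refine ((dominated_section he hD.isSmoothEmbedding (hI (c.2.1 i))).comp_tendsto (hy i)).congr ?_
    filter_upwards [hmem] with c hc
    rw [hc.2 i hi]
  have hXP : ∀ i, i + 1 < N → Dominated l (fun c => e (ι' (c.1 i)))
      (fun c => e (ι' (c.1 (i + 1)))) := fun i hi => by
    refine Dominated.trans (hXY i (by omega)) ?_
    refine ((dominated_section he hD'.isSmoothEmbedding (hIs (c.1 (i + 1)))).comp_tendsto
      (hx (i + 1))).congr ?_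
    filter_upwards [hmem] with c hc
    have h1 : I.diffeo.symm (I.diffeo (c.2.1 i)) = c.2.1 i := I.diffeo.symm_apply_apply _
    rw [hc.2 i hi, h1]
  -- Each point of a chain is compared in both directions with the initial one; any two points are
  -- then compared through it.
  have h0 : ∀ i < N, Dominated l (fun c => e (ι' (c.1 i))) (fun c => e (ι' (c.1 0))) ∧
      Dominated l (fun c => e (ι' (c.1 0))) (fun c => e (ι' (c.1 i))) := by
    intro i
    induction i with
    | zero => exact fun _ => ⟨Dominated.refl _ _, Dominated.refl _ _⟩
    | succ i ih =>
      intro hi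
      obtain ⟨h1, h2⟩ := ih (by omega)
      exact ⟨(hXS i hi).trans h1, h2.trans (hXP i hi)⟩
  exact ⟨hYX, fun i hi j hj => (h0 i hi).1.trans (h0 j hj).2⟩

/-- The impulses that have a cycle of period `N` through `Z`, with bounds, whose initial point
lies in the closed ball of radius `r` in a chart and whose other points avoid a larger ball. -/
def nullCycleImpulses (φ : Flow ℝ M) (ι : D → M) (ι' : D' → M) (e : M → EuclideanSpace ℝ (Fin m))
    (c : D') (q : EuclideanSpace ℝ (Fin n)) (r : ℝ) (N j : ℕ) (Z A' : Set D') (A : Set D) (k : ℝ) :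
    Set (ImpulseSpace n ι ι' e) :=
  {J | ∃ x : ℕ → D', ∃ y : ℕ → D, ∃ t : ℕ → ℝ, (∀ i, x i ∈ A' ∧ y i ∈ A ∧ t i ∈ Icc (-k) k) ∧
    (∀ i < N, φ (t i) (ι' (x i)) = ι (y i) ∧ x (i + 1) = J.diffeo (y i)) ∧ x N = x 0 ∧
    x 0 ∈ chartSet c (Metric.closedBall q r) ∧
    (∀ i < N, 0 < i → x i ∉ chartSet c (Metric.ball q (4 * r))) ∧ x j ∈ Z}

variable {c : D'} {q : EuclideanSpace ℝ (Fin n)} {r : ℝ} {j : ℕ} {Z A' : Set D'} {A : Set D} {k : ℝ}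

include he hD hD' in
-- The times are arbitrary hitting times, not first ones, and the avoided ball is open. So all
-- conditions are closed in the impulse and the cycle, and the latter ranges over a product of
-- compact sets.
lemma isClosed_nullCycleImpulses (hr : 0 < r)
    (hTt : Metric.ball q (4 * r) ⊆ (extChartAt (𝓡∂ n) c).target) (hZ : IsClosed Z)
    (hA' : IsCompact A') (hA : IsCompact A) :
    IsClosed (nullCycleImpulses φ ι ι' e c q r N j Z A' A k) := by
  have hιc : Continuous ι := hD.isSmoothEmbedding.contMDiff.continuous
  have hι'c : Continuous ι' := hD'.isSmoothEmbedding.contMDiff.continuous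
  have hJc := continuous_impulse_apply (ι := ι) he hD'.isSmoothEmbedding
  have hx : ∀ i, Continuous fun p : ImpulseSpace n ι ι' e × ((ℕ → D') × (ℕ → D) × (ℕ → ℝ)) =>
    p.2.1 i := fun i => (continuous_apply i).comp continuous_snd.fst
  have hy : ∀ i, Continuous fun p : ImpulseSpace n ι ι' e × ((ℕ → D') × (ℕ → D) × (ℕ → ℝ)) =>
    p.2.2.1 i := fun i => (continuous_apply i).comp continuous_snd.snd.fst
  have ht : ∀ i, Continuous fun p : ImpulseSpace n ι ι' e × ((ℕ → D') × (ℕ → D) × (ℕ → ℝ)) =>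
    p.2.2.2 i := fun i => (continuous_apply i).comp continuous_snd.snd.snd
  have hK : IsCompact ((Set.pi univ fun _ : ℕ => A') ×ˢ ((Set.pi univ fun _ : ℕ => A) ×ˢ
      (Set.pi univ fun _ : ℕ => Icc (-k) k))) :=
    (isCompact_univ_pi fun _ => hA').prod ((isCompact_univ_pi fun _ => hA).prod
      (isCompact_univ_pi fun _ => isCompact_Icc))
  have hball : IsClosed (chartSet c (Metric.closedBall q r)) :=
    (isCompact_chartSet c (isCompact_closedBall _ _)
      ((Metric.closedBall_subset_ball (by linarith)).trans hTt)).isClosed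
  have hS : IsClosed {p : ImpulseSpace n ι ι' e × ((ℕ → D') × (ℕ → D) × (ℕ → ℝ)) |
      (∀ i < N, φ (p.2.2.2 i) (ι' (p.2.1 i)) = ι (p.2.2.1 i) ∧
        p.2.1 (i + 1) = p.1.diffeo (p.2.2.1 i)) ∧ p.2.1 N = p.2.1 0 ∧
      p.2.1 0 ∈ chartSet c (Metric.closedBall q r) ∧
      (∀ i < N, 0 < i → p.2.1 i ∉ chartSet c (Metric.ball q (4 * r))) ∧ p.2.1 j ∈ Z} := by
    have h1 : IsClosed {p : ImpulseSpace n ι ι' e × ((ℕ → D') × (ℕ → D) × (ℕ → ℝ)) |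
        ∀ i < N, φ (p.2.2.2 i) (ι' (p.2.1 i)) = ι (p.2.2.1 i) ∧
          p.2.1 (i + 1) = p.1.diffeo (p.2.2.1 i)} :=
      isClosed_forall_lt fun i _ => IsClosed.inter
        (isClosed_eq (φ.continuous (ht i) (hι'c.comp (hx i))) (hιc.comp (hy i)))
        (isClosed_eq (hx _) (hJc.comp (continuous_fst.prodMk (hy i))))
    have h2 : IsClosed {p : ImpulseSpace n ι ι' e × ((ℕ → D') × (ℕ → D) × (ℕ → ℝ)) |
        ∀ i < N, 0 < i → p.2.1 i ∉ chartSet c (Metric.ball q (4 * r))} := by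
      refine isClosed_forall_lt fun i _ => ?_
      by_cases hi : 0 < i
      · simp only [hi, true_imp_iff]
        exact ((isOpen_chartSet c Metric.isOpen_ball).isClosed_compl).preimage (hx i)
      · simp [hi]
    exact h1.inter ((isClosed_eq (hx N) (hx 0)).inter
      ((hball.preimage (hx 0)).inter (h2.inter (hZ.preimage (hx j)))))
  convert isClosed_setOf_exists_mem hK hS using 1
  ext J
  simp only [nullCycleImpulses, mem_ofPred_eq, Prod.exists, mem_prod, mem_univ_pi]
  constructor
  · rintro ⟨x, y, t, h, h'⟩
    exact ⟨x, y, t, ⟨fun i => (h i).1, fun i => (h i).2.1, fun i => (h i).2.2⟩, h'⟩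
  · rintro ⟨x, y, t, h, h'⟩
    exact ⟨x, y, t, fun i => ⟨h.1 i, h.2.1 i, h.2.2 i⟩, h'⟩

include he hD hD' in
/-- The possible displacements of chains through a null set form a null set. -/
lemma hausdorffMeasure_displacement_chains
    (hZ : μH[(n : ℝ)] ((fun x => e (ι' x)) '' Z) = 0) (hN : 0 < N) (hj : j < N)
    (I : ImpulseSpace n ι ι' e) :
    μH[(n : ℝ)] ((fun p : (ℕ → D') × (ℕ → D) × (ℕ → ℝ) => extChartAt (𝓡∂ n) c (p.1 0) -
      extChartAt (𝓡∂ n) c (I.diffeo (p.2.1 (N - 1)))) '' {p | p ∈ Chains φ ι ι' I.diffeo N ∧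
        p.1 0 ∈ (extChartAt (𝓡∂ n) c).source ∧
        I.diffeo (p.2.1 (N - 1)) ∈ (extChartAt (𝓡∂ n) c).source ∧ p.1 j ∈ Z}) = 0 := by
  refine hausdorffMeasure_image_eq_zero (g := fun p => e (ι' (p.1 j))) (by positivity) ?_ ?_
  · rintro p ⟨hp, hp0, hpN, hpj⟩
    obtain ⟨h1, h2⟩ := dominated_chains he hD hD' I hp
    have hle : 𝓝[{p | p ∈ Chains φ ι ι' I.diffeo N ∧
        p.1 0 ∈ (extChartAt (𝓡∂ n) c).source ∧
        I.diffeo (p.2.1 (N - 1)) ∈ (extChartAt (𝓡∂ n) c).source ∧ p.1 j ∈ Z}] p ≤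
        𝓝[Chains φ ι ι' I.diffeo N] p := nhdsWithin_mono _ fun p hp => hp.1
    have hκ : ∀ x ∈ (extChartAt (𝓡∂ n) c).source, ContMDiffAt (𝓡∂ n)
        𝓘(ℝ, EuclideanSpace ℝ (Fin n)) 1 (extChartAt (𝓡∂ n) c) x := fun x hx =>
      contMDiffAt_extChartAt' (by simpa using hx)
    have hx : Tendsto (fun c : (ℕ → D') × (ℕ → D) × (ℕ → ℝ) => c.1 0)
        (𝓝[Chains φ ι ι' I.diffeo N] p) (𝓝 (p.1 0)) :=
      (((continuous_apply 0).comp continuous_fst).continuousAt (x := p)).mono_left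
        nhdsWithin_le_nhds
    have hy : Tendsto (fun c : (ℕ → D') × (ℕ → D) × (ℕ → ℝ) => c.2.1 (N - 1))
        (𝓝[Chains φ ι ι' I.diffeo N] p) (𝓝 (p.2.1 (N - 1))) :=
      (((continuous_apply _).comp continuous_snd.fst).continuousAt (x := p)).mono_left
        nhdsWithin_le_nhds
    have h3 := ((dominated_section he hD'.isSmoothEmbedding (hκ _ hp0)).comp_tendsto hx).trans
      (h2 0 hN j hj)
    have hκI : ContMDiffAt (𝓡∂ n) 𝓘(ℝ, EuclideanSpace ℝ (Fin n)) 1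
        (fun y => extChartAt (𝓡∂ n) c (I.diffeo y)) (p.2.1 (N - 1)) :=
      (hκ _ hpN).comp _ (I.diffeo.contMDiff _)
    have h4 := ((dominated_section he hD.isSmoothEmbedding hκI).comp_tendsto hy).trans
      ((h1 (N - 1) (by omega)).trans (h2 (N - 1) (by omega) j hj))
    exact (h3.sub h4).comp_tendsto (u := id) (tendsto_id'.2 hle)
  · refine measure_mono_null ?_ hZ
    rintro _ ⟨p, hp, rfl⟩
    exact ⟨p.1 j, hp.2.2.2, rfl⟩

include he hD hD' in
/-- For most impulses, there are no cycles through a null set. -/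
lemma interior_nullCycleImpulses (hr : 0 < r)
    (hTt : Metric.ball q (4 * r) ⊆ (extChartAt (𝓡∂ n) c).target)
    (hZ : μH[(n : ℝ)] ((fun x => e (ι' x)) '' Z) = 0) (hN : 0 < N) (hj : j < N) :
    interior (nullCycleImpulses φ ι ι' e c q r N j Z A' A k) = ∅ := by
  rw [eq_empty_iff_forall_notMem]
  intro I hI
  obtain ⟨ε, hε, hball⟩ := EMetric.mem_nhds_iff.1 (mem_interior_iff_mem_nhds.1 hI)
  have hpert := eventually_exists_perturbation he hD.isSmoothEmbedding hD'.isSmoothEmbedding I hr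
    hTt hε
  -- If `I` were an interior point, all its perturbations by small translations `v` would have such
  -- cycles. Only the last impulse of the cycle enters the perturbed ball, so removing it leaves a
  -- chain of `I`, and `v` is precisely the gap between the two ends of this chain.
  have hv : ∀ᶠ v : EuclideanSpace ℝ (Fin n) in 𝓝 0, v ∈
      (fun p : (ℕ → D') × (ℕ → D) × (ℕ → ℝ) => extChartAt (𝓡∂ n) c (p.1 0) -
      extChartAt (𝓡∂ n) c (I.diffeo (p.2.1 (N - 1)))) '' {p | p ∈ Chains φ ι ι' I.diffeo N ∧
        p.1 0 ∈ (extChartAt (𝓡∂ n) c).source ∧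
        I.diffeo (p.2.1 (N - 1)) ∈ (extChartAt (𝓡∂ n) c).source ∧ p.1 j ∈ Z} := by
    have ht : Tendsto (fun v : EuclideanSpace ℝ (Fin n) => ((0 : ℝ), v)) (𝓝 0) (𝓝 0) :=
      (Continuous.prodMk_right (0 : ℝ)).tendsto 0
    filter_upwards [ht.eventually hpert] with v hv
    obtain ⟨J, hJ, hJK, hJT, hJr⟩ := hv
    obtain ⟨x, y, t, -, hxy, hxN, hx0, hxi, hxj⟩ := hball hJ
    have hJy : J.diffeo (y (N - 1)) = x 0 := by
      rw [← hxN, ← (hxy (N - 1) (by omega)).2, Nat.sub_add_cancel hN]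
    have hIy := hJr _ (hJy ▸ hx0)
    refine ⟨(x, y, t), ⟨⟨fun i hi => (hxy i hi).1, fun i hi => ?_⟩, hx0.1, hIy.1, hxj⟩, ?_⟩
    · have h1 := (hxy i (by omega)).2
      have h2 := hxi (i + 1) hi (by omega)
      change x (i + 1) = I.diffeo (y i)
      rw [h1, hJK]
      intro h3
      rw [h1] at h2
      exact h2 (hJT _ (mem_chartSet_of_subset
        (Metric.closedBall_subset_ball (by linarith)) h3)).1
    · have h1 := (hJT _ (mem_chartSet_of_subset
        (Metric.ball_subset_ball (by linarith)) hIy)).2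
      rw [cutoffAffine_of_mem hr (Metric.ball_subset_closedBall hIy.2), hJy] at h1
      change extChartAt (𝓡∂ n) c (x 0) - extChartAt (𝓡∂ n) c (I.diffeo (y (N - 1))) = v
      rw [h1, zero_smul, add_zero, add_sub_cancel_left]
  have h0 := hausdorffMeasure_displacement_chains he hD hD' (φ := φ) (c := c) hZ hN hj I
  have hf : μH[(n : ℝ)] = (μH[(Module.finrank ℝ (EuclideanSpace ℝ (Fin n)) : ℝ)] :
      Measure (EuclideanSpace ℝ (Fin n))) := by rw [finrank_euclideanSpace_fin]
  rw [hf] at h0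
  -- The gaps would fill a neighbourhood of `0`, although they form a null set.
  exact (Measure.measure_pos_of_mem_nhds _ hv).ne' h0

end NullCycles

/-- An offending eigenvalue lies on the unit circle, which is compact. -/
lemma isClosed_setOf_not_isHyperbolicLinear {n : ℕ} :
    IsClosed {L : EuclideanSpace ℝ (Fin n) →L[ℝ] EuclideanSpace ℝ (Fin n) |
      ¬ IsHyperbolicLinear L} := by
  convert isClosed_setOf_exists_mem (isCompact_sphere (0 : ℂ) 1)
    (isClosed_singleton.preimage (continuous_aeval_charpoly (n := n)) (t := {0})) using 1
  ext L
  simp only [IsHyperbolicLinear, not_forall, not_not, mem_ofPred_eq, mem_preimage,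
    mem_singleton_iff, mem_sphere_zero_iff_norm]
  constructor
  · rintro ⟨z, hz, hz1⟩
    exact ⟨z, hz1, hz⟩
  · rintro ⟨z, hz1, hz⟩
    exact ⟨z, hz, hz1⟩

/-! ### Non-hyperbolic cycles along given branches -/

section BranchCycles

variable {n m : ℕ} [NeZero n] {M : Type*} [TopologicalSpace M] [T2Space M]
  [ChartedSpace (EuclideanSpace ℝ (Fin (n + 1))) M] [IsManifold (𝓡 (n + 1)) ∞ M]
  {D D' : Type*} [TopologicalSpace D] [ChartedSpace (EuclideanHalfSpace n) D]
  [IsManifold (𝓡∂ n) ∞ D] [TopologicalSpace D'] [ChartedSpace (EuclideanHalfSpace n) D']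
  [IsManifold (𝓡∂ n) ∞ D'] [T2Space D']
  {ι : D → M} {ι' : D' → M} {e : M → EuclideanSpace ℝ (Fin m)}
  (he : IsSmoothEmbedding (𝓡 (n + 1)) (𝓡 m) ∞ e)
  (hι : IsSmoothEmbedding (𝓡∂ n) (𝓡 (n + 1)) ∞ ι)
  (hι' : IsSmoothEmbedding (𝓡∂ n) (𝓡 (n + 1)) ∞ ι') {φ : Flow ℝ M}

/-- The sequence of points of the target section that is obtained from `x` by following given
branches and applying the impulse `J`. -/
def branchChain (b : ℕ → Branch n φ ι) (ι' : D' → M) (J : D → D') (x : D') : ℕ → D'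
  | 0 => x
  | i + 1 => J ((b i).proj (ι' (branchChain b ι' J x i)))

variable {b : ℕ → Branch n φ ι} {c : D'} {q : EuclideanSpace ℝ (Fin n)} {r : ℝ} {N : ℕ}

include hι' in
lemma contMDiffAt_branchChain (J : Impulses n D D') {x : D'} {N : ℕ}
    (h : ∀ i < N, ι' (branchChain b ι' J x i) ∈ (b i).dom) :
    ContMDiffAt (𝓡∂ n) (𝓡∂ n) 1 (fun x => branchChain b ι' J x N) x := by
  induction N with
  | zero => exact contMDiffAt_id
  | succ N ih =>
    have h1 := ih fun i hi => h i (by omega)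
    have h2 : ContMDiffAt (𝓡∂ n) (𝓡 (n + 1)) 1 (fun x => ι' (branchChain b ι' J x N)) x :=
      ContMDiffAt.comp (g := ι') x ((hι'.contMDiff _).of_le (by norm_cast)) h1
    have h3 : ContMDiffAt (𝓡∂ n) (𝓡∂ n) 1 (fun x => (b N).proj (ι' (branchChain b ι' J x N))) x :=
      ContMDiffAt.comp (g := (b N).proj) x ((b N).contMDiffAt_proj (h N (by omega))) h2
    exact ContMDiffAt.comp (g := J) x (J.contMDiff _) h3

include hι' in
lemma contMDiffAt_branchChain_chart (J : Impulses n D D')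
    (hTt : Metric.ball q (4 * r) ⊆ (extChartAt (𝓡∂ n) c).target) {z : EuclideanSpace ℝ (Fin n)}
    (hz : z ∈ Metric.ball q (4 * r))
    (h : ∀ i < N, ι' (branchChain b ι' J ((extChartAt (𝓡∂ n) c).symm z) i) ∈ (b i).dom) :
    ContMDiffAt 𝓘(ℝ, EuclideanSpace ℝ (Fin n)) (𝓡∂ n) 1
      (fun z => branchChain b ι' J ((extChartAt (𝓡∂ n) c).symm z) N) z :=
  ContMDiffAt.comp (g := fun x => branchChain b ι' J x N) z (contMDiffAt_branchChain hι' J h)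
    ((contMDiffAt_chart_symm Metric.isOpen_ball hTt hz).of_le (by norm_cast))

include hι' in
lemma contDiffAt_branchChain_chart (J : Impulses n D D')
    (hTt : Metric.ball q (4 * r) ⊆ (extChartAt (𝓡∂ n) c).target) {z : EuclideanSpace ℝ (Fin n)}
    (hz : z ∈ Metric.ball q (4 * r))
    (h : ∀ i < N, ι' (branchChain b ι' J ((extChartAt (𝓡∂ n) c).symm z) i) ∈ (b i).dom)
    (hN : branchChain b ι' J ((extChartAt (𝓡∂ n) c).symm z) N ∈ (extChartAt (𝓡∂ n) c).source) :
    ContDiffAt ℝ 1 (fun z => extChartAt (𝓡∂ n) c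
      (branchChain b ι' J ((extChartAt (𝓡∂ n) c).symm z) N)) z := by
  rw [← contMDiffAt_iff_contDiffAt]
  exact ContMDiffAt.comp (g := extChartAt (𝓡∂ n) c) z (contMDiffAt_extChartAt' (by simpa using hN))
    (contMDiffAt_branchChain_chart hι' J hTt hz h)

include he hι hι' in
-- Induction on the length. The points are viewed in the ambient Euclidean space, and a retraction
-- feeds the previous point back into the next branch and impulse, so that the chain rule for
-- `JointC1At` applies.
lemma jointC1At_branchChain (hTt : Metric.ball q (4 * r) ⊆ (extChartAt (𝓡∂ n) c).target)
    {J₀ : ImpulseSpace n ι ι' e} {z₀ : EuclideanSpace ℝ (Fin n)} (hz₀ : z₀ ∈ Metric.ball q (4 * r))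
    (h : ∀ i < N, ι' (branchChain b ι' J₀.diffeo ((extChartAt (𝓡∂ n) c).symm z₀) i) ∈ (b i).dom) :
    JointC1At (fun (J : ImpulseSpace n ι ι' e) z =>
      e (ι' (branchChain b ι' J.diffeo ((extChartAt (𝓡∂ n) c).symm z) N))) (J₀, z₀) := by
  induction N with
  | zero =>
    exact JointC1At.of_contDiffAt (contDiffAt_chart_symm he hι' Metric.isOpen_ball hTt hz₀) _
  | succ N ih =>
    have h1 := ih fun i hi => h i (by omega)
    set p₀ := ι' (branchChain b ι' J₀.diffeo ((extChartAt (𝓡∂ n) c).symm z₀) N) with hp₀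
    obtain ⟨B, hB, hBe⟩ := exists_retraction he p₀
    have hB0 : B (e p₀) = p₀ := hBe.self_of_nhds
    have h2 : ContMDiffAt (𝓡 m) (𝓡∂ n) 1 (fun ζ => (b N).proj (B ζ)) (e p₀) :=
      ContMDiffAt.comp (g := (b N).proj) (e p₀)
        (by rw [hB0]; exact (b N).contMDiffAt_proj (h N (by omega))) (hB.of_le (by norm_cast))
    have h3 := jointC1At_impulse he hι hι' h2 J₀
    have h4 : ContinuousAt (fun x : ImpulseSpace n ι ι' e × EuclideanSpace ℝ (Fin n) =>
        ι' (branchChain b ι' x.1.diffeo ((extChartAt (𝓡∂ n) c).symm x.2) N)) (J₀, z₀) :=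
      he.isEmbedding.isInducing.continuousAt_iff.2 h1.2.1
    refine (JointC1At.comp h3 h1).congr ?_
    filter_upwards [h4.eventually hBe] with x hx
    simp only [branchChain]
    rw [hx]

include he hι hι' in
lemma continuousAt_branchChain (hTt : Metric.ball q (4 * r) ⊆ (extChartAt (𝓡∂ n) c).target)
    {J₀ : ImpulseSpace n ι ι' e} {z₀ : EuclideanSpace ℝ (Fin n)} (hz₀ : z₀ ∈ Metric.ball q (4 * r))
    (h : ∀ i < N, ι' (branchChain b ι' J₀.diffeo ((extChartAt (𝓡∂ n) c).symm z₀) i) ∈ (b i).dom) :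
    ContinuousAt (fun x : ImpulseSpace n ι ι' e × EuclideanSpace ℝ (Fin n) =>
      branchChain b ι' x.1.diffeo ((extChartAt (𝓡∂ n) c).symm x.2) N) (J₀, z₀) :=
  (he.isEmbedding.isInducing.comp hι'.isEmbedding.isInducing).continuousAt_iff.2
    (jointC1At_branchChain he hι hι' hTt hz₀ h).2.1

include he hι hι' in
-- The endpoint is an interior point, so a local retraction of the ambient space onto the section
-- allows it to be read in the chart by a `C¹` function of its ambient position.
lemma continuousAt_fderiv_branchChain (hTt : Metric.ball q (4 * r) ⊆ (extChartAt (𝓡∂ n) c).target)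
    {J₀ : ImpulseSpace n ι ι' e} {z₀ : EuclideanSpace ℝ (Fin n)} (hz₀ : z₀ ∈ Metric.ball q (4 * r))
    (h : ∀ i < N, ι' (branchChain b ι' J₀.diffeo ((extChartAt (𝓡∂ n) c).symm z₀) i) ∈ (b i).dom)
    (hN : branchChain b ι' J₀.diffeo ((extChartAt (𝓡∂ n) c).symm z₀) N ∈
      chartSet c (Metric.ball q (4 * r))) :
    ContinuousAt (fun x : ImpulseSpace n ι ι' e × EuclideanSpace ℝ (Fin n) =>
      fderiv ℝ (fun z => extChartAt (𝓡∂ n) c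
        (branchChain b ι' x.1.diffeo ((extChartAt (𝓡∂ n) c).symm z) N)) x.2) (J₀, z₀) := by
  set x₀ := branchChain b ι' J₀.diffeo ((extChartAt (𝓡∂ n) c).symm z₀) N with hx₀
  obtain ⟨B, hB, hBe⟩ := exists_retraction_section he hι'
    (isInteriorPoint_of_mem_chartSet Metric.isOpen_ball hTt hN)
  have hB0 : B (e (ι' x₀)) = x₀ := hBe.self_of_nhds
  have h2 : ContDiffAt ℝ 1 (fun ζ => extChartAt (𝓡∂ n) c (B ζ)) (e (ι' x₀)) := by
    rw [← contMDiffAt_iff_contDiffAt]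
    refine ContMDiffAt.comp (g := extChartAt (𝓡∂ n) c) (e (ι' x₀)) ?_ (hB.of_le (by norm_cast))
    rw [hB0]
    exact contMDiffAt_extChartAt' (by simpa using hN.1)
  have h1 := jointC1At_branchChain he hι hι' hTt hz₀ h
  have h3 := JointC1At.comp (g := fun _ ζ => extChartAt (𝓡∂ n) c (B ζ))
    (JointC1At.of_contDiffAt h2 J₀) h1
  have h4 := continuousAt_branchChain he hι hι' hTt hz₀ h
  exact (h3.congr (g := fun (J : ImpulseSpace n ι ι' e) z => extChartAt (𝓡∂ n) c
    (branchChain b ι' J.diffeo ((extChartAt (𝓡∂ n) c).symm z) N))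
    ((h4.eventually hBe).mono fun x hx => by rw [hx])).2.2

/-- The impulses and initial points whose chains stay in the cores of the given branches. -/
def coreSet (ι' : D' → M) (e : M → EuclideanSpace ℝ (Fin m)) (b : ℕ → Branch n φ ι) (c : D')
    (q : EuclideanSpace ℝ (Fin n)) (r : ℝ) (N : ℕ) :
    Set (ImpulseSpace n ι ι' e × EuclideanSpace ℝ (Fin n)) :=
  {x | x.2 ∈ Metric.closedBall q r ∧
    ∀ i < N, ι' (branchChain b ι' x.1.diffeo ((extChartAt (𝓡∂ n) c).symm x.2) i) ∈ (b i).core}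

include he hι hι' in
lemma continuousOn_branchChain (hr : 0 < r)
    (hTt : Metric.ball q (4 * r) ⊆ (extChartAt (𝓡∂ n) c).target) {i : ℕ} (hi : i ≤ N) :
    ContinuousOn (fun x : ImpulseSpace n ι ι' e × EuclideanSpace ℝ (Fin n) =>
      branchChain b ι' x.1.diffeo ((extChartAt (𝓡∂ n) c).symm x.2) i) (coreSet ι' e b c q r N) := by
  rintro ⟨J, z⟩ ⟨hz, h⟩
  exact (continuousAt_branchChain he hι hι' hTt (Metric.closedBall_subset_ball (by linarith) hz)
    fun j hj => (b j).core_subset (h j (by omega))).continuousWithinAt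

include he hι hι' in
-- Induction is needed because the next point depends continuously on the data only where the
-- earlier points lie in the domains of their branches. The closed cores ensure this on a closed
-- set, within which one more closed condition is imposed.
lemma isClosed_coreSet (hr : 0 < r)
    (hTt : Metric.ball q (4 * r) ⊆ (extChartAt (𝓡∂ n) c).target) :
    IsClosed (coreSet ι' e b c q r N) := by
  induction N with
  | zero =>
    have : coreSet ι' e b c q r 0 = Prod.snd ⁻¹' Metric.closedBall q r := by
      ext x
      simp [coreSet]
    rw [this]
    exact Metric.isClosed_closedBall.preimage continuous_snd
  | succ N ih =>
    have h1 := (hι'.contMDiff.continuous.comp_continuousOn (continuousOn_branchChain he hι hι' hr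
      hTt (b := b) (le_refl N))).preimage_isClosed_of_isClosed ih (b N).isClosed_core
    convert h1 using 1
    ext x
    simp only [coreSet, mem_ofPred_eq, mem_inter_iff, mem_preimage, Function.comp_apply]
    constructor
    · rintro ⟨hz, h⟩
      exact ⟨⟨hz, fun i hi => h i (by omega)⟩, h N (by omega)⟩
    · rintro ⟨⟨hz, h⟩, h'⟩
      refine ⟨hz, fun i hi => ?_⟩
      rcases Nat.lt_succ_iff_lt_or_eq.1 hi with h1 | rfl
      exacts [h i h1, h']

/-- The members of `coreSet` whose intermediate points avoid the chart ball of radius `4 r`. -/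
def avoidSet (ι' : D' → M) (e : M → EuclideanSpace ℝ (Fin m)) (b : ℕ → Branch n φ ι) (c : D')
    (q : EuclideanSpace ℝ (Fin n)) (r : ℝ) (N : ℕ) :
    Set (ImpulseSpace n ι ι' e × EuclideanSpace ℝ (Fin n)) :=
  {x | x ∈ coreSet ι' e b c q r N ∧ ∀ i < N, 0 < i →
    branchChain b ι' x.1.diffeo ((extChartAt (𝓡∂ n) c).symm x.2) i ∉
      chartSet c (Metric.ball q (4 * r))}

include he hι hι' in
lemma isClosed_avoidSet (hr : 0 < r)
    (hTt : Metric.ball q (4 * r) ⊆ (extChartAt (𝓡∂ n) c).target) :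
    IsClosed (avoidSet ι' e b c q r N) := by
  have h0 := isClosed_coreSet he hι hι' hr hTt (b := b) (N := N)
  have h1 : ∀ i < N, IsClosed (coreSet ι' e b c q r N ∩
      (fun x : ImpulseSpace n ι ι' e × EuclideanSpace ℝ (Fin n) =>
        branchChain b ι' x.1.diffeo ((extChartAt (𝓡∂ n) c).symm x.2) i) ⁻¹'
          (chartSet c (Metric.ball q (4 * r)))ᶜ) := fun i hi =>
    (continuousOn_branchChain he hι hι' hr hTt hi.le).preimage_isClosed_of_isClosed h0
      (isOpen_chartSet c Metric.isOpen_ball).isClosed_compl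
  have h2 : avoidSet ι' e b c q r N = coreSet ι' e b c q r N ∩ {x | ∀ i < N, 0 < i →
      x ∈ coreSet ι' e b c q r N ∧ branchChain b ι' x.1.diffeo ((extChartAt (𝓡∂ n) c).symm x.2) i ∉
      chartSet c (Metric.ball q (4 * r))} := by
    ext x
    constructor
    · rintro ⟨h, h'⟩
      exact ⟨h, fun i hi hi' => ⟨h, h' i hi hi'⟩⟩
    · rintro ⟨h, h'⟩
      exact ⟨h, fun i hi hi' => (h' i hi hi').2⟩
  rw [h2]
  refine h0.inter (isClosed_forall_lt fun i hi => ?_)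
  by_cases hi' : 0 < i
  · simp only [hi', true_imp_iff]
    exact h1 i hi
  · simp [hi']

/-- The impulses that have a cycle along the given branches, with bounds, that is not hyperbolic or
whose initial point lies in `E`. -/
def badCycleImpulses (ι' : D' → M) (e : M → EuclideanSpace ℝ (Fin m)) (b : ℕ → Branch n φ ι)
    (c : D') (q : EuclideanSpace ℝ (Fin n)) (r : ℝ) (N : ℕ) (E : Set (EuclideanSpace ℝ (Fin n))) :
    Set (ImpulseSpace n ι ι' e) :=
  {J | ∃ z ∈ Metric.closedBall q r, (J, z) ∈ avoidSet ι' e b c q r N ∧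
    branchChain b ι' J.diffeo ((extChartAt (𝓡∂ n) c).symm z) N = (extChartAt (𝓡∂ n) c).symm z ∧
    (¬ IsHyperbolicLinear (fderiv ℝ (fun z => extChartAt (𝓡∂ n) c
        (branchChain b ι' J.diffeo ((extChartAt (𝓡∂ n) c).symm z) N)) z) ∨ z ∈ E)}

variable {E : Set (EuclideanSpace ℝ (Fin n))}

include he hι hι' in
lemma isClosed_badCycleImpulses (hr : 0 < r)
    (hTt : Metric.ball q (4 * r) ⊆ (extChartAt (𝓡∂ n) c).target) (hE : IsClosed E) :
    IsClosed (badCycleImpulses ι' e b c q r N E) := by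
  have h0 := isClosed_avoidSet he hι hι' hr hTt (b := b) (N := N)
  have hcl : Metric.closedBall q r ⊆ Metric.ball q (4 * r) :=
    Metric.closedBall_subset_ball (by linarith)
  have h1 : IsClosed (avoidSet ι' e b c q r N ∩
      (fun x : ImpulseSpace n ι ι' e × EuclideanSpace ℝ (Fin n) =>
        (branchChain b ι' x.1.diffeo ((extChartAt (𝓡∂ n) c).symm x.2) N,
          (extChartAt (𝓡∂ n) c).symm x.2)) ⁻¹' diagonal D') := by
    refine ContinuousOn.preimage_isClosed_of_isClosed (ContinuousOn.prodMk
      ((continuousOn_branchChain he hι hι' hr hTt le_rfl).mono fun x hx => hx.1) ?_) h0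
      isClosed_diagonal
    refine (continuousOn_extChartAt_symm c).comp continuousOn_snd fun x hx => ?_
    exact hTt (hcl hx.1.1)
  have h2 := isClosed_setOf_exists_mem (isCompact_closedBall q r) (IsClosed.union
    (ContinuousOn.preimage_isClosed_of_isClosed (t := {L | ¬ IsHyperbolicLinear L})
      (f := fun x : ImpulseSpace n ι ι' e × EuclideanSpace ℝ (Fin n) =>
      fderiv ℝ (fun z => extChartAt (𝓡∂ n) c
        (branchChain b ι' x.1.diffeo ((extChartAt (𝓡∂ n) c).symm z) N)) x.2) ?_ h1
        isClosed_setOf_not_isHyperbolicLinear) (h1.inter (hE.preimage continuous_snd)))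
  · convert h2 using 1
    ext J
    constructor
    · rintro ⟨z, hz, h, h', h'' | h''⟩
      · exact ⟨z, hz, Or.inl ⟨⟨h, h'⟩, h''⟩⟩
      · exact ⟨z, hz, Or.inr ⟨⟨h, h'⟩, h''⟩⟩
    · rintro ⟨z, hz, ⟨⟨h, h'⟩, h''⟩ | ⟨⟨h, h'⟩, h''⟩⟩
      · exact ⟨z, hz, h, h', Or.inl h''⟩
      · exact ⟨z, hz, h, h', Or.inr h''⟩
  · rintro ⟨J, z⟩ ⟨⟨⟨hz, hc⟩, -⟩, hN⟩
    have hN' : branchChain b ι' J.diffeo ((extChartAt (𝓡∂ n) c).symm z) N =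
      (extChartAt (𝓡∂ n) c).symm z := hN
    refine (continuousAt_fderiv_branchChain he hι hι' hTt (hcl hz)
      (fun i hi => (b i).core_subset (hc i hi)) ?_).continuousWithinAt
    rw [hN', chartSet_eq_image c hTt]
    exact mem_image_of_mem _ (hcl hz)

include he hι hι' in
-- Cycles of a perturbation `J` of `I` share all but the last step with chains of `I`. In the chart
-- they are fixed points of `F + a • (F - q) + v`, where `F` is the return map of `I`, and generic
-- `a` and `v` make these hyperbolic and keep them off `E`.
lemma interior_badCycleImpulses (hr : 0 < r)
    (hTt : Metric.ball q (4 * r) ⊆ (extChartAt (𝓡∂ n) c).target) (hE : IsClosed E)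
    (hE' : interior E = ∅) (hN : 0 < N) :
    interior (badCycleImpulses ι' e b c q r N E) = ∅ := by
  rw [eq_empty_iff_forall_notMem]
  intro I hI
  have hcl : Metric.closedBall q r ⊆ Metric.ball q (4 * r) :=
    Metric.closedBall_subset_ball (by linarith)
  have hcl2 : Metric.closedBall q (2 * r) ⊆ Metric.ball q (4 * r) :=
    Metric.closedBall_subset_ball (by linarith)
  have hcl3 : Metric.closedBall q (3 * r) ⊆ Metric.ball q (4 * r) :=
    Metric.closedBall_subset_ball (by linarith)
  obtain ⟨ε, hε, hball⟩ := EMetric.mem_nhds_iff.1 (mem_interior_iff_mem_nhds.1 hI)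
  obtain ⟨δ, hδ, hpert⟩ := Metric.eventually_nhds_iff.1
    (eventually_exists_perturbation he hι hι' I hr hTt hε)
  set ch : EuclideanSpace ℝ (Fin n) → ℕ → D' :=
    fun z => branchChain b ι' I.diffeo ((extChartAt (𝓡∂ n) c).symm z) with hch
  set F : EuclideanSpace ℝ (Fin n) → EuclideanSpace ℝ (Fin n) :=
    fun z => extChartAt (𝓡∂ n) c (ch z N) with hF
  -- The parameters must be chosen before `J` is known. This compact set, defined by `I` alone,
  -- contains the initial points of all cycles of `J` concerned: if `J` returns within `r` of `q`,
  -- then `I` arrives within `2 r`.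
  set A : Set (EuclideanSpace ℝ (Fin n)) := {z | (I, z) ∈ avoidSet ι' e b c q r N ∧
    ch z N ∈ chartSet c (Metric.closedBall q (2 * r))} with hA
  have hAc : IsCompact A := by
    have h1 := ((continuousOn_branchChain he hι hι' hr hTt (b := b) (le_refl N)).mono
      (fun x hx => hx.1)).preimage_isClosed_of_isClosed
      (isClosed_avoidSet he hι hι' hr hTt (b := b) (N := N))
      (isCompact_chartSet c (isCompact_closedBall q (2 * r)) (hcl2.trans hTt)).isClosed
    have h2 : IsClosed A := h1.preimage (Continuous.prodMk_right I)
    exact (isCompact_closedBall q r).of_isClosed_subset h2 fun z hz => hz.1.1.1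
  have hdom : ∀ z ∈ A, ∀ i < N, ι' (ch z i) ∈ (b i).dom := fun z hz i hi =>
    (b i).core_subset (hz.1.1.2 i hi)
  obtain ⟨a, v, ha, hv, hav⟩ := exists_generic_perturbation hAc (F := F) (fun z hz =>
    contDiffAt_branchChain_chart hι' I.diffeo hTt (hcl hz.1.1.1) (hdom z hz) hz.2.1) hE hE' q hδ
  obtain ⟨J, hJ, hJK, hJT, hJr⟩ := hpert (y := (a, v)) (by
    rw [dist_zero_right, Prod.norm_def]
    exact max_lt ha hv)
  obtain ⟨z, hz, ⟨⟨-, hcore⟩, havoid⟩, hfix, hbad⟩ := hball hJ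
  simp only at hcore havoid
  have heq : ∀ i < N, branchChain b ι' J.diffeo ((extChartAt (𝓡∂ n) c).symm z) i = ch z i := by
    intro i
    induction i with
    | zero => exact fun _ => rfl
    | succ i ih =>
      intro hi
      have h1 := havoid (i + 1) hi (by omega)
      simp only [branchChain, hch, ih (by omega)] at h1 ⊢
      exact hJK _ fun h2 => h1 (hJT _ (mem_chartSet_of_subset hcl3 h2)).1
  obtain ⟨N, rfl⟩ := Nat.exists_eq_succ_of_ne_zero hN.ne'
  have hzT : z ∈ (extChartAt (𝓡∂ n) c).target := hTt (hcl hz)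
  have hJN : J.diffeo ((b N).proj (ι' (ch z N))) = (extChartAt (𝓡∂ n) c).symm z := by
    rw [← heq N (by omega)]
    exact hfix
  have hJmem : J.diffeo ((b N).proj (ι' (ch z N))) ∈ chartSet c (Metric.closedBall q r) := by
    rw [hJN, chartSet_eq_image c (hcl.trans hTt)]
    exact mem_image_of_mem _ hz
  have hImem : ch z (N + 1) ∈ chartSet c (Metric.ball q (2 * r)) := hJr _ hJmem
  have hImemT := mem_chartSet_of_subset (Metric.ball_subset_ball
    (show 2 * r ≤ 4 * r by linarith)) hImem
  have hzA : z ∈ A := by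
    refine ⟨⟨⟨hz, fun i hi => ?_⟩, fun i hi hi' => ?_⟩,
      mem_chartSet_of_subset Metric.ball_subset_closedBall hImem⟩
    · have := hcore i hi
      rw [heq i hi] at this
      exact this
    · have := havoid i hi hi'
      rw [heq i hi] at this
      exact this
  have hcont : ∀ i ≤ N + 1, ContinuousAt (fun z => ch z i) z := fun i hi =>
    (contMDiffAt_branchChain_chart hι' I.diffeo hTt (hcl hz)
      fun j hj => hdom z hzA j (by omega)).continuousAt
  have hKc : IsClosed (chartSet c (Metric.closedBall q (3 * r))) :=
    (isCompact_chartSet c (isCompact_closedBall _ _) (hcl3.trans hTt)).isClosed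
  -- Equality of the chains at `z` gives the fixed point equation, but comparing derivatives
  -- requires equality near `z`. The old points lie in the open complement of the closed support of
  -- the perturbation.
  have hnear : ∀ i < N + 1, ∀ᶠ w in 𝓝 z,
      branchChain b ι' J.diffeo ((extChartAt (𝓡∂ n) c).symm w) i = ch w i := by
    intro i
    induction i with
    | zero => exact fun _ => Eventually.of_forall fun w => rfl
    | succ i ih =>
      intro hi
      have h1 : ch z (i + 1) ∈ (chartSet c (Metric.closedBall q (3 * r)))ᶜ :=
        fun h2 => hzA.1.2 (i + 1) hi (by omega) (mem_chartSet_of_subset hcl3 h2)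
      filter_upwards [ih (by omega), (hcont (i + 1) (by omega)).eventually
        (hKc.isOpen_compl.mem_nhds h1)] with w hw1 hw2
      simp only [branchChain, hch] at hw1 hw2 ⊢
      rw [hw1]
      exact hJK _ hw2
  have hFc : ContDiffAt ℝ 1 F z :=
    contDiffAt_branchChain_chart hι' I.diffeo hTt (hcl hz) (hdom z hzA) hImem.1
  have hFJ : (fun w => extChartAt (𝓡∂ n) c
      (branchChain b ι' J.diffeo ((extChartAt (𝓡∂ n) c).symm w) (N + 1))) =ᶠ[𝓝 z]
      fun w => F w + a • (F w - q) + v := by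
    filter_upwards [hnear N (by omega), (hcont (N + 1) le_rfl).eventually
      ((isOpen_chartSet c Metric.isOpen_ball).mem_nhds hImem)] with w hw1 hw2
    have h1 : branchChain b ι' J.diffeo ((extChartAt (𝓡∂ n) c).symm w) (N + 1) =
      J.diffeo ((b N).proj (ι' (ch w N))) := by rw [← hw1]; rfl
    rw [h1, (hJT _ (mem_chartSet_of_subset (Metric.ball_subset_ball (by linarith)) hw2)).2]
    exact (cutoffAffine_of_mem hr (Metric.ball_subset_closedBall hw2.2)).trans rfl
  have hfixz : z = F z + a • (F z - q) + v := by
    have h1 := hFJ.self_of_nhds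
    simp only at h1
    rw [hfix, (extChartAt (𝓡∂ n) c).right_inv hzT] at h1
    exact h1
  obtain ⟨hhyp, hzE⟩ := hav z hzA hfixz
  refine hbad.elim (fun h => h ?_) hzE
  rw [hFJ.fderiv_eq]
  have hd : HasFDerivAt F (fderiv ℝ F z) z := (hFc.differentiableAt one_ne_zero).hasFDerivAt
  have h2 := ((hd.add ((hd.sub_const q).const_smul a)).add_const v).fderiv
  have h3 : fderiv ℝ (fun w => F w + a • (F w - q) + v) z = (1 + a) • fderiv ℝ F z := by
    refine Eq.trans h2 ?_
    module
  rw [h3]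
  exact hhyp

end BranchCycles

/-! ### The combinatorics of impulsive orbits -/

section Orbits

variable {M D D' : Type*} [TopologicalSpace M] {φ : Flow ℝ M} {S : Set M} {p : M}

lemma notMem_of_lt_hittingTime {t : ℝ} (ht : 0 < t) (h : (t : EReal) < hittingTime φ S p) :
    φ t p ∉ S := fun hS =>
  h.not_ge (sInf_le ⟨t, ⟨ht, hS⟩, rfl⟩)

lemma hittingTime_nonneg : 0 ≤ hittingTime φ S p := by
  refine le_sInf ?_
  rintro _ ⟨t, ⟨ht, -⟩, rfl⟩
  exact EReal.coe_nonneg.2 ht.le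

lemma hittingTime_eq {t : ℝ} (ht : 0 < t) (hS : φ t p ∈ S)
    (h : ∀ s, 0 < s → s < t → φ s p ∉ S) : hittingTime φ S p = t := by
  refine le_antisymm (sInf_le ⟨t, ⟨ht, hS⟩, rfl⟩) (le_sInf ?_)
  rintro _ ⟨s, ⟨hs, hsS⟩, rfl⟩
  rw [EReal.coe_le_coe_iff]
  by_contra! hst
  exact h s hs hst hsS

/-- The infimum of positive hitting times may be `0`, but if it is attained in the sense of `ht`,
then `p` itself lies in `S`. -/
lemma hittingTime_pos {t : ℝ} (hp : p ∉ S) (h : hittingTime φ S p = t) (ht : φ t p ∈ S) :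
    0 < t := by
  have h1 : (0 : EReal) ≤ t := h ▸ hittingTime_nonneg
  refine (EReal.coe_nonneg.1 h1).lt_of_ne fun h0 => hp ?_
  rwa [← h0, φ.map_zero_apply] at ht

lemma hittingTime_of_apply {u t : ℝ} (hu : 0 ≤ u) (huh : (u : EReal) < hittingTime φ S p)
    (ht : 0 < t) (h : hittingTime φ S (φ u p) = t) (hS : φ t (φ u p) ∈ S) :
    hittingTime φ S p = (t + u : ℝ) ∧ φ (t + u) p ∈ S := by
  have h1 : φ (t + u) p ∈ S := by rwa [φ.map_add]
  refine ⟨hittingTime_eq (by linarith) h1 fun s hs hst => ?_, h1⟩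
  rcases le_or_gt s u with hsu | hsu
  · exact notMem_of_lt_hittingTime hs ((EReal.coe_le_coe_iff.2 hsu).trans_lt huh)
  · have h2 := notMem_of_lt_hittingTime (φ := φ) (S := S) (p := φ u p) (t := s - u)
      (by linarith) (by rw [h, EReal.coe_lt_coe_iff]; linarith)
    rwa [← φ.map_add, sub_add_cancel] at h2

variable {ι : D → M} {ι' : D' → M} {I : D → D'}

lemma poincareMap_eq (hι : Function.Injective ι) {x : D'} {t : ℝ} {y : D}
    (h : hittingTime φ (range ι) (ι' x) = t) (hy : φ t (ι' x) = ι y) :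
    x ∈ poincareDomain φ ι ι' ∧ poincareMap φ ι ι' I x = I y := by
  have hx : x ∈ poincareDomain φ ι ι' := ⟨y, t, h, hy⟩
  refine ⟨hx, ?_⟩
  rw [poincareMap, dif_pos hx]
  obtain ⟨t', ht', hy'⟩ := hx.choose_spec
  have : t' = t := EReal.coe_injective (ht'.symm.trans h)
  subst this
  rw [hι (hy'.symm.trans hy)]

variable (hι : Function.Injective ι) (hdisj : Disjoint (range ι) (range ι'))

lemma ImpulseState.nonneg {s : ℝ} {z : M} (h : ImpulseState φ ι ι' I p s z) : 0 ≤ s := by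
  induction h with
  | start => exact le_rfl
  | impulse h ht hy ih =>
    exact add_nonneg ih (EReal.coe_nonneg.1 (ht ▸ hittingTime_nonneg))

include hι in
-- The initial point need not lie on `D'`, so the first impulse is recorded separately; from then on
-- the states are iterates of the Poincaré map.
lemma ImpulseState.cases_iterate {s : ℝ} {z : M} (h : ImpulseState φ ι ι' I p s z) :
    (s = 0 ∧ z = p) ∨ ∃ (y₀ : D) (t₀ : ℝ) (j : ℕ), hittingTime φ (range ι) p = t₀ ∧
      φ t₀ p = ι y₀ ∧ (∀ i < j, (poincareMap φ ι ι' I)^[i] (I y₀) ∈ poincareDomain φ ι ι') ∧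
      z = ι' ((poincareMap φ ι ι' I)^[j] (I y₀)) := by
  induction h with
  | start => exact Or.inl ⟨rfl, rfl⟩
  | impulse h ht hy ih =>
    right
    rename_i s t z y
    rcases ih with ⟨-, rfl⟩ | ⟨y₀, t₀, j, h1, h2, h3, rfl⟩
    · exact ⟨y, t, 0, ht, hy, by simp, rfl⟩
    · obtain ⟨h4, h5⟩ := poincareMap_eq (I := I) hι ht hy
      refine ⟨y₀, t₀, j + 1, h1, h2, fun i hi => ?_, ?_⟩
      · rcases Nat.lt_succ_iff_lt_or_eq.1 hi with h6 | rfl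
        exacts [h3 i h6, h4]
      · rw [Function.iterate_succ_apply', h5]

lemma exists_impulseState {y₀ : D} {t₀ : ℝ} (h1 : hittingTime φ (range ι) p = t₀)
    (h2 : φ t₀ p = ι y₀) (h3 : ∀ i, (poincareMap φ ι ι' I)^[i] (I y₀) ∈ poincareDomain φ ι ι')
    (j : ℕ) : ∃ s, ImpulseState φ ι ι' I p s (ι' ((poincareMap φ ι ι' I)^[j] (I y₀))) := by
  induction j with
  | zero => exact ⟨0 + t₀, .impulse .start h1 h2⟩
  | succ j ih =>
    obtain ⟨s, hs⟩ := ih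
    have hx := h3 j
    obtain ⟨t, ht, hy⟩ := hx.choose_spec
    refine ⟨s + t, ?_⟩
    have h := ImpulseState.impulse hs ht hy
    rwa [Function.iterate_succ_apply', poincareMap, dif_pos hx]

include hι hdisj in
/-- A periodic orbit with no impulses does not accumulate on the cross-section; all other periodic
orbits come from cycles of the Poincaré map. -/
lemma IsPeriodicOrbit.exists_cycle [T2Space M] {γ : Set M} (h : IsPeriodicOrbit φ ι ι' I γ)
    (hγ : (closure γ ∩ range ι).Nonempty) :
    ∃ x : D', x ∈ Function.periodicPts (poincareMap φ ι ι' I) ∧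
      (∀ i, (poincareMap φ ι ι' I)^[i] x ∈ poincareDomain φ ι ι') ∧
      γ = {q | ∃ (i : ℕ) (t : ℝ), 0 ≤ t ∧
        (t : EReal) < hittingTime φ (range ι) (ι' ((poincareMap φ ι ι' I)^[i] x)) ∧
        q = φ t (ι' ((poincareMap φ ι ι' I)^[i] x))} := by
  obtain ⟨p, T, hT, ⟨s, z, hs, hsT, hlt, hp⟩, rfl⟩ := h
  have hι'm : ∀ x, ι' x ∉ range ι := fun x hx => hdisj.notMem_of_mem_left hx ⟨x, rfl⟩
  rcases hs.cases_iterate hι with ⟨rfl, rfl⟩ | ⟨y₀, t₀, j, h1, h2, h3, rfl⟩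
  -- No impulse before the return: the trajectory is a closed flow line that misses `D` forever, so
  -- no impulse ever occurs and the orbit lies in a compact set disjoint from `D`.
  · exfalso
    rw [sub_zero] at hlt hp
    have hno : ∀ t, 0 < t → t ≤ T → φ t z ∉ range ι := fun t ht htT =>
      notMem_of_lt_hittingTime ht ((EReal.coe_le_coe_iff.2 htT).trans_lt hlt)
    have hper : ∀ (k : ℕ), φ (k * T) z = z := by
      intro k
      induction k with
      | zero => simp
      | succ k ih => rw [Nat.cast_succ, add_mul, one_mul, φ.map_add, ← hp, ih]
    -- Times are reduced to `(0, T]` rather than `[0, T)`, because the hitting time says nothing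
    -- about time `0`; hence the ceiling minus one.
    have hred : ∀ t, 0 < t → ∃ u, 0 < u ∧ u ≤ T ∧ φ t z = φ u z := by
      intro t ht
      have hc : 0 < ⌈t / T⌉₊ := Nat.ceil_pos.2 (by positivity)
      have hle := Nat.le_ceil (t / T)
      have hlt' := Nat.ceil_lt_add_one (a := t / T) (by positivity)
      rw [div_le_iff₀ hT] at hle
      rw [← sub_lt_iff_lt_add, lt_div_iff₀ hT] at hlt'
      have hcast : ((⌈t / T⌉₊ - 1 : ℕ) : ℝ) = ⌈t / T⌉₊ - 1 := by
        rw [Nat.cast_sub hc]; simp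
      refine ⟨t - (⌈t / T⌉₊ - 1 : ℕ) * T, ?_, ?_, ?_⟩
      · rw [hcast]; linarith
      · rw [hcast]; nlinarith
      · conv_lhs => rw [← sub_add_cancel t ((⌈t / T⌉₊ - 1 : ℕ) * T)]
        rw [φ.map_add, hper]
    have hnever : ∀ t, 0 < t → φ t z ∉ range ι := fun t ht => by
      obtain ⟨u, hu, huT, h⟩ := hred t ht
      rw [h]
      exact hno u hu huT
    have hstate : ∀ s z', ImpulseState φ ι ι' I z s z' → s = 0 ∧ z' = z := by
      intro s z' h
      rcases h.cases_iterate hι with h | ⟨y₀, t₀, j, h1, h2, -⟩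
      · exact h
      · have h0 : t₀ ≠ 0 := by
          rintro rfl
          rw [φ.map_zero_apply] at h2
          exact hno T hT le_rfl (hp ▸ h2 ▸ ⟨y₀, rfl⟩)
        have h4 : 0 ≤ t₀ := EReal.coe_nonneg.1 (h1 ▸ hittingTime_nonneg)
        exact absurd ⟨y₀, h2.symm⟩ (hnever t₀ (h4.lt_of_ne h0.symm))
    have hsub : {q | ∃ t, 0 ≤ t ∧ Reaches φ ι ι' I z t q} ⊆ (fun t => φ t z) '' Icc 0 T := by
      rintro q ⟨t, ht, s, z', hs, hst, -, rfl⟩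
      obtain ⟨rfl, rfl⟩ := hstate s z' hs
      rw [sub_zero]
      rcases ht.eq_or_lt with rfl | ht
      · exact ⟨0, ⟨le_rfl, hT.le⟩, rfl⟩
      · obtain ⟨u, hu, huT, h⟩ := hred t ht
        exact ⟨u, ⟨hu.le, huT⟩, h.symm⟩
    have hcomp : IsCompact ((fun t => φ t z) '' Icc 0 T) :=
      isCompact_Icc.image (φ.continuous continuous_id continuous_const)
    obtain ⟨q, hq, hqι⟩ := hγ
    obtain ⟨t, ht, rfl⟩ := closure_minimal hsub hcomp.isClosed hq
    rcases ht.1.eq_or_lt with rfl | ht0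
    · simp only [φ.map_zero_apply] at hqι
      exact hno T hT le_rfl (hp ▸ hqι)
    · exact hnever t ht0 hqι
  · clear hγ
    set P := poincareMap φ ι ι' I with hP
    set x := P^[j] (I y₀) with hx
    set u := T - s with hu
    have hu0 : 0 ≤ u := by linarith
    have hpn : p ∉ range ι := by
      rw [hp]
      rcases hu0.eq_or_lt with h0 | h0
      · rw [← h0, φ.map_zero_apply]
        exact hι'm x
      · exact notMem_of_lt_hittingTime h0 hlt
    have ht₀ : 0 < t₀ := hittingTime_pos hpn h1 ⟨y₀, h2.symm⟩
    have hadd := hittingTime_of_apply hu0 hlt ht₀ (by rw [← hp]; exact h1)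
      (by rw [← hp]; exact ⟨y₀, h2.symm⟩)
    have hφ : φ (t₀ + u) (ι' x) = ι y₀ := by rw [φ.map_add, ← hp, h2]
    -- Here `x` is the last point of `D'` before the return to `p`. Continuing through `p` to the
    -- first impulse gives `P x = I y₀`, and `x = P^[j] (I y₀)`, so `x` has period `j + 1`.
    obtain ⟨hxd, hxP⟩ := poincareMap_eq (I := I) hι hadd.1 hφ
    rw [← hP] at hxP
    have hper : Function.IsPeriodicPt P (j + 1) x := by
      change P^[j + 1] x = x
      rw [Function.iterate_succ_apply, hxP]
    have hiter : ∀ i, P^[i] (I y₀) = P^[i + 1] x := fun i => by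
      rw [Function.iterate_succ_apply, hxP]
    have hdom : ∀ i, P^[i] x ∈ poincareDomain φ ι ι' := by
      intro i
      rw [← hper.iterate_mod_apply]
      have hlt : i % (j + 1) < j + 1 := Nat.mod_lt _ (by omega)
      cases hk : i % (j + 1) with
      | zero => exact hxd
      | succ k =>
        rw [← hiter]
        exact h3 k (by omega)
    refine ⟨x, ⟨j + 1, by omega, hper⟩, hdom, ?_⟩
    ext q
    constructor
    · rintro ⟨t, ht, s', z', hs', hst, hlt', rfl⟩
      rcases hs'.cases_iterate hι with ⟨rfl, rfl⟩ | ⟨y₁, t₁, i, h1', h2', -, rfl⟩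
      · refine ⟨0, t + u, by linarith, ?_, ?_⟩
        · change ((t + u : ℝ) : EReal) < hittingTime φ (range ι) (ι' x)
          rw [sub_zero, h1, EReal.coe_lt_coe_iff] at hlt'
          rw [hadd.1, EReal.coe_lt_coe_iff]
          linarith
        · change φ (t - 0) z' = φ (t + u) (ι' x)
          rw [φ.map_add, ← hp, sub_zero]
      · have h4 : t₁ = t₀ := EReal.coe_injective (h1'.symm.trans h1)
        subst h4
        have h5 : y₁ = y₀ := hι (h2'.symm.trans h2)
        subst h5
        exact ⟨i + 1, t - s', by linarith, by rw [← hiter]; exact hlt', by rw [← hiter]⟩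
    · rintro ⟨i, t, ht, hlt', rfl⟩
      have h4 : P^[i] x = P^[i + j] (I y₀) := by
        rw [hiter, add_assoc, Function.iterate_add_apply, hper]
      obtain ⟨s', hs'⟩ := exists_impulseState h1 h2 (fun i => by
        rw [← hP, hiter]; exact hdom _) (i + j)
      rw [← hP, ← h4] at hs'
      have h5 := hs'.nonneg
      exact ⟨s' + t, by linarith, s', _, hs', by linarith, by rwa [add_sub_cancel_left],
        by rw [add_sub_cancel_left]⟩

end Orbits

/-! ### Isolating a point of a cycle in a chart, and hyperbolicity read in charts. -/

section Charts

variable {n : ℕ} [NeZero n] {D' : Type*} [TopologicalSpace D']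
  [ChartedSpace (EuclideanHalfSpace n) D'] [IsManifold (𝓡∂ n) ∞ D'] [T2Space D']

lemma frequently_isInteriorPoint (y : D') : ∃ᶠ y' in 𝓝 y, (𝓡∂ n).IsInteriorPoint y' := by
  set κ := extChartAt (𝓡∂ n) y
  have h1 : κ y ∈ closure (interior κ.target) :=
    extChartAt_target_subset_closure_interior (mem_extChartAt_target y)
  have h2 : ∃ᶠ z in 𝓝 (κ y), z ∈ interior κ.target := mem_closure_iff_frequently.1 h1
  have h3 : Tendsto κ.symm (𝓝 (κ y)) (𝓝 y) := by
    have := continuousAt_extChartAt_symm (I := 𝓡∂ n) y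
    rwa [ContinuousAt, extChartAt_to_inv] at this
  refine h3.frequently (h2.mono fun z hz => ?_)
  have hzt : z ∈ κ.target := interior_subset hz
  have hx1 : κ.symm z ∈ (chartAt (EuclideanHalfSpace n) y).source := by
    simpa [κ] using κ.map_target hzt
  rw [(𝓡∂ n).isInteriorPoint_iff_of_mem_atlas (n := (∞ : ℕ∞ω)) (by simp) (chart_mem_atlas _ y) hx1]
  change κ (κ.symm z) ∈ interior κ.target
  rwa [κ.right_inv hzt]

/-- An interior point has a small neighbourhood of a standard form in a given chart. -/
lemma exists_chart_ball {c x : D'} (hx : x ∈ (extChartAt (𝓡∂ n) c).source)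
    (hxi : (𝓡∂ n).IsInteriorPoint x) {F : Set D'} (hF : F.Finite) (hxF : x ∉ F) :
    ∃ a l : ℕ, Metric.ball (TopologicalSpace.denseSeq (EuclideanSpace ℝ (Fin n)) a)
        (4 * (1 / ((l : ℝ) + 1))) ⊆ (extChartAt (𝓡∂ n) c).target ∧
      x ∈ chartSet c (Metric.closedBall (TopologicalSpace.denseSeq (EuclideanSpace ℝ (Fin n)) a)
        (1 / ((l : ℝ) + 1))) ∧
      ∀ x' ∈ F, x' ∉ chartSet c (Metric.ball
        (TopologicalSpace.denseSeq (EuclideanSpace ℝ (Fin n)) a) (4 * (1 / ((l : ℝ) + 1)))) := by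
  set κ := extChartAt (𝓡∂ n) c with hκ
  have hx1 : x ∈ (chartAt (EuclideanHalfSpace n) c).source := by simpa [hκ] using hx
  have h1 : κ x ∈ interior κ.target := by
    rwa [(𝓡∂ n).isInteriorPoint_iff_of_mem_atlas (n := (∞ : ℕ∞ω)) (by simp)
      (chart_mem_atlas _ c) hx1] at hxi
  have h2 : κ x ∉ κ '' (F ∩ κ.source) := by
    rintro ⟨x', ⟨hx', hxs⟩, h⟩
    exact hxF (κ.injOn hxs hx h ▸ hx')
  have h3 : interior κ.target ∩ (κ '' (F ∩ κ.source))ᶜ ∈ 𝓝 (κ x) :=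
    inter_mem (isOpen_interior.mem_nhds h1)
      (((hF.inter_of_left _).image _).isClosed.isOpen_compl.mem_nhds h2)
  obtain ⟨ε, hε, hball⟩ := Metric.mem_nhds_iff.1 h3
  -- The centre is within one radius of `κ x` and the ball has four radii; together five radii must
  -- stay below `ε`.
  obtain ⟨l, hl⟩ := exists_nat_one_div_lt (show 0 < ε / 5 by positivity)
  have hl0 : (0 : ℝ) < 1 / ((l : ℝ) + 1) := by positivity
  obtain ⟨a, hq⟩ := (TopologicalSpace.denseRange_denseSeq (EuclideanSpace ℝ (Fin n))).exists_dist_lt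
    (κ x) hl0
  set q := TopologicalSpace.denseSeq (EuclideanSpace ℝ (Fin n)) a
  have hsub : Metric.ball q (4 * (1 / ((l : ℝ) + 1))) ⊆
      interior κ.target ∩ (κ '' (F ∩ κ.source))ᶜ := by
    refine Subset.trans (fun w hw => ?_) hball
    rw [Metric.mem_ball] at hw ⊢
    rw [dist_comm] at hq
    linarith [dist_triangle w q (κ x)]
  refine ⟨a, l, hsub.trans (inter_subset_left.trans interior_subset), ⟨hx, ?_⟩, ?_⟩
  · exact Metric.mem_closedBall.2 hq.le
  · rintro x' hx' ⟨hxs, hxb⟩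
    exact (hsub hxb).2 ⟨x', ⟨hx', hxs⟩, rfl⟩

/-- Hyperbolicity of a fixed point can be checked in a chart. -/
lemma isHyperbolicLinear_of_chart {f : D' → D'} {c x : D'} {T : Set (EuclideanSpace ℝ (Fin n))}
    (hT : IsOpen T) (hTt : T ⊆ (extChartAt (𝓡∂ n) c).target) (hx : x ∈ chartSet c T) (hfx : f x = x)
    (hf : ContMDiffAt (𝓡∂ n) (𝓡∂ n) 1 f x)
    (h : IsHyperbolicLinear (fderiv ℝ (fun z => extChartAt (𝓡∂ n) c
        (f ((extChartAt (𝓡∂ n) c).symm z)))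
      (extChartAt (𝓡∂ n) c x))) :
    IsHyperbolicLinear (n := n) (mfderiv (𝓡∂ n) (𝓡∂ n) f x) := by
  set κ := extChartAt (𝓡∂ n) c with hκ
  set F : EuclideanSpace ℝ (Fin n) → EuclideanSpace ℝ (Fin n) := fun z => κ (f (κ.symm z)) with hF
  have hκx : ContMDiffAt (𝓡∂ n) 𝓘(ℝ, EuclideanSpace ℝ (Fin n)) 1 κ x :=
    contMDiffAt_extChartAt' (by simpa [hκ] using hx.1)
  have hκs : κ.symm (κ x) = x := κ.left_inv hx.1
  have hFd : DifferentiableAt ℝ F (κ x) := by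
    have h1 : ContMDiffAt 𝓘(ℝ, EuclideanSpace ℝ (Fin n)) (𝓡∂ n) 1 κ.symm (κ x) :=
      (contMDiffAt_chart_symm hT hTt hx.2).of_le (by norm_cast)
    have h2 : ContMDiffAt 𝓘(ℝ, EuclideanSpace ℝ (Fin n)) (𝓡∂ n) 1 (f ∘ κ.symm) (κ x) :=
      ContMDiffAt.comp (κ x) (by rwa [hκs]) h1
    have h3 : ContMDiffAt 𝓘(ℝ, EuclideanSpace ℝ (Fin n)) 𝓘(ℝ, EuclideanSpace ℝ (Fin n)) 1
        (κ ∘ (f ∘ κ.symm)) (κ x) :=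
      ContMDiffAt.comp (κ x) (by simp only [Function.comp_apply]; rw [hκs, hfx]; exact hκx) h2
    exact (contMDiffAt_iff_contDiffAt.1 h3).differentiableAt one_ne_zero
  set A : EuclideanSpace ℝ (Fin n) →L[ℝ] EuclideanSpace ℝ (Fin n) := modelDeriv κ x with hA
  set L : EuclideanSpace ℝ (Fin n) →L[ℝ] EuclideanSpace ℝ (Fin n) :=
    mfderiv (𝓡∂ n) (𝓡∂ n) f x with hL
  have hcomp1 : modelDeriv (F ∘ κ) x = (fderiv ℝ F (κ x)).comp A := by
    have h4 := mfderiv_comp x (I := 𝓡∂ n) (I' := 𝓘(ℝ, EuclideanSpace ℝ (Fin n)))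
      (I'' := 𝓘(ℝ, EuclideanSpace ℝ (Fin n))) (g := F) (f := κ) hFd.mdifferentiableAt
      (hκx.mdifferentiableAt one_ne_zero)
    rw [mfderiv_eq_fderiv] at h4
    exact h4
  have hcomp2 : modelDeriv (κ ∘ f) x = A.comp L := by
    have h4 := mfderiv_comp_of_eq (I := 𝓡∂ n) (I' := 𝓡∂ n)
      (I'' := 𝓘(ℝ, EuclideanSpace ℝ (Fin n))) (g := κ) (f := f) (x := x) (y := x)
      (hκx.mdifferentiableAt one_ne_zero) (hf.mdifferentiableAt one_ne_zero) hfx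
    rw [hfx] at h4
    exact h4
  have heq : modelDeriv (n := n) (F ∘ κ) x = modelDeriv (κ ∘ f) x := by
    refine Filter.EventuallyEq.mfderiv_eq ?_
    filter_upwards [extChartAt_source_mem_nhds' hx.1] with y hy
    simp only [hF, Function.comp_apply]
    rw [κ.left_inv hy]
  obtain ⟨ε, hε⟩ : ∃ ε : EuclideanSpace ℝ (Fin n) ≃L[ℝ] EuclideanSpace ℝ (Fin n),
      (ε : EuclideanSpace ℝ (Fin n) →L[ℝ] EuclideanSpace ℝ (Fin n)) = A :=
    isInvertible_mfderiv_extChartAt (I := 𝓡∂ n) hx.1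
  -- The derivative of the chart conjugates the two derivatives, so they have the same
  -- characteristic polynomial.
  have hconj : (fderiv ℝ F (κ x) : EuclideanSpace ℝ (Fin n) →ₗ[ℝ] EuclideanSpace ℝ (Fin n)) =
      ε.toLinearEquiv.conj (L : EuclideanSpace ℝ (Fin n) →ₗ[ℝ] EuclideanSpace ℝ (Fin n)) := by
    ext1 v
    have h1 : (fderiv ℝ F (κ x)).comp A = A.comp L := by rw [← hcomp1, heq, hcomp2]
    have h2 := congrArg (fun B => B (ε.symm v)) h1
    simp only [ContinuousLinearMap.comp_apply, ← hε] at h2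
    rw [ContinuousLinearEquiv.coe_coe, ε.apply_symm_apply] at h2
    exact h2
  intro w hw
  refine h w ?_
  rw [hconj, LinearEquiv.charpoly_conj]
  exact hw

end Charts

/-! ### Continuity of the first hitting time outside a set with empty interior. -/

section EarlyHits

variable {n m : ℕ} [NeZero n] {M : Type*} [TopologicalSpace M] [T2Space M] [CompactSpace M]
  [ChartedSpace (EuclideanSpace ℝ (Fin (n + 1))) M] [IsManifold (𝓡 (n + 1)) ∞ M]
  {D D' : Type*} [TopologicalSpace D] [ChartedSpace (EuclideanHalfSpace n) D]
  [IsManifold (𝓡∂ n) ∞ D] [TopologicalSpace D'] [ChartedSpace (EuclideanHalfSpace n) D']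
  [IsManifold (𝓡∂ n) ∞ D'] [T2Space D] [T2Space D']
  {ι : D → M} {ι' : D' → M} {φ : Flow ℝ M}
  (hD : IsTransversal n φ ι) (hD' : IsTransversal n φ ι')

/-- The points of the section that reach an interior point of the other section earlier than the
branch does. -/
def earlyHits (b : Branch n φ ι) (ι' : D' → M) : Set D' :=
  {x | ι' x ∈ b.dom ∧ ∃ s y, 0 < s ∧ s < b.time (ι' x) ∧ φ s (ι' x) = ι y ∧
    (𝓡∂ n).IsInteriorPoint y}

include hD hD' in
-- A transversal hit at an interior point continues along a branch, and the strict inequalities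
-- between continuous times persist.
lemma isOpen_earlyHits (b : Branch n φ ι) : IsOpen (earlyHits b ι') := by
  rw [isOpen_iff_mem_nhds]
  rintro x ⟨hx, s, y, hs, hst, hy, hyi⟩
  obtain ⟨b', hb'⟩ := hD.exists_branch hy hyi
  have hι' : ContinuousAt ι' x := hD'.isSmoothEmbedding.contMDiff.continuous.continuousAt
  have h0 := hb'.self_of_nhds
  have hs' : s = b'.time (ι' x) := h0.2 ⟨y, hy.symm⟩
  have hx' := b'.core_subset h0.1
  have hc' : ContinuousAt (fun x => b'.time (ι' x)) x :=
    ContinuousAt.comp (g := b'.time) (b'.continuousAt_time hx') hι'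
  have hc : ContinuousAt (fun x => b.time (ι' x)) x :=
    ContinuousAt.comp (g := b.time) (b.continuousAt_time hx) hι'
  filter_upwards [hι'.eventually (b.isOpen_dom.mem_nhds hx),
    hι'.eventually (b'.isOpen_dom.mem_nhds hx'), hc'.eventually (lt_mem_nhds (hs' ▸ hs)),
    hc'.eventually_lt hc (hs' ▸ hst)] with x' h1 h2 h3 h4
  exact ⟨h1, b'.time (ι' x'), b'.proj (ι' x'), h3, h4, b'.flow_time _ h2, b'.isInteriorPoint _ h2⟩

include hD hD' in
/-- Away from the frontier of the set of early hits, the first hitting time is given by a branch. -/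
lemma eventually_hittingTime_eq {b : Branch n φ ι} {x : D'} (hxi : (𝓡∂ n).IsInteriorPoint x)
    (hx : ι' x ∈ b.dom) (ht : 0 < b.time (ι' x))
    (hhit : hittingTime φ (range ι) (ι' x) = b.time (ι' x)) (hfr : x ∉ frontier (earlyHits b ι')) :
    ∀ᶠ x' in 𝓝 x, ι' x' ∈ b.dom ∧ hittingTime φ (range ι) (ι' x') = b.time (ι' x') := by
  have hopen := isOpen_earlyHits hD hD' b
  have hι' : Continuous ι' := hD'.isSmoothEmbedding.contMDiff.continuous
  have hι : Continuous ι := hD.isSmoothEmbedding.contMDiff.continuous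
  have hxG : x ∉ earlyHits b ι' := by
    rintro ⟨-, s, y, hs, hst, hy, -⟩
    have hlt : (s : EReal) < hittingTime φ (range ι) (ι' x) := by
      rw [hhit]; exact EReal.coe_lt_coe_iff.2 hst
    exact notMem_of_lt_hittingTime hs hlt ⟨y, hy.symm⟩
  have hxcl : x ∉ closure (earlyHits b ι') := fun h =>
    hfr ⟨h, by rwa [hopen.interior_eq]⟩
  have hc : ∀ x, ι' x ∈ b.dom → ContinuousAt (fun x => b.time (ι' x)) x := fun x hx =>
    ContinuousAt.comp (g := b.time) (b.continuousAt_time hx) hι'.continuousAt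
  have hno : ∀ᶠ x' in 𝓝 x, x' ∉ earlyHits b ι' := by
    filter_upwards [isClosed_closure.isOpen_compl.mem_nhds hxcl] with x' hx' h
    exact hx' (subset_closure h)
  filter_upwards [hno.eventually_nhds, hno,
    ((𝓡∂ n).isOpen_interior (n := (∞ : ℕ∞ω)) (by simp)).mem_nhds hxi,
    hι'.continuousAt.eventually (b.isOpen_dom.mem_nhds hx),
    (hc x hx).eventually (lt_mem_nhds ht)] with x' h1 h2 h3 h4 h5
  refine ⟨h4, hittingTime_eq h5 ⟨_, (b.flow_time _ h4).symm⟩ ?_⟩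
  rintro s hs hst ⟨y, hy⟩
  -- Suppose `x'` hits `D` early, at `y`. Flowing back from points of `D` near `y` leads to points
  -- of `D'` near `x'`. Interior points of `D` occur arbitrarily near `y`, even if `y ∈ ∂D`, and
  -- they would produce early hits near `x'`, where there are none.
  have hrev : φ.reverse s (ι y) = ι' x' := by
    rw [hy, Flow.reverse_apply, ← φ.map_add, neg_add_cancel, φ.map_zero_apply]
  obtain ⟨b', hb'⟩ := hD'.reverse.exists_branch hrev h3
  have h0 := hb'.self_of_nhds
  have hs' : s = b'.time (ι y) := h0.2 ⟨x', hrev.symm⟩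
  have hy' := b'.core_subset h0.1
  have hpy : b'.proj (ι y) = x' := by
    apply hD'.isSmoothEmbedding.isEmbedding.injective
    rw [← b'.flow_time _ hy', ← hs', hrev]
  have hc' : ContinuousAt (fun y => b'.time (ι y)) y :=
    ContinuousAt.comp (g := b'.time) (b'.continuousAt_time hy') hι.continuousAt
  have hp' : ContinuousAt (fun y => b'.proj (ι y)) y :=
    ContinuousAt.comp (g := b'.proj) (b'.contMDiffAt_proj hy').continuousAt hι.continuousAt
  have hp'' : Tendsto (fun y => b'.proj (ι y)) (𝓝 y) (𝓝 x') := by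
    have := hp'.tendsto
    rwa [hpy] at this
  have hct : Tendsto (fun y => b.time (ι' (b'.proj (ι y)))) (𝓝 y) (𝓝 (b.time (ι' x'))) :=
    (hc x' h4).tendsto.comp hp''
  have hev : ∀ᶠ y' in 𝓝 y, ¬ (𝓡∂ n).IsInteriorPoint y' := by
    filter_upwards [hι.continuousAt.eventually (b'.isOpen_dom.mem_nhds hy'),
      hc'.eventually (lt_mem_nhds (hs' ▸ hs)), hc'.tendsto.eventually_lt hct (hs' ▸ hst),
      hp''.eventually h1, hp''.eventually ((b.isOpen_dom.preimage hι').mem_nhds h4)]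
      with y' g1 g2 g3 g4 g5 hyi
    refine g4 ⟨g5, b'.time (ι y'), y', g2, g3, ?_, hyi⟩
    rw [← b'.flow_time _ g1, Flow.reverse_apply, ← φ.map_add, add_neg_cancel, φ.map_zero_apply]
  exact frequently_isInteriorPoint y hev

/-- The set of early hits has a nowhere dense frontier, also in a chart. -/
lemma isClosed_chart_frontier (G : Set D') {c : D'} {q : EuclideanSpace ℝ (Fin n)} {r : ℝ}
    (hTt : Metric.closedBall q r ⊆ (extChartAt (𝓡∂ n) c).target) :
    IsClosed (Metric.closedBall q r ∩ (extChartAt (𝓡∂ n) c).symm ⁻¹' frontier G) :=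
  ((continuousOn_extChartAt_symm c).mono hTt).preimage_isClosed_of_isClosed
    Metric.isClosed_closedBall isClosed_frontier

/-- The frontier of an open set has empty interior, and an open set of the chart contained in its
preimage would give an open set inside it. -/
lemma interior_chart_frontier {G : Set D'} (hG : IsOpen G) {c : D'} {q : EuclideanSpace ℝ (Fin n)}
    {r : ℝ} (hTt : Metric.closedBall q r ⊆ (extChartAt (𝓡∂ n) c).target) :
    interior (Metric.closedBall q r ∩ (extChartAt (𝓡∂ n) c).symm ⁻¹' frontier G) = ∅ := by
  set W := interior (Metric.closedBall q r ∩ (extChartAt (𝓡∂ n) c).symm ⁻¹' frontier G) with hW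
  have hWt : W ⊆ (extChartAt (𝓡∂ n) c).target :=
    interior_subset.trans (inter_subset_left.trans hTt)
  have h1 : chartSet c W ⊆ interior (frontier G) := by
    refine interior_maximal ?_ (isOpen_chartSet c isOpen_interior)
    rw [chartSet_eq_image c hWt]
    rintro _ ⟨z, hz, rfl⟩
    exact (interior_subset hz).2
  rw [← frontier_compl, interior_frontier hG.isClosed_compl, subset_empty_iff, chartSet_eq_image c
      hWt, image_eq_empty] at h1
  exact h1

end EarlyHits

/-! ### Generic impulses -/

lemma eventually_residual_notMem {X : Type*} [TopologicalSpace X] {S : Set X} (hS : IsClosed S)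
    (h : interior S = ∅) : ∀ᶠ x in residual X, x ∉ S :=
  residual_of_dense_open hS.isOpen_compl (interior_eq_empty_iff_dense_compl.1 h)

lemma CompactExhaustion.eventually_mem {X : Type*} [TopologicalSpace X] (K : CompactExhaustion X)
    (x : X) : ∀ᶠ k in atTop, x ∈ K k := by
  obtain ⟨k, hk⟩ := K.exists_mem x
  filter_upwards [eventually_ge_atTop k] with l hl using K.subset hl hk

section GenericImpulses

variable {n m : ℕ} [NeZero n] {M : Type*} [TopologicalSpace M] [T2Space M] [CompactSpace M]
  [ChartedSpace (EuclideanSpace ℝ (Fin (n + 1))) M] [IsManifold (𝓡 (n + 1)) ∞ M]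
  {D D' : Type*} [TopologicalSpace D] [ChartedSpace (EuclideanHalfSpace n) D]
  [IsManifold (𝓡∂ n) ∞ D] [TopologicalSpace D'] [ChartedSpace (EuclideanHalfSpace n) D']
  [IsManifold (𝓡∂ n) ∞ D'] [T2Space D] [T2Space D'] [SecondCountableTopology D]
  [SecondCountableTopology D'] {ι : D → M} {ι' : D' → M} {e : M → EuclideanSpace ℝ (Fin m)}
  (he : IsSmoothEmbedding (𝓡 (n + 1)) (𝓡 m) ∞ e) {φ : Flow ℝ M}
  (hD : IsTransversal n φ ι) (hD' : IsTransversal n φ ι')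
  (hdisj : Disjoint (range ι) (range ι'))

/-- The impulse has no cycles that meet the boundary of the target section; the quantifiers range
over countable sets. -/
def AvoidsBoundary (φ : Flow ℝ M) (S : Set D') (K : CompactExhaustion D) (K' : CompactExhaustion D')
    (J : ImpulseSpace n ι ι' e) : Prop :=
  ∀ c ∈ S, ∀ a l N j k : ℕ, Metric.ball (TopologicalSpace.denseSeq (EuclideanSpace ℝ (Fin n)) a)
      (4 * (1 / ((l : ℝ) + 1))) ⊆ (extChartAt (𝓡∂ n) c).target → j < N →
    J ∉ nullCycleImpulses φ ι ι' e c (TopologicalSpace.denseSeq (EuclideanSpace ℝ (Fin n)) a)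
      (1 / ((l : ℝ) + 1)) N j (boundaryTrace (n := n) φ ι' (K' k) k) (K' k) (K k) k

/-- All cycles of the impulse along branches of a given countable family are hyperbolic and
have no early hits; the quantifiers range over countable sets. -/
def HyperbolicBranchCycles (S : Set D') (B : ℕ → Branch n φ ι) (J : ImpulseSpace n ι ι' e) : Prop :=
  ∀ c ∈ S, ∀ a l N : ℕ, ∀ β : List ℕ,
    Metric.ball (TopologicalSpace.denseSeq (EuclideanSpace ℝ (Fin n)) a)
      (4 * (1 / ((l : ℝ) + 1))) ⊆ (extChartAt (𝓡∂ n) c).target → 0 < N →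
    J ∉ badCycleImpulses ι' e (fun i => B (β.getD i 0)) c
      (TopologicalSpace.denseSeq (EuclideanSpace ℝ (Fin n)) a) (1 / ((l : ℝ) + 1)) N
      (Metric.closedBall (TopologicalSpace.denseSeq (EuclideanSpace ℝ (Fin n)) a)
        (1 / ((l : ℝ) + 1)) ∩ (extChartAt (𝓡∂ n) c).symm ⁻¹'
          frontier (earlyHits (B (β.getD 0 0)) ι'))

include he hD hD' in
lemma eventually_avoidsBoundary {S : Set D'} (hS : S.Countable) (K : CompactExhaustion D)
    (K' : CompactExhaustion D') :
    ∀ᶠ J : ImpulseSpace n ι ι' e in residual _, AvoidsBoundary φ S K K' J := by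
  refine (eventually_countable_ball hS).2 fun c _ => eventually_countable_forall.2 fun a =>
    eventually_countable_forall.2 fun l => eventually_countable_forall.2 fun N =>
    eventually_countable_forall.2 fun j => eventually_countable_forall.2 fun k =>
    eventually_imp_distrib_left.2 fun hTt => eventually_imp_distrib_left.2 fun hj => ?_
  have hr : (0 : ℝ) < 1 / ((l : ℝ) + 1) := by positivity
  exact eventually_residual_notMem
    (isClosed_nullCycleImpulses he hD hD' hr hTt (isClosed_boundaryTrace hD'.isSmoothEmbedding
      (K'.isCompact k) (K'.isCompact k).isClosed) (K'.isCompact k) (K.isCompact k))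
    (interior_nullCycleImpulses he hD hD' hr hTt (hausdorffMeasure_boundaryTrace he hD')
      (by omega) hj)

include he hD hD' in
lemma eventually_hyperbolicBranchCycles {S : Set D'} (hS : S.Countable) (B : ℕ → Branch n φ ι) :
    ∀ᶠ J : ImpulseSpace n ι ι' e in residual _, HyperbolicBranchCycles S B J := by
  refine (eventually_countable_ball hS).2 fun c _ => eventually_countable_forall.2 fun a =>
    eventually_countable_forall.2 fun l => eventually_countable_forall.2 fun N =>
    eventually_countable_forall.2 fun β =>
    eventually_imp_distrib_left.2 fun hTt => eventually_imp_distrib_left.2 fun hN => ?_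
  have hr : (0 : ℝ) < 1 / ((l : ℝ) + 1) := by positivity
  have hTt' := (Metric.closedBall_subset_ball (lt_mul_of_one_lt_left hr (by norm_num))).trans hTt
  have hcl := isClosed_chart_frontier (n := n) (earlyHits (B (β.getD 0 0)) ι') hTt'
  exact eventually_residual_notMem
    (isClosed_badCycleImpulses he hD.isSmoothEmbedding hD'.isSmoothEmbedding hr hTt hcl)
    (interior_badCycleImpulses he hD.isSmoothEmbedding hD'.isSmoothEmbedding hr hTt hcl
      (interior_chart_frontier (isOpen_earlyHits hD hD' _) hTt') hN)

variable {S : Set D'} (hS : ∀ x, ∃ c ∈ S, x ∈ (extChartAt (𝓡∂ n) c).source)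
  {K : CompactExhaustion D} {K' : CompactExhaustion D'} {J : ImpulseSpace n ι ι' e} {x : D'}

include hS in
/-- The standard neighbourhoods of a point of a cycle that contain no other points of it. -/
lemma exists_chart_ball_of_cycle {P : D' → D'} (hxi : (𝓡∂ n).IsInteriorPoint x) :
    ∃ c ∈ S, ∃ a l : ℕ, Metric.ball (TopologicalSpace.denseSeq (EuclideanSpace ℝ (Fin n)) a)
        (4 * (1 / ((l : ℝ) + 1))) ⊆ (extChartAt (𝓡∂ n) c).target ∧
      x ∈ chartSet c (Metric.closedBall (TopologicalSpace.denseSeq (EuclideanSpace ℝ (Fin n)) a)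
        (1 / ((l : ℝ) + 1))) ∧
      ∀ i < Function.minimalPeriod P x, 0 < i → P^[i] x ∉ chartSet c (Metric.ball
        (TopologicalSpace.denseSeq (EuclideanSpace ℝ (Fin n)) a) (4 * (1 / ((l : ℝ) + 1)))) := by
  obtain ⟨c, hc, hxc⟩ := hS x
  have hF : ((fun i => P^[i] x) '' Ioo 0 (Function.minimalPeriod P x)).Finite :=
    (finite_Ioo _ _).image _
  obtain ⟨a, l, h1, h2, h3⟩ := exists_chart_ball hxc hxi hF (by
    rintro ⟨i, ⟨hi, hi'⟩, h⟩
    exact Function.not_isPeriodicPt_of_pos_of_lt_minimalPeriod hi.ne' hi' h)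
  exact ⟨c, hc, a, l, h1, h2, fun i hi hi' => h3 _ ⟨i, ⟨hi', hi⟩, rfl⟩⟩

include hD hS in
-- A meeting with `∂D'` would give a cycle through the boundary trace. The cycle has finitely many
-- points and times, so a single large `k` bounds all the data and places `J` in one of the excluded
-- sets.
lemma AvoidsBoundary.ne (hJ : AvoidsBoundary φ S K K' J) (hxi : (𝓡∂ n).IsInteriorPoint x)
    (hper : x ∈ Function.periodicPts (poincareMap φ ι ι' J.diffeo))
    (hdom : ∀ i, (poincareMap φ ι ι' J.diffeo)^[i] x ∈ poincareDomain φ ι ι') (i : ℕ) (s : ℝ)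
    {q : D'} (hq : (𝓡∂ n).IsBoundaryPoint q) :
    φ s (ι' ((poincareMap φ ι ι' J.diffeo)^[i] x)) ≠ ι' q := by
  intro hs
  set P := poincareMap φ ι ι' J.diffeo with hP
  set N := Function.minimalPeriod P x with hN
  have hNpos : 0 < N := Function.minimalPeriod_pos_of_mem_periodicPts hper
  have hmod : ∀ i, P^[i] x = P^[i % N] x := fun i => (Function.iterate_mod_minimalPeriod_eq).symm
  have : Nonempty D := ⟨(hdom 0).choose⟩
  have hdom' : ∀ z ∈ poincareDomain φ ι ι', ∃ y : D, ∃ t : ℝ,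
      hittingTime φ (range ι) (ι' z) = (t : EReal) ∧ φ t (ι' z) = ι y := fun z hz => hz
  choose! Y T hT hY using hdom'
  obtain ⟨c, hc, a, l, h1, h2, h3⟩ := exists_chart_ball_of_cycle hS (P := P) hxi
  have hbd : ∀ t : ℝ, ∀ᶠ k : ℕ in atTop, t ∈ Icc (-(k : ℝ)) k := fun t => by
    filter_upwards [tendsto_natCast_atTop_atTop.eventually_ge_atTop |t|] with k hk
      using abs_le.1 hk
  have hev : ∀ᶠ k : ℕ in atTop, (∀ i ∈ Finset.range N, P^[i] x ∈ K' k ∧ Y (P^[i] x) ∈ K k ∧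
      T (P^[i] x) ∈ Icc (-(k : ℝ)) k) ∧ q ∈ K' k ∧ s ∈ Icc (-(k : ℝ)) k :=
    ((eventually_all_finset _).2 fun i _ => (CompactExhaustion.eventually_mem K' _).and
      ((CompactExhaustion.eventually_mem K _).and (hbd _))).and
      ((CompactExhaustion.eventually_mem K' _).and (hbd _))
  obtain ⟨k, hk, hqk, hsk⟩ := hev.exists
  have hk' : ∀ i, P^[i] x ∈ K' k ∧ Y (P^[i] x) ∈ K k ∧ T (P^[i] x) ∈ Icc (-(k : ℝ)) k := by
    intro i
    rw [hmod i]
    exact hk _ (Finset.mem_range.2 (Nat.mod_lt _ hNpos))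
  refine hJ c hc a l N (i % N) k h1 (Nat.mod_lt _ hNpos) ⟨fun i => P^[i] x,
    fun i => Y (P^[i] x), fun i => T (P^[i] x), hk', fun i _ => ⟨hY _ (hdom i), ?_⟩,
    Function.iterate_minimalPeriod, h2, h3, ?_⟩
  · have h4 := (poincareMap_eq (I := J.diffeo) hD.isSmoothEmbedding.isEmbedding.injective
      (hT _ (hdom i)) (hY _ (hdom i))).2
    simp only
    rw [Function.iterate_succ_apply', ← h4]
  · simp only
    rw [← hmod i]
    exact ⟨(hk' i).1, s, hsk, q, hqk, hq, hs⟩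

/-- The orbit of `x` under the Poincaré map of `J` is described by the branches `b i`. -/
def FollowsBranches (J : D → D') (ι' : D' → M) (b : ℕ → Branch n φ ι) (x : D') : Prop :=
  ∀ i, ι' ((poincareMap φ ι ι' J)^[i] x) ∈ (b i).core ∧
    hittingTime φ (range ι) (ι' ((poincareMap φ ι ι' J)^[i] x)) =
      (b i).time (ι' ((poincareMap φ ι ι' J)^[i] x)) ∧
    (poincareMap φ ι ι' J)^[i + 1] x = J ((b i).proj (ι' ((poincareMap φ ι ι' J)^[i] x)))

lemma FollowsBranches.branchChain_eq {J : D → D'} {b : ℕ → Branch n φ ι} {x : D'}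
    (h : FollowsBranches J ι' b x) (i : ℕ) :
    branchChain b ι' J x i = (poincareMap φ ι ι' J)^[i] x := by
  induction i with
  | zero => rfl
  | succ i ih => rw [branchChain, ih, (h i).2.2]

lemma FollowsBranches.iterate {J : D → D'} {b : ℕ → Branch n φ ι} {x : D'}
    (h : FollowsBranches J ι' b x) (k : ℕ) :
    FollowsBranches J ι' (fun i => b (i + k)) ((poincareMap φ ι ι' J)^[k] x) := by
  intro i
  have h1 := h (i + k)
  have h2 : i + k + 1 = i + 1 + k := by omega
  rw [h2, Function.iterate_add_apply, Function.iterate_add_apply] at h1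
  exact h1

lemma branchChain_congr {J : D → D'} {b b' : ℕ → Branch n φ ι} {x : D'} {N : ℕ}
    (h : ∀ i < N, b i = b' i) : branchChain b ι' J x N = branchChain b' ι' J x N := by
  induction N with
  | zero => rfl
  | succ N ih => rw [branchChain, branchChain, ih fun i hi => h i (by omega), h N (by omega)]

include hD' hS in
-- The minimal period lets a standard chart ball separate `x` from the rest of its cycle. A failure
-- of either conclusion would then put `J` in the corresponding set of `badCycleImpulses`.
lemma HyperbolicBranchCycles.isHyperbolicLinear {B : ℕ → Branch n φ ι}
    (hJ : HyperbolicBranchCycles S B J) (hxi : (𝓡∂ n).IsInteriorPoint x)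
    (hper : x ∈ Function.periodicPts (poincareMap φ ι ι' J.diffeo)) {f : ℕ → ℕ}
    (hf : FollowsBranches J.diffeo ι' (fun i => B (f i)) x) {N : ℕ}
    (hN : N = Function.minimalPeriod (poincareMap φ ι ι' J.diffeo) x) :
    x ∉ frontier (earlyHits (B (f 0)) ι') ∧ IsHyperbolicLinear (n := n) (mfderiv (𝓡∂ n) (𝓡∂ n)
      (fun w => branchChain (fun i => B (f i)) ι' J.diffeo w N) x) := by
  have hNpos : 0 < N := hN ▸ Function.minimalPeriod_pos_of_mem_periodicPts hper
  obtain ⟨c, hc, a, l, h1, h2, h3⟩ :=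
    exists_chart_ball_of_cycle hS (P := poincareMap φ ι ι' J.diffeo) hxi
  rw [← hN] at h3
  have hr : (0 : ℝ) < 1 / ((l : ℝ) + 1) := by positivity
  set q := TopologicalSpace.denseSeq (EuclideanSpace ℝ (Fin n)) a
  -- Only the first `N` branches matter. Finite lists are countable in number, unlike sequences; the
  -- default value `0` fills the positions beyond the end.
  set β := (List.range N).map f with hβ
  have hβi : ∀ i < N, β.getD i 0 = f i := fun i hi => by
    rw [hβ, List.getD_eq_getElem _ _ (by simpa using hi)]
    simp
  have hchain : ∀ i ≤ N, ∀ w, branchChain (fun i => B (β.getD i 0)) ι' J.diffeo w i =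
      branchChain (fun i => B (f i)) ι' J.diffeo w i := fun i hi w =>
    branchChain_congr fun i' hi' => by rw [hβi i' (by omega)]
  have hfix : branchChain (fun i => B (f i)) ι' J.diffeo x N = x := by
    rw [hf.branchChain_eq, hN, Function.iterate_minimalPeriod]
  have hsymm : (extChartAt (𝓡∂ n) c).symm (extChartAt (𝓡∂ n) c x) = x :=
    (extChartAt (𝓡∂ n) c).left_inv h2.1
  have hnot := hJ c hc a l N β h1 hNpos
  have hcore : (J, extChartAt (𝓡∂ n) c x) ∈
      avoidSet ι' e (fun i => B (β.getD i 0)) c q (1 / ((l : ℝ) + 1)) N := by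
    refine ⟨⟨h2.2, fun i hi => ?_⟩, fun i hi hi' => ?_⟩
    · simp only
      rw [hsymm, hchain i hi.le, hf.branchChain_eq, hβi i hi]
      exact (hf i).1
    · simp only
      rw [hsymm, hchain i hi.le, hf.branchChain_eq]
      exact h3 i hi hi'
  have hboth := fun h => hnot ⟨_, h2.2, hcore, by rw [hsymm, hchain N le_rfl, hfix], h⟩
  have hfun : (fun z => extChartAt (𝓡∂ n) c (branchChain (fun i => B (β.getD i 0)) ι' J.diffeo
      ((extChartAt (𝓡∂ n) c).symm z) N)) = fun z => extChartAt (𝓡∂ n) c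
      (branchChain (fun i => B (f i)) ι' J.diffeo ((extChartAt (𝓡∂ n) c).symm z) N) := by
    ext1 z
    rw [hchain N le_rfl]
  rw [hfun, hβi 0 hNpos] at hboth
  constructor
  · intro hfr
    refine hboth (Or.inr ⟨h2.2, ?_⟩)
    rw [mem_preimage, hsymm]
    exact hfr
  · refine isHyperbolicLinear_of_chart Metric.isOpen_ball h1 (mem_chartSet_of_subset
      (Metric.closedBall_subset_ball (lt_mul_of_one_lt_left hr (by norm_num))) h2) hfix
      (contMDiffAt_branchChain hD'.isSmoothEmbedding J.diffeo fun i _ => ?_) ?_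
    · rw [hf.branchChain_eq]
      exact (B (f i)).core_subset (hf i).1
    · by_contra h
      exact hboth (Or.inl h)

include hD hdisj in
/-- A periodic orbit that accumulates on an interior point of the section passes through the
interior of the target section. -/
lemma exists_isInteriorPoint_iterate {γ : Set M}
    (hγ : (closure γ ∩ (range ι \ ι '' (𝓡∂ n).boundary D)).Nonempty)
    (hper : x ∈ Function.periodicPts (poincareMap φ ι ι' J.diffeo))
    (hdom : ∀ i, (poincareMap φ ι ι' J.diffeo)^[i] x ∈ poincareDomain φ ι ι')
    (hγx : γ = {q | ∃ (i : ℕ) (t : ℝ), 0 ≤ t ∧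
        (t : EReal) < hittingTime φ (range ι) (ι' ((poincareMap φ ι ι' J.diffeo)^[i] x)) ∧
        q = φ t (ι' ((poincareMap φ ι ι' J.diffeo)^[i] x))}) :
    ∃ i, (𝓡∂ n).IsInteriorPoint ((poincareMap φ ι ι' J.diffeo)^[i] x) := by
  set P := poincareMap φ ι ι' J.diffeo with hP
  set N := Function.minimalPeriod P x with hN
  have hNpos : 0 < N := Function.minimalPeriod_pos_of_mem_periodicPts hper
  have : Nonempty D := ⟨(hdom 0).choose⟩
  have hdom' : ∀ z ∈ poincareDomain φ ι ι', ∃ y : D, ∃ t : ℝ,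
      hittingTime φ (range ι) (ι' z) = (t : EReal) ∧ φ t (ι' z) = ι y := fun z hz => hz
  choose! Y T hT hY using hdom'
  -- The orbit lies in finitely many closed trajectory segments. A point of `D` in its closure is
  -- thus on a segment: not at its start, which lies on `D'`, and not before the first hit. It is an
  -- endpoint, and the impulse sends it to an interior point of `D'`.
  have hcomp : IsCompact (⋃ i ∈ Finset.range N,
      (fun t => φ t (ι' (P^[i] x))) '' Icc 0 (T (P^[i] x))) :=
    (Finset.range N).isCompact_biUnion fun i _ =>
      isCompact_Icc.image (φ.continuous continuous_id continuous_const)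
  have hsub : γ ⊆ ⋃ i ∈ Finset.range N,
      (fun t => φ t (ι' (P^[i] x))) '' Icc 0 (T (P^[i] x)) := by
    rw [hγx]
    rintro _ ⟨i, t, ht, hlt, rfl⟩
    rw [hT _ (hdom i), EReal.coe_lt_coe_iff] at hlt
    have hmod : P^[i % N] x = P^[i] x := Function.iterate_mod_minimalPeriod_eq
    refine mem_iUnion₂.2 ⟨i % N, Finset.mem_range.2 (Nat.mod_lt _ hNpos), t, ?_, ?_⟩
    · rw [hmod]; exact ⟨ht, hlt.le⟩
    · simp only; rw [hmod]
  obtain ⟨_, hq, ⟨y, rfl⟩, hqb⟩ := hγ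
  obtain ⟨i, -, t, ht, hφ⟩ := mem_iUnion₂.1 (closure_minimal hsub hcomp.isClosed hq)
  simp only at hφ
  have ht0 : 0 < t := by
    refine ht.1.lt_of_ne fun h0 => ?_
    rw [← h0, φ.map_zero_apply] at hφ
    exact hdisj.notMem_of_mem_left ⟨y, rfl⟩ ⟨_, hφ⟩
  have htT : t = T (P^[i] x) := by
    refine ht.2.eq_or_lt.resolve_right fun hlt => ?_
    refine notMem_of_lt_hittingTime (φ := φ) (S := range ι) (p := ι' (P^[i] x)) ht0 ?_
      ⟨y, hφ.symm⟩
    rw [hT _ (hdom i)]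
    exact EReal.coe_lt_coe_iff.2 hlt
  have h1 := (poincareMap_eq (I := J.diffeo) hD.isSmoothEmbedding.isEmbedding.injective
    (htT ▸ hT _ (hdom i)) hφ).2
  refine ⟨i + 1, ?_⟩
  rw [Function.iterate_succ_apply', hP, h1, isInteriorPoint_apply_iff,
    (𝓡∂ n).isInteriorPoint_iff_not_isBoundaryPoint]
  exact fun h => hqb ⟨y, h, rfl⟩

include hD hD' hdisj hS in
/-- The periodic orbits of generic impulses are hyperbolic. -/
lemma isHyperbolicOrbit_of_generic (hJ : AvoidsBoundary φ S K K' J) {B : ℕ → Branch n φ ι}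
    (hB : ∀ p t y, φ t p = ι y → (𝓡∂ n).IsInteriorPoint y →
      ∃ i, p ∈ (B i).core ∧ (B i).time p = t ∧ (B i).proj p = y)
    (hJ' : HyperbolicBranchCycles S B J) {γ : Set M} (hγ : IsPeriodicOrbit φ ι ι' J.diffeo γ)
    (hγD : (closure γ ∩ (range ι \ ι '' (𝓡∂ n).boundary D)).Nonempty) :
    IsHyperbolicOrbit (n := n) φ ι ι' J.diffeo γ := by
  have hinj : Function.Injective ι := hD.isSmoothEmbedding.isEmbedding.injective
  obtain ⟨x₀, hper₀, hdom₀, hγx⟩ := hγ.exists_cycle hinj hdisj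
    (hγD.mono (inter_subset_inter_right _ sdiff_subset))
  obtain ⟨k, hk⟩ := exists_isInteriorPoint_iterate hD hdisj hγD hper₀ hdom₀ hγx
  set P := poincareMap φ ι ι' J.diffeo with hP
  -- The cycle is restarted at an interior point, as the genericity conditions concern chart balls
  -- around such a point.
  obtain ⟨x, hx⟩ : ∃ x, x = P^[k] x₀ := ⟨_, rfl⟩
  have hiter : ∀ i, P^[i] x = P^[i + k] x₀ := fun i => by rw [hx, Function.iterate_add_apply]
  have hdom : ∀ i, P^[i] x ∈ poincareDomain φ ι ι' := fun i => hiter i ▸ hdom₀ _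
  have hxi : (𝓡∂ n).IsInteriorPoint x := hx ▸ hk
  obtain ⟨N₀, hN₀, hper₀'⟩ := hper₀
  have hper : ∀ i, P^[i] x ∈ Function.periodicPts P := fun i =>
    ⟨N₀, hN₀, by rw [hiter]; exact hper₀'.apply_iterate _⟩
  have hback : ∀ i, ∃ j, P^[i] x₀ = P^[j] x := fun i => by
    refine ⟨i + (N₀ * k - k), ?_⟩
    have h1 : i + (N₀ * k - k) + k = i + N₀ * k := by
      have : k ≤ N₀ * k := Nat.le_mul_of_pos_left k hN₀
      omega
    rw [hiter, h1, Function.iterate_add_apply, (hper₀'.mul_const k).eq]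
  -- Flow time `0` in the avoidance of `∂D'` shows that every point of the cycle is interior. As
  -- impulses preserve boundaries, all hits of `D` are at interior points too, so branches exist
  -- along the whole cycle.
  have hint : ∀ i, (𝓡∂ n).IsInteriorPoint (P^[i] x) := fun i => by
    rw [(𝓡∂ n).isInteriorPoint_iff_not_isBoundaryPoint]
    intro h
    exact hJ.ne hD hS hxi (hper 0) hdom i 0 h (φ.map_zero_apply _)
  have hfol : ∃ f : ℕ → ℕ, FollowsBranches J.diffeo ι' (fun i => B (f i)) x := by
    have : ∀ i, ∃ j, ι' (P^[i] x) ∈ (B j).core ∧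
        hittingTime φ (range ι) (ι' (P^[i] x)) = (B j).time (ι' (P^[i] x)) ∧
        P^[i + 1] x = J.diffeo ((B j).proj (ι' (P^[i] x))) := by
      intro i
      obtain ⟨y, t, ht, hy⟩ := hdom i
      have h1 := (poincareMap_eq (I := J.diffeo) hinj ht hy).2
      have h2 := hint (i + 1)
      rw [Function.iterate_succ_apply', hP, h1, isInteriorPoint_apply_iff] at h2
      obtain ⟨j, hj1, hj2, hj3⟩ := hB _ _ _ hy h2
      refine ⟨j, hj1, by rw [hj2]; exact ht, ?_⟩
      rw [Function.iterate_succ_apply', hj3]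
      exact h1
    choose f hf using this
    exact ⟨f, hf⟩
  obtain ⟨f, hf⟩ := hfol
  have hpos : ∀ i, 0 < (B (f i)).time (ι' (P^[i] x)) := fun i => by
    have h1 := (B (f i)).flow_time _ ((B (f i)).core_subset (hf i).1)
    exact hittingTime_pos (fun h => hdisj.notMem_of_mem_left h ⟨_, rfl⟩) (hf i).2.1 ⟨_, h1.symm⟩
  have hnear : ∀ i, ∀ᶠ x' in 𝓝 (P^[i] x), ι' x' ∈ (B (f i)).dom ∧
      x' ∈ poincareDomain φ ι ι' ∧ P x' = J.diffeo ((B (f i)).proj (ι' x')) := by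
    intro i
    -- Genericity concerns the early hits of the first branch only; it is applied to the cycle
    -- rotated to start at its `i`-th point.
    have h1 := (hJ'.isHyperbolicLinear hD' hS (hint i) (hper i) (f := fun j => f (j + i))
      (hf.iterate i) rfl).1
    simp only [zero_add] at h1
    filter_upwards [eventually_hittingTime_eq hD hD' (hint i) ((B (f i)).core_subset (hf i).1)
      (hpos i) (hf i).2.1 h1] with x' hx'
    exact ⟨hx'.1, poincareMap_eq (I := J.diffeo) hinj hx'.2 ((B (f i)).flow_time _ hx'.1)⟩
  have hV : ∀ i, ∃ V : Set D', IsOpen V ∧ P^[i] x ∈ V ∧ ∀ x' ∈ V, ι' x' ∈ (B (f i)).dom ∧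
      x' ∈ poincareDomain φ ι ι' ∧ P x' = J.diffeo ((B (f i)).proj (ι' x')) := fun i => by
    obtain ⟨V, h1, h2, h3⟩ := eventually_nhds_iff.1 (hnear i)
    exact ⟨V, h2, h3, h1⟩
  choose V hVo hxV hVP using hV
  have hzero : ∀ i, ι' (P^[i] x) ∈ γ := fun i => by
    rw [hγx]
    refine ⟨i + k, 0, le_rfl, ?_, by rw [φ.map_zero_apply, hiter]⟩
    rw [← hiter, (hf i).2.1]
    exact EReal.coe_lt_coe_iff.2 (hpos i)
  set N := Function.minimalPeriod P x with hN
  have hchain : ∀ j, ∀ᶠ x' in 𝓝 x, P^[j] x' = branchChain (fun i => B (f i)) ι' J.diffeo x' j := by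
    intro j
    induction j with
    | zero => exact Eventually.of_forall fun _ => rfl
    | succ j ih =>
      have hc : ContinuousAt (fun x => branchChain (fun i => B (f i)) ι' J.diffeo x j) x :=
        (contMDiffAt_branchChain hD'.isSmoothEmbedding J.diffeo fun i _ => by
          rw [hf.branchChain_eq]
          exact (B (f i)).core_subset (hf i).1).continuousAt
      have ht := hc.tendsto
      rw [hf.branchChain_eq] at ht
      filter_upwards [ih, ht.eventually (hnear j)] with x' h1 h2
      rw [Function.iterate_succ_apply', h1, h2.2.2]
      rfl
  have hcd : ContMDiffAt (𝓡∂ n) (𝓡∂ n) 1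
      (fun x => branchChain (fun i => B (f i)) ι' J.diffeo x N) x :=
    contMDiffAt_branchChain hD'.isSmoothEmbedding J.diffeo fun i _ => by
      rw [hf.branchChain_eq]
      exact (B (f i)).core_subset (hf i).1
  refine ⟨?_, N, fun i => P^[i] x, V, Function.minimalPeriod_pos_of_mem_periodicPts (hper 0),
    fun i _ => ⟨hzero i, hVo i, hxV i, fun x' hx' => (hVP i x' hx').2.1, ?_⟩,
    fun i _ => (Function.iterate_succ_apply' P i x).symm, Function.iterate_minimalPeriod,
    Function.iterate_minimalPeriod, ?_, ?_⟩
  · rw [Set.disjoint_left]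
    rintro _ hq ⟨q, hqb, rfl⟩
    rw [hγx] at hq
    obtain ⟨i, t, -, -, h⟩ := hq
    obtain ⟨j, hj⟩ := hback i
    rw [hj] at h
    exact hJ.ne hD hS hxi (hper 0) hdom j t hqb h.symm
  · intro x' hx'
    have h1 : ContMDiffAt (𝓡∂ n) (𝓡∂ n) 1 (fun x => J.diffeo ((B (f i)).proj (ι' x))) x' := by
      have h2 : ContMDiffAt (𝓡∂ n) (𝓡∂ n) 1 (fun x => (B (f i)).proj (ι' x)) x' :=
        ContMDiffAt.comp (g := (B (f i)).proj) x'
          ((B (f i)).contMDiffAt_proj (hVP i x' hx').1)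
          ((hD'.isSmoothEmbedding.contMDiff _).of_le (by norm_cast))
      exact ContMDiffAt.comp (g := J.diffeo) x' (J.diffeo.contMDiff _) h2
    refine (h1.congr_of_eventuallyEq ?_).contMDiffWithinAt
    filter_upwards [(hVo i).mem_nhds hx'] with w hw using (hVP i w hw).2.2
  · exact (hcd.mdifferentiableAt one_ne_zero).congr_of_eventuallyEq (hchain N)
  · have h1 := (hJ'.isHyperbolicLinear hD' hS hxi (hper 0) hf hN).2
    have h2 : (mfderiv (𝓡∂ n) (𝓡∂ n) P^[N] x : EuclideanSpace ℝ (Fin n) →L[ℝ]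
        EuclideanSpace ℝ (Fin n)) = mfderiv (𝓡∂ n) (𝓡∂ n)
        (fun x => branchChain (fun i => B (f i)) ι' J.diffeo x N) x :=
      Filter.EventuallyEq.mfderiv_eq (hchain N)
    exact (congrArg (IsHyperbolicLinear (n := n)) h2).mpr h1

end GenericImpulses

end Impulsive

end

theorem proposition3p5 {n m : ℕ} [NeZero n] (hn : 2 ≤ n)
    {M : Type*} [TopologicalSpace M] [T2Space M] [CompactSpace M]
    [ChartedSpace (EuclideanSpace ℝ (Fin (n + 1))) M] [IsManifold (𝓡 (n + 1)) ∞ M]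
    (e : M → EuclideanSpace ℝ (Fin m))
    (he : Manifold.IsSmoothEmbedding (𝓡 (n + 1)) (𝓡 m) ∞ e)
    (X : ∀ p : M, TangentSpace (𝓡 (n + 1)) p) (φ : Flow ℝ M)
    (hφ : Impulsive.IsC1FlowOf X φ)
    {D : Type*} [TopologicalSpace D] [ChartedSpace (EuclideanHalfSpace n) D]
    [IsManifold (𝓡∂ n) ∞ D] (ι : D → M) (hι : Impulsive.IsCrossSection X ι)
    {D' : Type*} [TopologicalSpace D'] [ChartedSpace (EuclideanHalfSpace n) D']
    [IsManifold (𝓡∂ n) ∞ D'] (ι' : D' → M) (hι' : Impulsive.IsCrossSection X ι')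
    (hsing : ∀ p ∈ closure (Set.range ι), X p ≠ 0)
    (hdisj : Disjoint (Set.range ι) (Set.range ι')) :
    ∃ R : Set (Impulsive.Impulses n D D'),
      R ∈ @residual (Impulsive.Impulses n D D') (Impulsive.c1Topology ι ι' e) ∧
      ∀ I ∈ R, ∀ γ : Set M, Impulsive.IsPeriodicOrbit φ ι ι' I γ →
        (closure γ ∩ (Set.range ι \ ι '' (𝓡∂ n).boundary D)).Nonempty →
        Impulsive.IsHyperbolicOrbit (n := n) φ ι ι' I γ := by
  have hD := Impulsive.IsTransversal.of_isC1FlowOf hφ hι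
  have hD' := Impulsive.IsTransversal.of_isC1FlowOf hφ hι'
  have : SecondCountableTopology M :=
    ChartedSpace.secondCountable_of_sigmaCompact (EuclideanSpace ℝ (Fin (n + 1))) M
  have : SecondCountableTopology D := hι.isSmoothEmbedding.isEmbedding.secondCountableTopology
  have : SecondCountableTopology D' := hι'.isSmoothEmbedding.isEmbedding.secondCountableTopology
  have : T2Space D := hι.isSmoothEmbedding.isEmbedding.t2Space
  have : T2Space D' := hι'.isSmoothEmbedding.isEmbedding.t2Space
  have : LocallyCompactSpace D := Manifold.locallyCompact_of_finiteDimensional (𝓡∂ n)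
  have : LocallyCompactSpace D' := Manifold.locallyCompact_of_finiteDimensional (𝓡∂ n)
  obtain ⟨S, hS, hSu⟩ := TopologicalSpace.countable_cover_nhds
    (f := fun c : D' => (extChartAt (𝓡∂ n) c).source) extChartAt_source_mem_nhds
  have hSu' : ∀ x, ∃ c ∈ S, x ∈ (extChartAt (𝓡∂ n) c).source := fun x => by
    obtain ⟨c, hc, hx⟩ := Set.mem_iUnion₂.1 (hSu.symm.subset (Set.mem_univ x))
    exact ⟨c, hc, hx⟩
  by_cases hne : ∃ y : D, (𝓡∂ n).IsInteriorPoint y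
  · obtain ⟨y₀, hy₀⟩ := hne
    obtain ⟨B, hB⟩ := hD.exists_countable_branches (φ.map_zero_apply (ι y₀)) hy₀
    refine ⟨{J | Impulsive.AvoidsBoundary (ι := ι) (ι' := ι') (e := e) φ S
        (CompactExhaustion.choice D) (CompactExhaustion.choice D') J ∧
      Impulsive.HyperbolicBranchCycles (e := e) S B J},
      (Impulsive.eventually_avoidsBoundary he hD hD' hS _ _).and
        (Impulsive.eventually_hyperbolicBranchCycles he hD hD' hS B), fun J hJ γ hγ hγD => ?_⟩
    exact Impulsive.isHyperbolicOrbit_of_generic (J := J) hD hD' hdisj hSu' hJ.1 hB hJ.2 hγ hγD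
  -- Without interior points, `D \ ∂D` is empty and no orbit satisfies the condition.
  · refine ⟨Set.univ, Filter.univ_mem, fun J _ γ _ hγD => ?_⟩
    obtain ⟨_, -, ⟨y, rfl⟩, hy⟩ := hγD
    refine absurd ⟨y, ?_⟩ hne
    rw [(𝓡∂ n).isInteriorPoint_iff_not_isBoundaryPoint]
    exact fun h => hy ⟨y, h, rfl⟩
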